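/- **Setting.** Let $h:\mathbb R^{d_x}\to\mathbb R^{d_y}$, $b:\mathbb R^{d_x}\to\mathbb R^{d_x}$, $\sigma:\mathbb R^{d_x}\to\mathbb R^{d_x\times d_x}$ and $x_*\in\mathbb R^{d_x}$ (the coefficients and initial value of $dY_t=h(X_t)dt+dB_t$, $dX_t=b(X_t)dt+\sigma(X_t)dW_t$, $X_0=x_*$). Assume (D1): all entries of $h,b,\sigma$ are bounded and Lipschitz for the Euclidean norm, and $a=\sigma\sigma^*$ is uniformly elliptic, i.e. there is $c>0$ with $v^*a(x)v\ge c|v|^2$ for all $x,v$. Let $(\Omega,\overline{\mathbb P})$ be a probability space (the reference measure) carrying independent standard Brownian motions $Y$ in $\mathbb R^{d_y}$ (the data) and $W$ in $\mathbb R^{d_x}$, and let $\mathcal Y_t=\sigma(Y_s:s\le t)$. **Discretized filters.** For a level $l\in\mathbb N_0$ put $\Delta_l=2^{-l}$ and let $X^l_{0}=x_*$, $X^l_{(k+1)\Delta_l}=X^l_{k\Delta_l}+b(X^l_{k\Delta_l})\Delta_l+\sigma(X^l_{k\Delta_l})(W_{(k+1)\Delta_l}-W_{k\Delta_l})$. With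 $$G^l_k(x)=\exp\{h(x)^*(Y_{(k+1)\Delta_l}-Y_{k\Delta_l})-\tfrac{\Delta_l}{2}h(x)^*h(x)\},$$ define for $n\in\mathbb N_0$ and bounded measurable $\varphi$ $$\gamma^l_n(\varphi)=\overline{\mathbb E}\Big[\varphi(X^l_n)\prod_{k=0}^{n2^l-1}G^l_k(X^l_{k\Delta_l})\,\Big|\,\mathcal Y_n\Big],\qquad \eta^l_n(\varphi)=\frac{\gamma^l_n(\varphi)}{\gamma^l_n(1)}.$$ **Coupled particle filter.** Let $l\ge1$, $N\ge1$. For $u=(x_0,x_{\Delta_l},\dots,x_1)\in E_l=(\mathbb R^{d_x})^{2^l+1}$ put $\mathbf G^l_p(u)=\prod_{k=0}^{2^l-1}G^l_{p2^l+k}(x_{k\Delta_l})$. Let $\check M^l((x,x'),\cdot)$ be the law on $E_l\times E_{l-1}$ of a pair of Euler paths over a unit time interval with steps $\Delta_l$ and $\Delta_{l-1}$, started at $x$ and $x'$ and driven by the increments of the same Brownian motion (independent of $Y$). Given the data $Y$, generation $0$ consists of $N$ i.i.d. pairs with law $\check M^l((x_*,x_*),\cdot)$. Given generations $0,\dots,p$,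 with generation $p$ equal to $(u^i,\bar u^i)_{i\le N}$, the $N$ pairs of generation $p+1$ are i.i.d. with law $$\sum_{i,j=1}^N\Big(\mathbb 1_{\{i=j\}}\,a_i\wedge\bar a_i+(1-s)\frac{a_i-a_i\wedge\bar a_i}{1-s}\cdot\frac{\bar a_j-a_j\wedge\bar a_j}{1-s}\Big)\,\check M^l\big((u^i_1,\bar u^j_1),\cdot\big),$$ where $u^i_1$ and $\bar u^j_1$ are the endpoints of the paths $u^i$ and $\bar u^j$, $a_i=\mathbf G^l_p(u^i)/\sum_k\mathbf G^l_p(u^k)$, $\bar a_i=\mathbf G^{l-1}_p(\bar u^i)/\sum_k\mathbf G^{l-1}_p(\bar u^k)$, $s=\sum_k a_k\wedge\bar a_k$, and the second term is $0$ if $s=1$ (maximally coupled resampling). For $n\ge1$, with $(u^i,\bar u^i)_{i\le N}$ now denoting generation $n-1$, the estimate of $[\eta^l_n-\eta^{l-1}_n](\varphi)=\eta^l_n(\varphi)-\eta^{l-1}_n(\varphi)$ is $$[\eta^l_n-\eta^{l-1}_n]^N(\varphi)=\frac{\sum_i\mathbf G^l_{n-1}(u^i)\varphi(u^i_1)}{\sum_i\mathbf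 G^l_{n-1}(u^i)}-\frac{\sum_i\mathbf G^{l-1}_{n-1}(\bar u^i)\varphi(\bar u^i_1)}{\sum_i\mathbf G^{l-1}_{n-1}(\bar u^i)},$$ and for $n=0$ it is $\varphi(x_*)-\varphi(x_*)=0$. **Proposition.** Assume (D1). For every $n\in\mathbb N_0$ there is $C<\infty$ (depending only on $n$ and on $h,b,\sigma,x_*$) such that for all $l\ge1$, all $N\ge1$ and all bounded Lipschitz $\varphi:\mathbb R^{d_x}\to\mathbb R$, $$\overline{\mathbb E}\Big[\big([\eta^l_n-\eta^{l-1}_n]^N(\varphi)-[\eta^l_n-\eta^{l-1}_n](\varphi)\big)^2\Big]\le C\,(\|\varphi\|+\|\varphi\|_{\mathrm{Lip}})^2\Big(\frac{\Delta_l^{1/2}}{N}+\frac{\Delta_l^{1/4}}{N^{3/2}}\Big),$$ where $\overline{\mathbb E}$ averages over the data $Y$ and the particle system, $\|\varphi\|=\sup_x|\varphi(x)|$, and $\|\varphi\|_{\mathrm{Lip}}$ is the Lipschitz constant of $\varphi$ for the Euclidean norm. -/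

import Mathlib

open MeasureTheory ProbabilityTheory
open scoped NNReal ENNReal Matrix

noncomputable section

namespace CoupledPF

/-- `ℝ^d` with the Euclidean norm. -/
abbrev Vec (d : ℕ) : Type := EuclideanSpace ℝ (Fin d)

section Functions

/-- A bounded real-valued function. -/
def IsBddFun {E : Type*} (f : E → ℝ) : Prop := ∃ K : ℝ, ∀ x, |f x| ≤ K

/-- A real-valued function on `ℝ^d` that is Lipschitz for the Euclidean norm. -/
def IsLipFun {d : ℕ} (f : Vec d → ℝ) : Prop := ∃ K : ℝ, ∀ x y, |f x - f y| ≤ K * ‖x - y‖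

/-- The supremum norm of a (bounded) function. -/
def supNorm {E : Type*} (f : E → ℝ) : ℝ := ⨆ x, |f x|

/-- The Lipschitz constant of a (Lipschitz) function. -/
def lipConst {d : ℕ} (f : Vec d → ℝ) : ℝ :=
  sInf {K : ℝ | 0 ≤ K ∧ ∀ x y, |f x - f y| ≤ K * ‖x - y‖}

end Functions

/-- The data of the model `dY = h(X) dt + dB`, `dX = b(X) dt + σ(X) dW`, `X_0 = x0`. -/
structure FilterModel (dx dy : ℕ) where
  h : Vec dx → Vec dy
  b : Vec dx → Vec dx
  σ : Vec dx → Matrix (Fin dx) (Fin dx) ℝ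
  x0 : Vec dx

/-- The standing assumption: all entries of `σ`, `h`, `b` are bounded and Lipschitz, and
`a = σ σ*` is uniformly elliptic. -/
structure FilterModel.Regular {dx dy : ℕ} (M : FilterModel dx dy) : Prop where
  sigma_bdd : ∀ i j, IsBddFun fun x => M.σ x i j
  sigma_lip : ∀ i j, IsLipFun fun x => M.σ x i j
  elliptic : ∃ c : ℝ, 0 < c ∧ ∀ (x : Vec dx) (v : Fin dx → ℝ),
    c * (v ⬝ᵥ v) ≤ v ⬝ᵥ ((M.σ x * (M.σ x)ᵀ) *ᵥ v)
  h_bdd : ∀ i, IsBddFun fun x => M.h x i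
  h_lip : ∀ i, IsLipFun fun x => M.h x i
  b_bdd : ∀ j, IsBddFun fun x => M.b x j
  b_lip : ∀ j, IsLipFun fun x => M.b x j

/-- The step size `Δ_l = 2^{-l}`. -/
def stepSize (l : ℕ) : ℝ := ((2 : ℝ) ^ l)⁻¹

/-- The grid time `k Δ_l`. -/
def gridTime (l k : ℕ) : ℝ≥0 := (k : ℝ≥0) / 2 ^ l

/-- A `d`-dimensional standard Brownian motion (started at `0`): its coordinates are independent
real Brownian motions. -/
structure IsBrownianVec {d : ℕ} {Ω : Type*} [MeasurableSpace Ω] (B : ℝ≥0 → Ω → Vec d)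
    (P : Measure Ω) : Prop where
  measurable : ∀ t, Measurable (B t)
  brownian : ∀ i, IsBrownianReal (fun t ω => B t ω i) P
  indep : iIndepFun (fun (i : Fin d) (ω : Ω) (t : ℝ≥0) => B t ω i) P

/-- The sigma-algebra generated by the process `Y` up to time `t`. -/
@[reducible]
def historySigma {d : ℕ} {Ω : Type*} (Y : ℝ≥0 → Ω → Vec d) (t : ℝ≥0) : MeasurableSpace Ω :=
  ⨆ s : Set.Iic t, MeasurableSpace.comap (Y s) inferInstance

namespace FilterModel

variable {dx dy : ℕ} (M : FilterModel dx dy)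

/-- The Euler recursion with step `Δ_l`, started at `x`, driven by the increments `dw`. -/
def eulerChain (l : ℕ) (x : Vec dx) (dw : ℕ → Vec dx) : ℕ → Vec dx
  | 0 => x
  | k + 1 =>
    eulerChain l x dw k + stepSize l • M.b (eulerChain l x dw k)
      + Matrix.toEuclideanLin (M.σ (eulerChain l x dw k)) (dw k)

/-- The potential `G_k^l(x) = exp{h(x)*(y_{(k+1)Δ_l} - y_{kΔ_l}) - (Δ_l/2) h(x)*h(x)}` for the
data path `y`. -/
def potential (l k : ℕ) (y : ℝ≥0 → Vec dy) (x : Vec dx) : ℝ :=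
  Real.exp (inner ℝ (M.h x) (y (gridTime l (k + 1)) - y (gridTime l k))
    - stepSize l / 2 * inner ℝ (M.h x) (M.h x))

section Filter

variable {Ω : Type*} [MeasurableSpace Ω] (P : Measure Ω)
  (Y : ℝ≥0 → Ω → Vec dy) (W : ℝ≥0 → Ω → Vec dx)

/-- The Euler discretization of the signal at time `k Δ_l`, driven by `W`, started at `x0`. -/
def eulerSignal (l k : ℕ) (ω : Ω) : Vec dx :=
  M.eulerChain l M.x0 (fun j => W (gridTime l (j + 1)) ω - W (gridTime l j) ω) k

/-- The unnormalized time-discretized filter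
`γ_n^l(φ) = E[φ(X_n) Z_n^l(X_0, X_{Δ_l}, …, X_{n-Δ_l}) | 𝒴_n]` at the integer time `n`. -/
def unnormFilter (l n : ℕ) (φ : Vec dx → ℝ) : Ω → ℝ :=
  P[fun ω => φ (M.eulerSignal W l (n * 2 ^ l) ω) *
      ∏ k ∈ Finset.range (n * 2 ^ l),
        M.potential l k (fun t => Y t ω) (M.eulerSignal W l k ω) | historySigma Y (n : ℝ≥0)]

/-- The time-discretized filter `η_n^l(φ) = γ_n^l(φ) / γ_n^l(1)`. -/
def filter (l n : ℕ) (φ : Vec dx → ℝ) (ω : Ω) : ℝ :=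
  M.unnormFilter P Y W l n φ ω / M.unnormFilter P Y W l n (fun _ => 1) ω

end Filter

end FilterModel

/-- `E_l = (ℝ^{dx})^{2^l + 1}`: level-`l` paths over a unit time interval. -/
abbrev PathSpace (dx l : ℕ) : Type := Fin (2 ^ l + 1) → Vec dx

/-- Pairs consisting of a path at level `l + 1` (fine) and a path at level `l` (coarse). -/
abbrev PathPair (dx l : ℕ) : Type := PathSpace dx (l + 1) × PathSpace dx l

/-- Extension by zero of a finite family of increments. -/
def extendZero {d m : ℕ} (ξ : Fin m → Vec d) (k : ℕ) : Vec d :=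
  if hk : k < m then ξ ⟨k, hk⟩ else 0

/-- The law of the `2^l` increments over a unit interval, on the grid of mesh `Δ_l`, of a standard
Brownian motion in `ℝ^d`: independent centred Gaussians with covariance `Δ_l I`. -/
def incrementLaw (d l : ℕ) : Measure (Fin (2 ^ l) → Vec d) :=
  Measure.pi fun _ => (stdGaussian (Vec d)).map fun z => Real.sqrt (stepSize l) • z

/-- Maximal coupling of two probability vectors `a`, `a'` on `Fin N`: the pair `(i, j)` has mass
`𝟙{i = j} (a_i ∧ a'_i) + (1 - ∑ a ∧ a') ā_i ā'_j`, with `ā`, `ā'` the normalized residuals (the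
second term vanishes if `∑ a ∧ a' = 1`). -/
def maxCouplingMass {N : ℕ} (a a' : Fin N → ℝ) (i j : Fin N) : ℝ :=
  (if i = j then min (a i) (a' i) else 0)
    + (1 - ∑ k, min (a k) (a' k))
      * ((a i - min (a i) (a' i)) / ∑ k, (a k - min (a k) (a' k)))
      * ((a' j - min (a j) (a' j)) / ∑ k, (a' k - min (a k) (a' k)))

/-- The empirical mean `(1/N) ∑_i f(w_i)`. -/
def empMean {E : Type*} {N : ℕ} (w : Fin N → E) (f : E → ℝ) : ℝ := (1 / (N : ℝ)) * ∑ i, f (w i)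

namespace FilterModel

variable {dx dy : ℕ} (M : FilterModel dx dy)

/-- The product `𝐆_p^l` of the potentials along a level-`l` path over `[p, p + 1]`. -/
def pathPotential (l p : ℕ) (y : ℝ≥0 → Vec dy) (u : PathSpace dx l) : ℝ :=
  ∏ k : Fin (2 ^ l), M.potential l (p * 2 ^ l + k) y (u k.castSucc)

/-- The kernel `M̌`: Euler paths over a unit interval at levels `l + 1` and `l`, started at `x` and
`x'`, built from common Brownian increments (a coarse increment is the sum of the two fine ones). -/
def coupledEuler (l : ℕ) (x x' : Vec dx) : Measure (PathPair dx l) :=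
  (incrementLaw dx (l + 1)).map fun ξ =>
    (fun k => M.eulerChain (l + 1) x (extendZero ξ) k,
      fun k => M.eulerChain l x' (fun j => extendZero ξ (2 * j) + extendZero ξ (2 * j + 1)) k)

/-- Normalized resampling weights of the fine particles at generation `p`. -/
def fineWeight {N : ℕ} (l p : ℕ) (y : ℝ≥0 → Vec dy) (w : Fin N → PathPair dx l) (i : Fin N) : ℝ :=
  M.pathPotential (l + 1) p y (w i).1 / ∑ k, M.pathPotential (l + 1) p y (w k).1

/-- Normalized resampling weights of the coarse particles at generation `p`. -/
def coarseWeight {N : ℕ} (l p : ℕ) (y : ℝ≥0 → Vec dy) (w : Fin N → PathPair dx l)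
    (i : Fin N) : ℝ :=
  M.pathPotential l p y (w i).2 / ∑ k, M.pathPotential l p y (w k).2

/-- The law `Φ̌_{p+1}(π̌_p^N)` of one particle pair of generation `p + 1`, given the particle pairs
`w` of generation `p`: choose ancestors `(i, j)` from the maximal coupling of the resampling weights
and move the endpoints of the fine path of `w_i` and the coarse path of `w_j` by `M̌`. -/
def coupledUpdate {N : ℕ} (l p : ℕ) (y : ℝ≥0 → Vec dy) (w : Fin N → PathPair dx l) :
    Measure (PathPair dx l) :=
  ∑ i, ∑ j,
    ENNReal.ofReal (maxCouplingMass (M.fineWeight l p y w) (M.coarseWeight l p y w) i j) •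
      M.coupledEuler l ((w i).1 (Fin.last _)) ((w j).2 (Fin.last _))

/-- The conditional law of the next generation of `N` particle pairs, given the data `y` and the
first `n` generations. -/
def nextGeneration (l N : ℕ) (y : ℝ≥0 → Vec dy) :
    (n : ℕ) → (Fin n → Fin N → PathPair dx l) → Measure (Fin N → PathPair dx l)
  | 0, _ => Measure.pi fun _ => M.coupledEuler l M.x0 M.x0
  | p + 1, w => Measure.pi fun _ => M.coupledUpdate l p y (w (Fin.last p))

/-- The law, given the data `y`, of the first `n` generations (`0, …, n - 1`) of the coupled
particle filter with `N` particle pairs. -/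
def cpfLaw (l N : ℕ) (y : ℝ≥0 → Vec dy) : (n : ℕ) → Measure (Fin n → Fin N → PathPair dx l)
  | 0 => Measure.dirac Fin.elim0
  | n + 1 => (cpfLaw l N y n).bind fun w =>
      (M.nextGeneration l N y n w).map fun v =>
        (Fin.snoc w v : Fin (n + 1) → Fin N → PathPair dx l)

/-- The coupled particle filter estimate `[η_n^{l+1} - η_n^l]^N(φ)`, computed from generation
`n - 1`; at time `0` both filters are the Dirac mass at `x0`. -/
def cpfEstimate {l N : ℕ} (y : ℝ≥0 → Vec dy) (φ : Vec dx → ℝ) :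
    (n : ℕ) → (Fin n → Fin N → PathPair dx l) → ℝ
  | 0, _ => φ M.x0 - φ M.x0
  | t + 1, w =>
    empMean (w (Fin.last t)) (fun u => M.pathPotential (l + 1) t y u.1 * φ (u.1 (Fin.last _)))
        / empMean (w (Fin.last t)) (fun u => M.pathPotential (l + 1) t y u.1)
      - empMean (w (Fin.last t)) (fun u => M.pathPotential l t y u.2 * φ (u.2 (Fin.last _)))
        / empMean (w (Fin.last t)) (fun u => M.pathPotential l t y u.2)

end FilterModel

end CoupledPF

end

open CoupledPF

/-! The potentials are unbounded in the data, so nothing can be estimated in sup norm. What saves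
the argument is timing. Generation `p` of the particles depends only on the data before time `p`,
whereas the potential of time `p` involves only the data increments over `[p, p+1]`, which are
independent of that past. Given the past the particles are frozen, and each potential is log-normal
with all moments, of itself and of its inverse, bounded uniformly in the particle and the level.
Every size is therefore a conditional moment bound (`LO`, `CLO`), and such bounds are stable under
products by Cauchy–Schwarz.

Time is handled by the backward operator `step`, which maps φ to ∫ g φ dK. The filter at time `p +
1` is a ratio of filters at time `p` applied to `step φ` and `step 1`. Each induction on `p` thus
runs over a whole class `Nice` of test functions, which may depend on the data and is stable under
`step`, even after multiplication by a random factor.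

Write ε = Δ^(1/2) for the strong error of the Euler scheme. Three sizes matter. The exact filters at
the two levels differ by ε in all moments (`exactInt_diff_lo`). The particle filter at one level
fluctuates by N^(-1/2) in all moments, by the Marcinkiewicz–Zygmund inequality (`partInt_sub_lo`).
Finally, maximal coupling separates the ancestors with probability at most the ℓ¹ distance of the
two weight vectors, which is of order ε in the mean. A separated pair may be at distance of order
one, so only the mean truncated distance is controlled by ε (`meanDist_le`), and level differences
of particle quantities have second moment of order ε and not ε².

The error at time `p + 1` splits algebraically (`ratio_error_decomposition`) into three kinds of
terms. In the linear terms the fresh sampling error has second moment ε/N, and the rest is the error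
at time `p` for a random multiple of a propagated test function (`linear_so`). The quadratic terms
are a level difference with second moment ε times a fluctuation of size N^(-1/2), which by
Cauchy–Schwarz costs ε^(1/2) N^(-3/2) (`lintegral_sq_mul_le`). The terms with a level difference of
exact quantities cost ε²/N ≤ ε/N. The sum is Δ^(1/2)/N + Δ^(1/4)/N^(3/2) (`err_so`).

All of this is done for an abstract `CoupledSystem`. It remains to verify its hypotheses for the
coupled Euler schemes, uniformly in the level (`good_system`), and to identify the abstract filters
and particles with the conditional expectations (`filter_ae_eq`) and with the algorithm
(`lintegral_cpfLaw`). -/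

noncomputable section

set_option linter.unusedSectionVars false

namespace CoupledPF

/-! ### Calculus of random variables with all moments of a given order -/

section MomentCalculus

variable {Ω : Type*} [MeasurableSpace Ω] {μ : Measure Ω}

/-- Moment inequalities are proved after squaring. This turns a product of constants back into a
square, so that no square roots of constants appear. -/
lemma mul_le_sq_add (a b : ℝ≥0) : a * b ≤ (a + b) ^ 2 :=
  calc a * b ≤ a * b + (a ^ 2 + a * b + b ^ 2) := le_self_add
    _ = (a + b) ^ 2 := by ring

/-- Cauchy–Schwarz for the lower integral. -/
lemma sq_lintegral_mul_le {f g : Ω → ℝ≥0∞} (hf : AEMeasurable f μ) (hg : AEMeasurable g μ) :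
    (∫⁻ ω, f ω * g ω ∂μ) ^ 2 ≤ (∫⁻ ω, f ω ^ 2 ∂μ) * ∫⁻ ω, g ω ^ 2 ∂μ := by
  have h := ENNReal.lintegral_mul_le_Lp_mul_Lq μ Real.HolderConjugate.two_two hf hg
  calc (∫⁻ ω, f ω * g ω ∂μ) ^ 2
      ≤ ((∫⁻ a, f a ^ (2 : ℝ) ∂μ) ^ (1 / 2 : ℝ) * (∫⁻ a, g a ^ (2 : ℝ) ∂μ) ^ (1 / 2 : ℝ)) ^ 2 := by
        gcongr; exact h
    _ = _ := by
        rw [mul_pow]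
        simp only [← ENNReal.rpow_natCast, ← ENNReal.rpow_mul]
        norm_num

lemma sq_lintegral_le [IsProbabilityMeasure μ] {f : Ω → ℝ≥0∞} (hf : AEMeasurable f μ) :
    (∫⁻ ω, f ω ∂μ) ^ 2 ≤ ∫⁻ ω, f ω ^ 2 ∂μ := by
  simpa using sq_lintegral_mul_le (μ := μ) hf (aemeasurable_const (b := (1 : ℝ≥0∞)))

/-- Jensen's inequality for powers of the lower integral. -/
lemma pow_lintegral_le [IsProbabilityMeasure μ] {f : Ω → ℝ≥0∞} (hf : AEMeasurable f μ) (r : ℕ) :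
    (∫⁻ ω, f ω ∂μ) ^ r ≤ ∫⁻ ω, f ω ^ r ∂μ := by
  rcases Nat.eq_zero_or_pos r with rfl | hr
  · simp
  rcases Nat.eq_or_lt_of_le hr with h1 | h1
  · simp [← h1]
  have hp : (1 : ℝ) < r := by exact_mod_cast h1
  have h := ENNReal.lintegral_mul_le_Lp_mul_Lq μ (Real.HolderConjugate.conjExponent hp) hf
    (aemeasurable_const (b := (1 : ℝ≥0∞)))
  simp only [Pi.mul_apply, mul_one, ENNReal.one_rpow, lintegral_const, measure_univ] at h
  calc (∫⁻ ω, f ω ∂μ) ^ r ≤ ((∫⁻ ω, f ω ^ (r : ℝ) ∂μ) ^ (1 / (r : ℝ))) ^ r := by gcongr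
    _ = _ := by
        rw [← ENNReal.rpow_natCast, ← ENNReal.rpow_mul, one_div_mul_cancel (by positivity),
          ENNReal.rpow_one]
        simp

/-- All moments of the random variable `f` are bounded by those of a quantity of size `ε`: the
`r`-th absolute moment is at most `C r * ε ^ r`. -/
structure LO (μ : Measure Ω) (f : Ω → ℝ) (ε : ℝ≥0) (C : ℕ → ℝ≥0) : Prop where
  meas : Measurable f
  bound : ∀ r : ℕ, ∫⁻ ω, ‖f ω‖ₑ ^ r ∂μ ≤ C r * (ε : ℝ≥0∞) ^ r

/-- Moment constants for products. -/
def mulC (C C' : ℕ → ℝ≥0) (r : ℕ) : ℝ≥0 := C (2 * r) + C' (2 * r)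

/-- Moment constants for sums. -/
def addC (C C' : ℕ → ℝ≥0) (r : ℕ) : ℝ≥0 := 2 ^ r * (C r + C' r)

namespace LO

variable {f g : Ω → ℝ} {ε δ : ℝ≥0} {C C' : ℕ → ℝ≥0}

lemma enorm_meas (hf : LO μ f ε C) : Measurable fun ω => ‖f ω‖ₑ := hf.meas.enorm

lemma mono (hf : LO μ f ε C) (h : ε ≤ δ) : LO μ f δ C where
  meas := hf.meas
  bound r := (hf.bound r).trans (by gcongr)

lemma mono_const (hf : LO μ f ε C) (h : ∀ r, C r ≤ C' r) : LO μ f ε C' where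
  meas := hf.meas
  bound r := (hf.bound r).trans (by gcongr; exact h r)

lemma neg (hf : LO μ f ε C) : LO μ (fun ω => -f ω) ε C where
  meas := hf.meas.neg
  bound r := by simpa using hf.bound r

/-- Cauchy–Schwarz, at the price of doubling the order of the moments. This is why the bounds are
required for every `r`. -/
lemma mul (hf : LO μ f ε C) (hg : LO μ g δ C') :
    LO μ (fun ω => f ω * g ω) (ε * δ) (mulC C C') where
  meas := hf.meas.mul hg.meas
  bound r := by
    rw [← ENNReal.pow_le_pow_left_iff two_ne_zero]
    calc (∫⁻ ω, ‖f ω * g ω‖ₑ ^ r ∂μ) ^ 2 = (∫⁻ ω, ‖f ω‖ₑ ^ r * ‖g ω‖ₑ ^ r ∂μ) ^ 2 := by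
          simp only [enorm_mul, mul_pow]
      _ ≤ _ := sq_lintegral_mul_le (hf.enorm_meas.pow_const r).aemeasurable
          (hg.enorm_meas.pow_const r).aemeasurable
      _ = (∫⁻ ω, ‖f ω‖ₑ ^ (2 * r) ∂μ) * ∫⁻ ω, ‖g ω‖ₑ ^ (2 * r) ∂μ := by
          simp only [← pow_mul, mul_comm r 2]
      _ ≤ (C (2 * r) * (ε : ℝ≥0∞) ^ (2 * r)) * (C' (2 * r) * (δ : ℝ≥0∞) ^ (2 * r)) := by
          gcongr
          · exact hf.bound _
          · exact hg.bound _
      _ = (C (2 * r) * C' (2 * r)) * (((ε * δ : ℝ≥0) : ℝ≥0∞) ^ r) ^ 2 := by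
          push_cast; ring
      _ ≤ _ := by
          rw [mul_pow]
          gcongr
          simp only [mulC]
          norm_cast
          exact mul_le_sq_add _ _

lemma add (hf : LO μ f ε C) (hg : LO μ g ε C') :
    LO μ (fun ω => f ω + g ω) ε (addC C C') where
  meas := hf.meas.add hg.meas
  bound r := by
    have key : ∀ x y : ℝ≥0∞, (x + y) ^ r ≤ 2 ^ r * (x ^ r + y ^ r) := by
      intro x y
      wlog h : x ≤ y generalizing x y
      · rw [add_comm x y, add_comm (x ^ r)]; exact this y x (le_of_not_ge h)
      calc (x + y) ^ r ≤ (2 * y) ^ r := by rw [two_mul]; gcongr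
        _ = 2 ^ r * y ^ r := mul_pow _ _ _
        _ ≤ _ := by gcongr; exact le_add_self
    calc ∫⁻ ω, ‖f ω + g ω‖ₑ ^ r ∂μ ≤ ∫⁻ ω, 2 ^ r * (‖f ω‖ₑ ^ r + ‖g ω‖ₑ ^ r) ∂μ :=
          lintegral_mono fun ω => (pow_le_pow_left' (enorm_add_le _ _) r).trans (key _ _)
      _ = 2 ^ r * ((∫⁻ ω, ‖f ω‖ₑ ^ r ∂μ) + ∫⁻ ω, ‖g ω‖ₑ ^ r ∂μ) := by
          rw [← lintegral_add_left (hf.enorm_meas.pow_const r)]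
          exact lintegral_const_mul _
            ((hf.enorm_meas.pow_const r).add (hg.enorm_meas.pow_const r))
      _ ≤ 2 ^ r * (C r * (ε : ℝ≥0∞) ^ r + C' r * (ε : ℝ≥0∞) ^ r) := by
          gcongr
          · exact hf.bound r
          · exact hg.bound r
      _ = _ := by simp only [addC]; push_cast; ring

lemma sub (hf : LO μ f ε C) (hg : LO μ g ε C') :
    LO μ (fun ω => f ω - g ω) ε (addC C C') := by
  simpa only [sub_eq_add_neg] using hf.add hg.neg

lemma of_enorm_le (hg : LO μ g ε C) (hf : Measurable f) (h : ∀ ω, ‖f ω‖ₑ ≤ ‖g ω‖ₑ) :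
    LO μ f ε C where
  meas := hf
  bound r := (lintegral_mono fun ω => pow_le_pow_left' (h ω) r).trans (hg.bound r)

lemma of_abs_le (hg : LO μ g ε C) (hf : Measurable f) (h : ∀ ω, |f ω| ≤ |g ω|) :
    LO μ f ε C :=
  hg.of_enorm_le hf fun ω => by
    rw [← ofReal_norm, ← ofReal_norm]
    exact ENNReal.ofReal_le_ofReal (h ω)

/-- Even moments suffice: by Jensen the squared `r`-th moment is at most the moment of order `2 *
r`. The added `1` avoids a square root of the constant. -/
lemma of_even [IsProbabilityMeasure μ] (hf : Measurable f)
    (h : ∀ m : ℕ, ∫⁻ ω, ‖f ω‖ₑ ^ (2 * m) ∂μ ≤ C m * (ε : ℝ≥0∞) ^ (2 * m)) :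
    LO μ f ε (fun r => C r + 1) where
  meas := hf
  bound r := by
    rw [← ENNReal.pow_le_pow_left_iff two_ne_zero]
    calc (∫⁻ ω, ‖f ω‖ₑ ^ r ∂μ) ^ 2 ≤ ∫⁻ ω, (‖f ω‖ₑ ^ r) ^ 2 ∂μ :=
          sq_lintegral_le (hf.enorm.pow_const r).aemeasurable
      _ = ∫⁻ ω, ‖f ω‖ₑ ^ (2 * r) ∂μ := by simp only [← pow_mul, mul_comm r 2]
      _ ≤ _ := h r
      _ ≤ _ := by
          rw [mul_pow, mul_comm 2 r, pow_mul]
          gcongr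
          norm_cast
          simpa using mul_le_sq_add (C r) 1

lemma bound_one (hf : LO μ f ε C) : ∫⁻ ω, ‖f ω‖ₑ ∂μ ≤ C 1 * ε := by
  simpa using hf.bound 1

lemma const [IsProbabilityMeasure μ] (c : ℝ) (h : |c| ≤ ε) : LO μ (fun _ => c) ε (fun _ => 1) where
  meas := measurable_const
  bound r := by
    have : ‖c‖ₑ ≤ ε := by
      rw [← ofReal_norm, Real.norm_eq_abs]
      exact (ENNReal.ofReal_le_ofReal h).trans (by simp)
    simpa using pow_le_pow_left' this r

lemma comp {Ω' : Type*} [MeasurableSpace Ω'] {μ' : Measure Ω'} {T : Ω' → Ω}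
    (hT : MeasurePreserving T μ' μ) (hf : LO μ f ε C) : LO μ' (fun ω => f (T ω)) ε C where
  meas := hf.meas.comp hT.measurable
  bound r := by
    rw [hT.lintegral_comp (f := fun ω => ‖f ω‖ₑ ^ r) (hf.enorm_meas.pow_const r)]
    exact hf.bound r

end LO

/-- If `S` has second moment at most `c * ε` and `S`, `X` are of size `δ` in all moments, then
`S * X` has second moment of order `ε ^ (1 / 2) * δ ^ 3`. -/
lemma lintegral_sq_mul_le {S X : Ω → ℝ} {η δ : ℝ≥0} {c : ℝ≥0} {C C' : ℕ → ℝ≥0}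
    (hS2 : ∫⁻ ω, ‖S ω‖ₑ ^ 2 ∂μ ≤ c * (η : ℝ≥0∞) ^ 2) (hS : LO μ S δ C) (hX : LO μ X δ C') :
    ∫⁻ ω, ‖S ω * X ω‖ₑ ^ 2 ∂μ ≤
      (c + mulC (mulC C C') C' 2 : ℝ≥0) * ((η : ℝ≥0∞) * (δ : ℝ≥0∞) ^ 3) := by
  rw [← ENNReal.pow_le_pow_left_iff two_ne_zero]
  -- The square S²X² is split as |S| · |S X X|. The first factor contributes the small second
  -- moment, the second has the crude size δ³ in all moments.
  have hSXX := ((hS.mul hX).mul hX).bound 2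
  calc (∫⁻ ω, ‖S ω * X ω‖ₑ ^ 2 ∂μ) ^ 2
      = (∫⁻ ω, ‖S ω‖ₑ * ‖S ω * X ω * X ω‖ₑ ∂μ) ^ 2 := by
        congr 2; ext ω; simp only [enorm_mul]; ring
    _ ≤ _ := sq_lintegral_mul_le hS.enorm_meas.aemeasurable
        ((hS.mul hX).mul hX).enorm_meas.aemeasurable
    _ = (∫⁻ ω, ‖S ω‖ₑ ^ 2 ∂μ) * ∫⁻ ω, ‖S ω * X ω * X ω‖ₑ ^ 2 ∂μ := rfl
    _ ≤ (c * (η : ℝ≥0∞) ^ 2) *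
        ((mulC (mulC C C') C' 2 : ℝ≥0) * ((δ * δ * δ : ℝ≥0) : ℝ≥0∞) ^ 2) :=
        mul_le_mul' hS2 hSXX
    _ = (c * mulC (mulC C C') C' 2 : ℝ≥0) * ((η : ℝ≥0∞) * (δ : ℝ≥0∞) ^ 3) ^ 2 := by
        push_cast; ring
    _ ≤ _ := by
        rw [mul_pow ((c + mulC (mulC C C') C' 2 : ℝ≥0) : ℝ≥0∞)]
        gcongr
        norm_cast
        exact mul_le_sq_add _ _

end MomentCalculus

end CoupledPF

namespace CoupledPF

/-! ### Expansion of even moments to second order -/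

section EvenMoments

/-- The constant of the second-order expansion of even powers. -/
def evenPowConst : ℕ → ℝ
  | 0 => 1
  | k + 1 => 1 + 8 * (k + 1) + 6 * evenPowConst k

lemma evenPowConst_pos : ∀ k, 0 < evenPowConst k
  | 0 => one_pos
  | k + 1 => by
    have := evenPowConst_pos k
    simp only [evenPowConst]; positivity

lemma pow_mul_pow_four_le {x y : ℝ} (k : ℕ) (hx : 0 ≤ x) (hy : 0 ≤ y) :
    x ^ (2 * k) * y ^ 4 ≤ x ^ (2 * k + 2) * y ^ 2 + y ^ (2 * k + 4) := by
  rcases le_total y x with h | h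
  · have : x ^ (2 * k) * y ^ 4 ≤ x ^ (2 * k + 2) * y ^ 2 := by
      calc x ^ (2 * k) * y ^ 4 = x ^ (2 * k) * (y ^ 2 * y ^ 2) := by ring
        _ ≤ x ^ (2 * k) * (x ^ 2 * y ^ 2) := by gcongr
        _ = _ := by ring
    have h2 : 0 ≤ y ^ (2 * k + 4) := by positivity
    linarith
  · have : x ^ (2 * k) * y ^ 4 ≤ y ^ (2 * k + 4) := by
      calc x ^ (2 * k) * y ^ 4 ≤ y ^ (2 * k) * y ^ 4 := by gcongr
        _ = _ := by ring
    have h2 : 0 ≤ x ^ (2 * k + 2) * y ^ 2 := by positivity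
    linarith

lemma sq_mul_pow_le {x y : ℝ} (k : ℕ) (hx : 0 ≤ x) (hy : 0 ≤ y) :
    x ^ 2 * y ^ (2 * k + 2) ≤ x ^ (2 * k + 2) * y ^ 2 + y ^ (2 * k + 4) := by
  rcases le_total y x with h | h
  · have : x ^ 2 * y ^ (2 * k + 2) ≤ x ^ (2 * k + 2) * y ^ 2 := by
      calc x ^ 2 * y ^ (2 * k + 2) = x ^ 2 * (y ^ (2 * k) * y ^ 2) := by ring
        _ ≤ x ^ 2 * (x ^ (2 * k) * y ^ 2) := by gcongr
        _ = _ := by ring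
    have h2 : 0 ≤ y ^ (2 * k + 4) := by positivity
    linarith
  · have : x ^ 2 * y ^ (2 * k + 2) ≤ y ^ (2 * k + 4) := by
      calc x ^ 2 * y ^ (2 * k + 2) ≤ y ^ 2 * y ^ (2 * k + 2) := by gcongr
        _ = _ := by ring
    have h2 : 0 ≤ x ^ (2 * k + 2) * y ^ 2 := by positivity
    linarith

/-- Here `x`, `y` play the role of two norms and `c` of the inner product, so the base is a squared
norm of a sum. The term linear in `c` keeps its exact coefficient, because it vanishes or becomes a
drift after integration. All other terms carry at least two powers of `y`, and mixed products are
absorbed in the two extreme ones. -/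
lemma even_pow_expansion {x y c : ℝ} (hx : 0 ≤ x) (hy : 0 ≤ y) (hc : |c| ≤ x * y) (k : ℕ) :
    (x ^ 2 + 2 * c + y ^ 2) ^ (k + 1) ≤ x ^ (2 * k + 2) + 2 * (k + 1) * x ^ (2 * k) * c
      + evenPowConst k * (x ^ (2 * k) * y ^ 2 + y ^ (2 * k + 2)) := by
  induction k with
  | zero => simp [evenPowConst]; positivity
  | succ k ih =>
    obtain ⟨hc1, hc2⟩ := abs_le.1 hc
    have hC := evenPowConst_pos k
    set C := evenPowConst k
    set P := x ^ (2 * k + 2) * y ^ 2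
    set Q := y ^ (2 * k + 4)
    have hP : 0 ≤ P := by positivity
    have hQ : 0 ≤ Q := by positivity
    have hs : 0 ≤ x ^ 2 + 2 * c + y ^ 2 := by nlinarith [sq_nonneg (x - y)]
    have hs2 : x ^ 2 + 2 * c + y ^ 2 ≤ 2 * (x ^ 2 + y ^ 2) := by nlinarith [sq_nonneg (x - y)]
    have h1 : x ^ (2 * k) * y ^ 4 ≤ P + Q := pow_mul_pow_four_le k hx hy
    have h2 : x ^ 2 * y ^ (2 * k + 2) ≤ P + Q := sq_mul_pow_le k hx hy
    have h3 : 2 * c ^ 2 + c * y ^ 2 ≤ 3 * (x ^ 2 * y ^ 2) + y ^ 4 := by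
      have e1 : c ^ 2 ≤ (x * y) ^ 2 := sq_le_sq' hc1 hc2
      have e2 : c * y ^ 2 ≤ x * y * y ^ 2 := by gcongr
      nlinarith [mul_nonneg (sq_nonneg y) (sq_nonneg (x - y)), mul_nonneg hx hy,
        mul_nonneg (mul_nonneg hx hy) (sq_nonneg y), sq_nonneg (x * y), sq_nonneg (y ^ 2)]
    have h4 : x ^ (2 * k) * (2 * c ^ 2 + c * y ^ 2) ≤ 4 * (P + Q) := by
      calc x ^ (2 * k) * (2 * c ^ 2 + c * y ^ 2)
          ≤ x ^ (2 * k) * (3 * (x ^ 2 * y ^ 2) + y ^ 4) := by gcongr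
        _ = 3 * P + x ^ (2 * k) * y ^ 4 := by simp only [P]; ring
        _ ≤ _ := by linarith
    have h5 : (x ^ 2 + 2 * c + y ^ 2) * (x ^ (2 * k) * y ^ 2 + y ^ (2 * k + 2)) ≤ 6 * (P + Q) := by
      calc _ ≤ 2 * (x ^ 2 + y ^ 2) * (x ^ (2 * k) * y ^ 2 + y ^ (2 * k + 2)) := by gcongr
        _ = 2 * (P + Q + x ^ (2 * k) * y ^ 4 + x ^ 2 * y ^ (2 * k + 2)) := by
          simp only [P, Q]; ring
        _ ≤ _ := by linarith
    calc (x ^ 2 + 2 * c + y ^ 2) ^ (k + 1 + 1)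
        = (x ^ 2 + 2 * c + y ^ 2) * (x ^ 2 + 2 * c + y ^ 2) ^ (k + 1) := by ring
      _ ≤ (x ^ 2 + 2 * c + y ^ 2) * (x ^ (2 * k + 2) + 2 * (k + 1) * x ^ (2 * k) * c
          + C * (x ^ (2 * k) * y ^ 2 + y ^ (2 * k + 2))) := by gcongr
      _ = x ^ (2 * (k + 1) + 2) + 2 * ((k : ℝ) + 1 + 1) * x ^ (2 * (k + 1)) * c + P
          + 2 * (k + 1) * (x ^ (2 * k) * (2 * c ^ 2 + c * y ^ 2))
          + C * ((x ^ 2 + 2 * c + y ^ 2) * (x ^ (2 * k) * y ^ 2 + y ^ (2 * k + 2))) := by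
        simp only [P]; ring
      _ ≤ x ^ (2 * (k + 1) + 2) + 2 * ((k : ℝ) + 1 + 1) * x ^ (2 * (k + 1)) * c + (P + Q)
          + 2 * (k + 1) * (4 * (P + Q)) + C * (6 * (P + Q)) := by
        gcongr; linarith
      _ = _ := by simp only [evenPowConst, P, Q, C]; push_cast; ring

variable {E : Type*} [NormedAddCommGroup E] [InnerProductSpace ℝ E]

lemma norm_add_pow_even_le (a b : E) (k : ℕ) :
    ‖a + b‖ ^ (2 * k + 2) ≤ ‖a‖ ^ (2 * k + 2) + 2 * (k + 1) * ‖a‖ ^ (2 * k) * inner ℝ a b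
      + evenPowConst k * (‖a‖ ^ (2 * k) * ‖b‖ ^ 2 + ‖b‖ ^ (2 * k + 2)) := by
  have h := even_pow_expansion (norm_nonneg a) (norm_nonneg b) (abs_real_inner_le_norm a b) k
  rw [← norm_add_sq_real, ← pow_mul] at h
  convert h using 2; ring

/-- Even moments of `a + ζ` for a random vector `ζ` and a fixed vector `a`. -/
lemma lintegral_norm_add_pow_even_le [CompleteSpace E] {Z : Type*} [MeasurableSpace Z]
    {μ : Measure Z} [IsProbabilityMeasure μ] {ζ : Z → E} (k : ℕ) (hζ : Integrable ζ μ)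
    (h2 : Integrable (fun z => ‖ζ z‖ ^ 2) μ) (hk : Integrable (fun z => ‖ζ z‖ ^ (2 * k + 2)) μ)
    (a : E) :
    ∫⁻ z, ENNReal.ofReal (‖a + ζ z‖ ^ (2 * k + 2)) ∂μ ≤ ENNReal.ofReal (‖a‖ ^ (2 * k + 2)
      + 2 * (k + 1) * ‖a‖ ^ (2 * k) * inner ℝ a (∫ z, ζ z ∂μ)
      + evenPowConst k * (‖a‖ ^ (2 * k) * ∫ z, ‖ζ z‖ ^ 2 ∂μ + ∫ z, ‖ζ z‖ ^ (2 * k + 2) ∂μ)) := by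
  have i1 : Integrable (fun z => inner ℝ a (ζ z)) μ := hζ.const_inner a
  have i2 : Integrable (fun z => ‖a‖ ^ (2 * k + 2) + 2 * (k + 1) * ‖a‖ ^ (2 * k) * inner ℝ a (ζ z)
      + evenPowConst k * (‖a‖ ^ (2 * k) * ‖ζ z‖ ^ 2 + ‖ζ z‖ ^ (2 * k + 2))) μ :=
    ((integrable_const _).add (i1.const_mul _)).add (((h2.const_mul _).add hk).const_mul _)
  calc _ ≤ ∫⁻ z, ENNReal.ofReal (‖a‖ ^ (2 * k + 2)
        + 2 * (k + 1) * ‖a‖ ^ (2 * k) * inner ℝ a (ζ z)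
        + evenPowConst k * (‖a‖ ^ (2 * k) * ‖ζ z‖ ^ 2 + ‖ζ z‖ ^ (2 * k + 2))) ∂μ :=
        lintegral_mono fun z => ENNReal.ofReal_le_ofReal (norm_add_pow_even_le a (ζ z) k)
    _ = ENNReal.ofReal (∫ z, (‖a‖ ^ (2 * k + 2)
        + 2 * (k + 1) * ‖a‖ ^ (2 * k) * inner ℝ a (ζ z)
        + evenPowConst k * (‖a‖ ^ (2 * k) * ‖ζ z‖ ^ 2 + ‖ζ z‖ ^ (2 * k + 2))) ∂μ) := by
        refine (ofReal_integral_eq_lintegral_ofReal i2 (ae_of_all _ fun z => ?_)).symm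
        exact (by positivity : (0 : ℝ) ≤ ‖a + ζ z‖ ^ (2 * k + 2)).trans
          (norm_add_pow_even_le a (ζ z) k)
    _ = _ := by
        congr 1
        have j1 := i1.const_mul (2 * (k + 1) * ‖a‖ ^ (2 * k))
        have j2 := h2.const_mul (‖a‖ ^ (2 * k))
        have j3 : Integrable (fun z => ‖a‖ ^ (2 * k + 2)
            + 2 * (k + 1) * ‖a‖ ^ (2 * k) * inner ℝ a (ζ z)) μ := (integrable_const _).add j1
        have j4 : Integrable (fun z => evenPowConst k * (‖a‖ ^ (2 * k) * ‖ζ z‖ ^ 2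
            + ‖ζ z‖ ^ (2 * k + 2))) μ := (j2.add hk).const_mul _
        rw [integral_add j3 j4, integral_add (integrable_const _) j1, integral_const_mul,
          integral_const_mul, integral_add j2 hk, integral_const_mul, integral_inner hζ]
        simp

/-- Chebyshev-type comparison of moments. -/
lemma lintegral_pow_mul_sq_le {Z : Type*} [MeasurableSpace Z] {μ : Measure Z}
    [IsProbabilityMeasure μ] {u : Z → ℝ≥0∞} (hu : Measurable u) (m : ℕ) :
    (∫⁻ z, u z ^ (2 * m) ∂μ) * ∫⁻ z, u z ^ 2 ∂μ ≤ 2 * ∫⁻ z, u z ^ (2 * m + 2) ∂μ := by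
  have key : ∀ a b : ℝ≥0∞, a ^ (2 * m) * b ^ 2 ≤ a ^ (2 * m + 2) + b ^ (2 * m + 2) := by
    intro a b
    rcases le_total a b with h | h
    · calc a ^ (2 * m) * b ^ 2 ≤ b ^ (2 * m) * b ^ 2 := by gcongr
        _ = b ^ (2 * m + 2) := by ring
        _ ≤ _ := le_add_self
    · calc a ^ (2 * m) * b ^ 2 ≤ a ^ (2 * m) * a ^ 2 := by gcongr
        _ = a ^ (2 * m + 2) := by ring
        _ ≤ _ := le_self_add
  calc (∫⁻ z, u z ^ (2 * m) ∂μ) * ∫⁻ z, u z ^ 2 ∂μ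
      = ∫⁻ z, ∫⁻ z', u z ^ (2 * m) * u z' ^ 2 ∂μ ∂μ := by
        rw [← lintegral_mul_const _ (hu.pow_const _)]
        refine lintegral_congr fun z => ?_
        rw [lintegral_const_mul _ (hu.pow_const _)]
    _ ≤ ∫⁻ z, ∫⁻ z', (u z ^ (2 * m + 2) + u z' ^ (2 * m + 2)) ∂μ ∂μ :=
        lintegral_mono fun z => lintegral_mono fun z' => key _ _
    _ = _ := by
        simp only [lintegral_add_left measurable_const, lintegral_const, measure_univ, mul_one]
        rw [lintegral_add_left (hu.pow_const _)]
        simp [two_mul]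

end EvenMoments

/-! ### Moments of sums and averages of independent variables -/

section MarcinkiewiczZygmund

/-- The constants of the Marcinkiewicz–Zygmund inequality for even moments. -/
def mzConst : ℕ → ℝ≥0
  | 0 => 1
  | m + 1 => (evenPowConst m).toNNReal * (2 * mzConst m + 1)

/-- Double induction, on the order of the moment and on the number of terms. The bound `c` serves
integrability only and does not enter the estimate: the potentials are bounded for fixed data, but
not uniformly in the data. -/
lemma lintegral_sum_pow_le {Z : Type*} [MeasurableSpace Z] {μ : Measure Z}
    [IsProbabilityMeasure μ] {ζ : Z → ℝ} (hζ : Measurable ζ) {c : ℝ} (hb : ∀ z, |ζ z| ≤ c)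
    (h0 : ∫ z, ζ z ∂μ = 0) (m n : ℕ) :
    ∫⁻ v : Fin n → Z, ‖∑ i, ζ (v i)‖ₑ ^ (2 * m) ∂(Measure.pi fun _ => μ) ≤
      mzConst m * n ^ m * ∫⁻ z, ‖ζ z‖ₑ ^ (2 * m) ∂μ := by
  induction m generalizing n with
  | zero => simp [mzConst]
  | succ m ihm =>
    induction n with
    | zero => simp
    | succ n ihn =>
      have hint : ∀ r : ℕ, Integrable (fun z => ‖ζ z‖ ^ r) μ := fun r =>
        Integrable.of_bound (hζ.norm.pow_const r).aestronglyMeasurable (c ^ r)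
          (ae_of_all _ fun z => by
            rw [norm_pow, norm_norm]
            exact pow_le_pow_left₀ (norm_nonneg _) (hb z) r)
      have hζi : Integrable ζ μ := Integrable.of_bound hζ.aestronglyMeasurable c (ae_of_all _ hb)
      have hof : ∀ r : ℕ, ENNReal.ofReal (∫ z, ‖ζ z‖ ^ r ∂μ) = ∫⁻ z, ‖ζ z‖ₑ ^ r ∂μ := by
        intro r
        rw [ofReal_integral_eq_lintegral_ofReal (hint r) (ae_of_all _ fun z => by positivity)]
        refine lintegral_congr fun z => ?_
        rw [ENNReal.ofReal_pow (norm_nonneg _), ofReal_norm]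
      -- Adding one centred term to a frozen sum `a`: the linear term of the expansion integrates to
      -- zero.
      have step : ∀ a : ℝ, ∫⁻ z, ‖a + ζ z‖ₑ ^ (2 * (m + 1)) ∂μ ≤ ‖a‖ₑ ^ (2 * (m + 1)) +
          (evenPowConst m).toNNReal * (‖a‖ₑ ^ (2 * m) * (∫⁻ z, ‖ζ z‖ₑ ^ 2 ∂μ)
            + ∫⁻ z, ‖ζ z‖ₑ ^ (2 * (m + 1)) ∂μ) := by
        intro a
        have h := lintegral_norm_add_pow_even_le m hζi (hint 2) (hint (2 * m + 2)) a
        rw [h0, inner_zero_right, mul_zero, add_zero] at h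
        have e : ∀ x : ℝ, ‖x‖ₑ ^ (2 * (m + 1)) = ENNReal.ofReal (‖x‖ ^ (2 * m + 2)) := by
          intro x
          rw [ENNReal.ofReal_pow (norm_nonneg _), ofReal_norm]; rfl
        simp only [e]
        refine h.trans (le_of_eq ?_)
        have p1 : 0 ≤ ∫ z, ‖ζ z‖ ^ 2 ∂μ := integral_nonneg fun z => by positivity
        have p2 : 0 ≤ ∫ z, ‖ζ z‖ ^ (2 * m + 2) ∂μ := integral_nonneg fun z => by positivity
        have p3 := (evenPowConst_pos m).le
        rw [ENNReal.ofReal_add (by positivity) (by positivity), ENNReal.ofReal_mul p3,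
          ENNReal.ofReal_add (by positivity) p2, ENNReal.ofReal_mul (by positivity), hof, hof,
          ENNReal.ofReal_pow (norm_nonneg a) (2 * m), ofReal_norm]
        congr 3
        refine lintegral_congr fun z => ?_
        rw [ENNReal.ofReal_pow (norm_nonneg _), ofReal_norm]
      -- One coordinate is split off and integrated first, with the sum of the others frozen.
      have hmp := (measurePreserving_piFinSuccAbove (fun _ : Fin (n + 1) => μ) 0).symm
      have hsum : Measurable fun v : Fin (n + 1) → Z => ‖∑ i, ζ (v i)‖ₑ ^ (2 * (m + 1)) := by
        fun_prop
      have hsum' : Measurable fun v : Fin n → Z => ‖∑ i, ζ (v i)‖ₑ := by fun_prop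
      rw [← hmp.lintegral_comp hsum]
      rw [lintegral_prod_symm' (fun a => ‖∑ i, ζ ((MeasurableEquiv.piFinSuccAbove
        (fun _ => Z) 0).symm a i)‖ₑ ^ (2 * (m + 1))) (hsum.comp hmp.measurable)]
      set M2 := ∫⁻ z, ‖ζ z‖ₑ ^ 2 ∂μ
      set M := ∫⁻ z, ‖ζ z‖ₑ ^ (2 * (m + 1)) ∂μ
      calc _ ≤ ∫⁻ v : Fin n → Z, (‖∑ i, ζ (v i)‖ₑ ^ (2 * (m + 1)) +
            (evenPowConst m).toNNReal * (‖∑ i, ζ (v i)‖ₑ ^ (2 * m) * M2 + M))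
              ∂(Measure.pi fun _ => μ) := by
            refine lintegral_mono fun v => ?_
            refine le_trans (le_of_eq ?_) (step _)
            refine lintegral_congr fun z => ?_
            simp [Fin.sum_univ_succ, add_comm, MeasurableEquiv.piFinSuccAbove]
        _ = (∫⁻ v : Fin n → Z, ‖∑ i, ζ (v i)‖ₑ ^ (2 * (m + 1)) ∂(Measure.pi fun _ => μ)) +
            (evenPowConst m).toNNReal *
              ((∫⁻ v : Fin n → Z, ‖∑ i, ζ (v i)‖ₑ ^ (2 * m) ∂(Measure.pi fun _ => μ)) * M2 + M) := by
            rw [lintegral_add_left (hsum'.pow_const _), lintegral_const_mul _ (by fun_prop),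
              lintegral_add_right _ measurable_const, lintegral_mul_const _ (hsum'.pow_const _)]
            simp
        _ ≤ mzConst (m + 1) * n ^ (m + 1) * M +
            (evenPowConst m).toNNReal *
              ((mzConst m * n ^ m * ∫⁻ z, ‖ζ z‖ₑ ^ (2 * m) ∂μ) * M2 + M) := by
            gcongr
            exact ihm n
        _ ≤ mzConst (m + 1) * n ^ (m + 1) * M +
            (evenPowConst m).toNNReal * (mzConst m * n ^ m * (2 * M) + M) := by
            gcongr _ + _ * (?_ + _)
            refine (mul_assoc _ _ _).trans_le ?_
            exact mul_le_mul' le_rfl (lintegral_pow_mul_sq_le hζ.enorm m)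
        _ ≤ mzConst (m + 1) * n ^ (m + 1) * M +
            (evenPowConst m).toNNReal * (mzConst m * (n + 1) ^ m * (2 * M) + (n + 1) ^ m * M) := by
            gcongr
            · exact le_self_add
            · nth_rewrite 1 [← one_mul M]
              gcongr
              exact one_le_pow₀ le_add_self
        _ = mzConst (m + 1) * (n ^ (m + 1) + (n + 1) ^ m) * M := by
            simp only [mzConst]; push_cast; ring
        _ ≤ _ := by
            gcongr
            push_cast
            calc (n : ℝ≥0∞) ^ (m + 1) + (n + 1) ^ m ≤ (n + 1) ^ m * n + (n + 1) ^ m := by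
                  rw [pow_succ]; gcongr; exact le_self_add
              _ = _ := by ring

/-- The size `N ^ (-1 / 2)` of the fluctuations of an average of `N` terms. -/
def fluct (N : ℕ) : ℝ≥0 := (NNReal.sqrt N)⁻¹

lemma fluct_sq (N : ℕ) : fluct N ^ 2 = (N : ℝ≥0)⁻¹ := by
  rw [fluct, inv_pow, NNReal.sq_sqrt]

lemma fluct_le_one (N : ℕ) : fluct N ≤ 1 := by
  rcases Nat.eq_zero_or_pos N with rfl | h
  · simp [fluct]
  · rw [fluct]
    refine inv_le_one_of_one_le₀ ?_
    rw [← NNReal.sqrt_one]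
    exact NNReal.sqrt_le_sqrt.2 (by exact_mod_cast h)

/-- The Marcinkiewicz–Zygmund inequality for empirical means and even moments. -/
lemma lintegral_empMean_sub_pow_le {Z : Type*} [MeasurableSpace Z] {μ : Measure Z}
    [IsProbabilityMeasure μ] {f : Z → ℝ} (hf : Measurable f) {c : ℝ} (hb : ∀ z, |f z| ≤ c)
    (m : ℕ) {N : ℕ} (hN : 1 ≤ N) :
    ∫⁻ v : Fin N → Z, ‖empMean v f - ∫ z, f z ∂μ‖ₑ ^ (2 * m) ∂(Measure.pi fun _ => μ) ≤
      (mzConst m * 2 ^ (2 * m + 1) : ℝ≥0) * (fluct N : ℝ≥0∞) ^ (2 * m)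
        * ∫⁻ z, ‖f z‖ₑ ^ (2 * m) ∂μ := by
  set I := ∫ z, f z ∂μ with hI
  have hfi : Integrable f μ := Integrable.of_bound hf.aestronglyMeasurable c (ae_of_all _ hb)
  have hN0 : (N : ℝ) ≠ 0 := by positivity
  have hIc : ∀ z, |f z - I| ≤ c + |I| := fun z => (abs_sub _ _).trans (by gcongr; exact hb z)
  have hzero : ∫ z, (f z - I) ∂μ = 0 := by
    rw [integral_sub hfi (integrable_const _)]; simp [hI]
  have h1 := lintegral_sum_pow_le (hf.sub_const I) hIc hzero m N
  have e : ∀ v : Fin N → Z, empMean v f - I = (1 / (N : ℝ)) * ∑ i, (f (v i) - I) := by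
    intro v
    rw [Finset.sum_sub_distrib, empMean]
    simp only [Finset.sum_const, Finset.card_univ, Fintype.card_fin, nsmul_eq_mul]
    field_simp
  have hIle : ‖I‖ₑ ^ (2 * m) ≤ ∫⁻ z, ‖f z‖ₑ ^ (2 * m) ∂μ :=
    (pow_le_pow_left' (enorm_integral_le_lintegral_enorm f) _).trans
      (pow_lintegral_le hf.enorm.aemeasurable _)
  -- Price of centring: the convexity constant 2^(2m), and another factor 2 because the mean is
  -- dominated by the moment itself.
  have h2 : ∫⁻ z, ‖f z - I‖ₑ ^ (2 * m) ∂μ ≤ 2 ^ (2 * m + 1) * ∫⁻ z, ‖f z‖ₑ ^ (2 * m) ∂μ := by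
    have key : ∀ x y : ℝ≥0∞, (x + y) ^ (2 * m) ≤ 2 ^ (2 * m) * (x ^ (2 * m) + y ^ (2 * m)) := by
      intro x y
      wlog h : x ≤ y generalizing x y
      · rw [add_comm x y, add_comm (x ^ (2 * m))]; exact this y x (le_of_not_ge h)
      calc (x + y) ^ (2 * m) ≤ (2 * y) ^ (2 * m) := by rw [two_mul y]; gcongr
        _ = 2 ^ (2 * m) * y ^ (2 * m) := mul_pow _ _ _
        _ ≤ _ := by gcongr; exact le_add_self
    calc ∫⁻ z, ‖f z - I‖ₑ ^ (2 * m) ∂μ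
        ≤ ∫⁻ z, 2 ^ (2 * m) * (‖f z‖ₑ ^ (2 * m) + ‖I‖ₑ ^ (2 * m)) ∂μ :=
          lintegral_mono fun z => (pow_le_pow_left' enorm_sub_le _).trans (key _ _)
      _ = 2 ^ (2 * m) * ((∫⁻ z, ‖f z‖ₑ ^ (2 * m) ∂μ) + ‖I‖ₑ ^ (2 * m)) := by
          rw [lintegral_const_mul _ (by fun_prop), lintegral_add_right _ measurable_const]
          simp
      _ ≤ 2 ^ (2 * m) * ((∫⁻ z, ‖f z‖ₑ ^ (2 * m) ∂μ) + ∫⁻ z, ‖f z‖ₑ ^ (2 * m) ∂μ) := by gcongr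
      _ = _ := by ring
  have hNe : ‖1 / (N : ℝ)‖ₑ ^ (2 * m) * (N : ℝ≥0∞) ^ m = (fluct N : ℝ≥0∞) ^ (2 * m) := by
    have : ‖1 / (N : ℝ)‖ₑ = (((N : ℝ≥0)⁻¹ : ℝ≥0) : ℝ≥0∞) := by
      rw [← ofReal_norm, ENNReal.ofReal, ENNReal.coe_inj, one_div, norm_inv]
      ext; simp
    rw [this, pow_mul (fluct N : ℝ≥0∞)]
    norm_cast
    rw [fluct_sq, pow_mul, Nat.cast_pow, ← mul_pow]
    congr 1
    have : (N : ℝ≥0) ≠ 0 := by exact_mod_cast (by lia : N ≠ 0)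
    field_simp
  calc _ = ∫⁻ v : Fin N → Z, ‖1 / (N : ℝ)‖ₑ ^ (2 * m) * ‖∑ i, (f (v i) - I)‖ₑ ^ (2 * m)
          ∂(Measure.pi fun _ => μ) := by
        refine lintegral_congr fun v => ?_
        rw [e v, enorm_mul, mul_pow]
    _ = ‖1 / (N : ℝ)‖ₑ ^ (2 * m) * ∫⁻ v : Fin N → Z, ‖∑ i, (f (v i) - I)‖ₑ ^ (2 * m)
          ∂(Measure.pi fun _ => μ) := lintegral_const_mul _ (by fun_prop)
    _ ≤ ‖1 / (N : ℝ)‖ₑ ^ (2 * m) * (mzConst m * N ^ m *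
          (2 ^ (2 * m + 1) * ∫⁻ z, ‖f z‖ₑ ^ (2 * m) ∂μ)) := by
        gcongr
        exact h1.trans (by gcongr)
    _ = (mzConst m * 2 ^ (2 * m + 1) : ℝ≥0) * (‖1 / (N : ℝ)‖ₑ ^ (2 * m) * (N : ℝ≥0∞) ^ m)
          * ∫⁻ z, ‖f z‖ₑ ^ (2 * m) ∂μ := by push_cast; ring
    _ = _ := by rw [hNe]

end MarcinkiewiczZygmund

end CoupledPF

namespace CoupledPF

/-! ### Conditional laws of an i.i.d. data sequence given its past -/

section FutureLaw

variable {Y : Type*} [MeasurableSpace Y]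

/-- The sequence that follows `y` before time `p` and `y'` from time `p` on. -/
def splice (p : ℕ) (y y' : ℕ → Y) : ℕ → Y := fun i => if i < p then y i else y' i

lemma measurable_splice (p : ℕ) :
    Measurable fun q : (ℕ → Y) × (ℕ → Y) => splice p q.1 q.2 := by
  refine measurable_pi_lambda _ fun i => ?_
  by_cases h : i < p
  · simp only [splice, h, if_true]; fun_prop
  · simp only [splice, h, if_false]; fun_prop

lemma measurable_splice_right (p : ℕ) (y : ℕ → Y) : Measurable (splice p y) :=
  (measurable_splice p).comp measurable_prodMk_left

lemma splice_splice {p q : ℕ} (h : p ≤ q) (y y' y'' : ℕ → Y) :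
    splice q (splice p y y') y'' = splice p y (splice q y' y'') := by
  funext i
  simp only [splice]
  split_ifs <;> first | rfl | lia

lemma splice_of_lt {p i : ℕ} (h : i < p) (y y' : ℕ → Y) : splice p y y' i = y i := if_pos h

lemma splice_of_le {p i : ℕ} (h : p ≤ i) (y y' : ℕ → Y) : splice p y y' i = y' i :=
  if_neg (not_lt.2 h)

variable (ν : Measure Y) [IsProbabilityMeasure ν]

/-- The law of an i.i.d. sequence. -/
def seqLaw : Measure (ℕ → Y) := Measure.infinitePi fun _ => ν

instance : IsProbabilityMeasure (seqLaw ν) := by unfold seqLaw; infer_instance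

/-- The conditional law of an i.i.d. sequence given its terms before time `p`. -/
def fut (p : ℕ) (y : ℕ → Y) : Measure (ℕ → Y) := (seqLaw ν).map (splice p y)

instance (p : ℕ) (y : ℕ → Y) : IsProbabilityMeasure (fut ν p y) :=
  Measure.isProbabilityMeasure_map (measurable_splice_right p y).aemeasurable

lemma lintegral_fut {p : ℕ} {y : ℕ → Y} {F : (ℕ → Y) → ℝ≥0∞} (hF : Measurable F) :
    ∫⁻ y', F y' ∂(fut ν p y) = ∫⁻ y', F (splice p y y') ∂(seqLaw ν) :=
  lintegral_map hF (measurable_splice_right p y)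

/-- On a cylinder set the event factorizes into the coordinates before `p` and those from `p` on.
This is the independence that makes `fut` a version of the conditional law. -/
lemma map_splice_prod (p : ℕ) :
    ((seqLaw ν).prod (seqLaw ν)).map (fun q => splice p q.1 q.2) = seqLaw ν := by
  refine Measure.eq_infinitePi _ fun s t ht => ?_
  classical
  have hpre : (fun q : (ℕ → Y) × (ℕ → Y) => splice p q.1 q.2) ⁻¹' ((s : Set ℕ).pi t)
      = ((s.filter (· < p) : Finset ℕ) : Set ℕ).pi t
        ×ˢ ((s.filter (¬ · < p) : Finset ℕ) : Set ℕ).pi t := by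
    ext q
    simp only [Set.mem_preimage, Set.mem_pi, Set.mem_prod, Finset.coe_filter, Set.mem_ofPred_eq,
      Finset.mem_coe, splice]
    constructor
    · intro h
      refine ⟨fun i hi => ?_, fun i hi => ?_⟩
      · simpa [hi.2] using h i hi.1
      · simpa [hi.2] using h i hi.1
    · rintro ⟨h1, h2⟩ i hi
      by_cases hip : i < p
      · simpa [hip] using h1 i ⟨hi, hip⟩
      · simpa [hip] using h2 i ⟨hi, hip⟩
  rw [Measure.map_apply (measurable_splice p)
    (MeasurableSet.pi s.countable_toSet fun i _ => ht i), hpre, Measure.prod_prod, seqLaw,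
    Measure.infinitePi_pi _ fun i _ => ht i, Measure.infinitePi_pi _ fun i _ => ht i,
    Finset.prod_filter_mul_prod_filter_not]

lemma lintegral_seqLaw_splice (p : ℕ) {F : (ℕ → Y) → ℝ≥0∞} (hF : Measurable F) :
    ∫⁻ y, F y ∂(seqLaw ν) = ∫⁻ y, ∫⁻ y', F (splice p y y') ∂(seqLaw ν) ∂(seqLaw ν) := by
  conv_lhs => rw [← map_splice_prod ν p]
  rw [lintegral_map hF (measurable_splice p),
    lintegral_prod (fun q : (ℕ → Y) × (ℕ → Y) => F (splice p q.1 q.2)) (hF.comp (measurable_splice p)).aemeasurable]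

/-- Tower property: resampling the terms from `q` on after those from `p` on changes nothing. -/
lemma lintegral_fut_fut {p q : ℕ} (h : p ≤ q) (y : ℕ → Y) {F : (ℕ → Y) → ℝ≥0∞}
    (hF : Measurable F) :
    ∫⁻ y', F y' ∂(fut ν p y) = ∫⁻ y', ∫⁻ y'', F y'' ∂(fut ν q y') ∂(fut ν p y) := by
  have hm : Measurable fun y' : ℕ → Y => ∫⁻ y'', F y'' ∂(fut ν q y') := by
    simp only [lintegral_fut ν hF]
    exact (hF.comp (measurable_splice q)).lintegral_prod_right'
  rw [lintegral_fut ν hF, lintegral_fut ν hm, lintegral_seqLaw_splice ν q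
    (F := fun y' => F (splice p y y')) (hF.comp (measurable_splice_right p y))]
  simp only [lintegral_fut ν hF, splice_splice h]

lemma fut_zero (y : ℕ → Y) : fut ν 0 y = seqLaw ν := by
  have : splice 0 y = id := by funext y' i; simp [splice]
  rw [fut, this, Measure.map_id]

lemma measurePreserving_eval_fut {p i : ℕ} (h : p ≤ i) (y : ℕ → Y) :
    MeasurePreserving (fun y' : ℕ → Y => y' i) (fut ν p y) ν := by
  refine ⟨measurable_pi_apply i, ?_⟩
  rw [fut, Measure.map_map (measurable_pi_apply i) (measurable_splice_right p y)]
  have : (fun y' : ℕ → Y => y' i) ∘ splice p y = fun y' => y' i := by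
    funext y'; simp [splice_of_le h]
  rw [this]
  exact Measure.infinitePi_map_eval _ i

lemma lintegral_fut_congr {p : ℕ} {y : ℕ → Y} {F G : (ℕ → Y) → ℝ≥0∞} (hF : Measurable F)
    (hG : Measurable G) (h : ∀ y', (∀ i < p, y' i = y i) → F y' = G y') :
    ∫⁻ y', F y' ∂(fut ν p y) = ∫⁻ y', G y' ∂(fut ν p y) := by
  rw [lintegral_fut ν hF, lintegral_fut ν hG]
  exact lintegral_congr fun y' => h _ fun i hi => splice_of_lt hi y y'

section Kernels

variable {Z : Type*} [MeasurableSpace Z] {m : Kernel (ℕ → Y) Z} {p : ℕ}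

lemma measurable_lintegral_kernel [IsSFiniteKernel m] {F : Z → (ℕ → Y) → ℝ≥0∞}
    (hF : Measurable (Function.uncurry F)) : Measurable fun y => ∫⁻ z, F z y ∂(m y) :=
  Measurable.lintegral_kernel_prod_right (f := fun y z => F z y) (hF.comp measurable_swap)

/-- Under `fut ν p y` the terms before `p` are those of `y`, so a kernel that only sees the past is
frozen and Tonelli applies. This is how particles are held fixed while the new data are averaged. -/
lemma lintegral_fut_kernel [IsSFiniteKernel m] (hm : DependsOn m (Set.Iio p))
    {F : Z → (ℕ → Y) → ℝ≥0∞} (hF : Measurable (Function.uncurry F)) (y : ℕ → Y) :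
    ∫⁻ y', ∫⁻ z, F z y' ∂(m y') ∂(fut ν p y) = ∫⁻ z, ∫⁻ y', F z y' ∂(fut ν p y) ∂(m y) := by
  have h1 : ∫⁻ y', ∫⁻ z, F z y' ∂(m y') ∂(fut ν p y) = ∫⁻ y', ∫⁻ z, F z y' ∂(m y) ∂(fut ν p y) := by
    refine lintegral_fut_congr ν (measurable_lintegral_kernel hF)
      (Measurable.lintegral_prod_right' (f := fun r : (ℕ → Y) × Z => F r.2 r.1)
        (hF.comp measurable_swap)) fun y' hy' => ?_
    rw [hm fun i hi => hy' i hi]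
  rw [h1]
  exact lintegral_lintegral_swap (f := fun y' z => F z y') (hF.comp measurable_swap).aemeasurable

/-- Integration of conditional bounds. -/
lemma lintegral_seqLaw_kernel_le [IsSFiniteKernel m] (hm : DependsOn m (Set.Iio p))
    {F : Z → (ℕ → Y) → ℝ≥0∞} (hF : Measurable (Function.uncurry F)) {B : Z → ℝ≥0∞}
    (h : ∀ y z, ∫⁻ y', F z y' ∂(fut ν p y) ≤ B z) :
    ∫⁻ y, ∫⁻ z, F z y ∂(m y) ∂(seqLaw ν) ≤ ∫⁻ y, ∫⁻ z, B z ∂(m y) ∂(seqLaw ν) := by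
  rcases isEmpty_or_nonempty (ℕ → Y) with hY | ⟨⟨y0⟩⟩
  · rw [Measure.eq_zero_of_isEmpty (seqLaw ν)]; simp
  rw [← fut_zero ν y0, lintegral_fut_fut ν (Nat.zero_le p) y0 (measurable_lintegral_kernel hF)]
  refine lintegral_mono fun y => ?_
  rw [lintegral_fut_kernel ν hm hF]
  exact lintegral_mono fun z => h y z

end Kernels

/-- Moment bounds that hold conditionally given the terms before time `p`, uniformly. -/
def CLO (p : ℕ) (F : (ℕ → Y) → ℝ) (ε : ℝ≥0) (C : ℕ → ℝ≥0) : Prop :=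
  ∀ y, LO (fut ν p y) F ε C

namespace CLO

variable {ν} {p q : ℕ} {F G : (ℕ → Y) → ℝ} {ε δ : ℝ≥0} {C C' : ℕ → ℝ≥0}

lemma mul (hF : CLO ν p F ε C) (hG : CLO ν p G δ C') :
    CLO ν p (fun y => F y * G y) (ε * δ) (mulC C C') := fun y => (hF y).mul (hG y)

lemma add (hF : CLO ν p F ε C) (hG : CLO ν p G ε C') :
    CLO ν p (fun y => F y + G y) ε (addC C C') := fun y => (hF y).add (hG y)

lemma sub (hF : CLO ν p F ε C) (hG : CLO ν p G ε C') :
    CLO ν p (fun y => F y - G y) ε (addC C C') := fun y => (hF y).sub (hG y)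

lemma mono (hF : CLO ν p F ε C) (h : ε ≤ δ) : CLO ν p F δ C := fun y => (hF y).mono h

lemma mono_const (hF : CLO ν p F ε C) (h : ∀ r, C r ≤ C' r) : CLO ν p F ε C' :=
  fun y => (hF y).mono_const h

lemma const (c : ℝ) (h : |c| ≤ ε) : CLO ν p (fun _ => c) ε (fun _ => 1) :=
  fun _ => LO.const c h

/-- The bounds are uniform in the past, so they survive averaging over a part of it. -/
lemma tower (hF : CLO ν q F ε C) (h : p ≤ q) : CLO ν p F ε C := fun y =>
  ⟨(hF y).meas, fun r => by
    rw [lintegral_fut_fut ν h y ((hF y).enorm_meas.pow_const r)]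
    calc _ ≤ ∫⁻ _, C r * (ε : ℝ≥0∞) ^ r ∂(fut ν p y) :=
          lintegral_mono fun y' => (hF y').bound r
      _ = _ := by simp⟩

lemma eval {f : Y → ℝ} (hf : LO ν f ε C) (h : p ≤ q) : CLO ν p (fun y => f (y q)) ε C :=
  fun y => hf.comp (measurePreserving_eval_fut ν h y)

lemma seqLaw (hF : CLO ν p F ε C) : LO (seqLaw ν) F ε C := by
  obtain ⟨y⟩ := nonempty_of_isProbabilityMeasure (CoupledPF.seqLaw ν)
  rw [← fut_zero ν y]; exact hF.tower (Nat.zero_le p) y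

/-- Jensen for the average over `z`, then the kernel is frozen and the integrals exchanged. The size
`E z` may vary with `z`; only its moments under the kernel are needed. -/
lemma integral_of_moments {Z : Type*} [MeasurableSpace Z] {m : Kernel (ℕ → Y) Z}
    [IsMarkovKernel m] (hm : DependsOn m (Set.Iio p)) {F : Z → (ℕ → Y) → ℝ}
    (hF : Measurable (Function.uncurry F)) {E : Z → ℝ≥0} (h : ∀ z, CLO ν p (F z) (E z) C)
    (hE : ∀ y r, ∫⁻ z, (E z : ℝ≥0∞) ^ r ∂(m y) ≤ C' r * (ε : ℝ≥0∞) ^ r) :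
    CLO ν p (fun y => ∫ z, F z y ∂(m y)) ε (fun r => C r * C' r) := fun y => by
  refine ⟨(StronglyMeasurable.integral_kernel_prod_right (f := fun y z => F z y)
    (hF.comp measurable_swap).stronglyMeasurable).measurable, fun r => ?_⟩
  have hFe : Measurable (Function.uncurry fun z y => ‖F z y‖ₑ ^ r) := (hF.enorm).pow_const r
  calc ∫⁻ y', ‖∫ z, F z y' ∂(m y')‖ₑ ^ r ∂(fut ν p y)
      ≤ ∫⁻ y', ∫⁻ z, ‖F z y'‖ₑ ^ r ∂(m y') ∂(fut ν p y) := by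
        refine lintegral_mono fun y' => ?_
        refine (pow_le_pow_left' (enorm_integral_le_lintegral_enorm _) r).trans ?_
        exact pow_lintegral_le (hF.comp measurable_prodMk_right).enorm.aemeasurable r
    _ = ∫⁻ z, ∫⁻ y', ‖F z y'‖ₑ ^ r ∂(fut ν p y) ∂(m y) := lintegral_fut_kernel ν hm hFe y
    _ ≤ ∫⁻ z, C r * (E z : ℝ≥0∞) ^ r ∂(m y) := lintegral_mono fun z => (h z y).bound r
    _ = C r * ∫⁻ z, (E z : ℝ≥0∞) ^ r ∂(m y) := lintegral_const_mul' _ _ ENNReal.coe_ne_top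
    _ ≤ C r * (C' r * (ε : ℝ≥0∞) ^ r) := by gcongr; exact hE y r
    _ = _ := by push_cast; ring

/-- Averages of random variables with conditional moment bounds satisfy the same bounds. -/
lemma integral {Z : Type*} [MeasurableSpace Z] {m : Kernel (ℕ → Y) Z}
    [IsMarkovKernel m] (hm : DependsOn m (Set.Iio p)) {F : Z → (ℕ → Y) → ℝ}
    (hF : Measurable (Function.uncurry F)) (h : ∀ z, CLO ν p (F z) ε C) :
    CLO ν p (fun y => ∫ z, F z y ∂(m y)) ε C := by
  simpa using integral_of_moments (C' := fun _ => 1) hm hF h (by simp)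

/-- A conditional second moment is bounded by the smaller of two scales. -/
lemma lintegral_sq_le_min (h1 : CLO ν p F 1 C) (h2 : CLO ν p F δ C') (y : ℕ → Y) :
    ∫⁻ y', ‖F y'‖ₑ ^ 2 ∂(fut ν p y) ≤ (C 2 + C' 2 : ℝ≥0) * (min 1 δ : ℝ≥0) := by
  rcases le_total δ 1 with h | h
  · rw [min_eq_right h]
    refine ((h2 y).bound 2).trans ?_
    norm_cast
    -- A power of δ is given up on purpose: only the mean of the truncated distance `min 1 δ`, not
    -- of its square at a better rate, is controlled for the particle pairs.
    calc C' 2 * δ ^ 2 ≤ C' 2 * δ := by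
          gcongr; rw [sq]; exact mul_le_of_le_one_left' h
      _ ≤ _ := by gcongr; exact le_add_self
  · rw [min_eq_left h]
    refine ((h1 y).bound 2).trans ?_
    simp

lemma lintegral_le_min (h1 : CLO ν p F 1 C) (h2 : CLO ν p F δ C') (y : ℕ → Y) :
    ∫⁻ y', ‖F y'‖ₑ ∂(fut ν p y) ≤ (C 1 + C' 1 : ℝ≥0) * (min 1 δ : ℝ≥0) := by
  rcases le_total δ 1 with h | h
  · rw [min_eq_right h]
    refine (h2 y).bound_one.trans ?_
    gcongr
    exact le_add_self
  · rw [min_eq_left h]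
    refine (h1 y).bound_one.trans ?_
    gcongr
    exact le_self_add

end CLO

end FutureLaw

end CoupledPF

/-! ### Abstract coupled systems and their backward operator -/

namespace CoupledPF

lemma integrable_of_abs_le {Z : Type*} [MeasurableSpace Z] {μ : Measure Z} [IsFiniteMeasure μ]
    {f : Z → ℝ} (hf : Measurable f) {c : ℝ} (h : ∀ z, |f z| ≤ c) : Integrable f μ :=
  Integrable.of_bound hf.aestronglyMeasurable c (ae_of_all _ h)

/-- Jensen's inequality for the inverse function. -/
lemma inv_integral_le {Z : Type*} [MeasurableSpace Z] {μ : Measure Z} [IsProbabilityMeasure μ]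
    {g : Z → ℝ} (hg : Measurable g) {a b : ℝ} (ha : 0 < a) (hl : ∀ z, a ≤ g z)
    (hu : ∀ z, g z ≤ b) : 0 < ∫ z, g z ∂μ ∧ (∫ z, g z ∂μ)⁻¹ ≤ ∫ z, (g z)⁻¹ ∂μ := by
  have hp : ∀ z, 0 < g z := fun z => ha.trans_le (hl z)
  have hgi : Integrable g μ := integrable_of_abs_le hg (c := b) fun z => by
    rw [abs_of_pos (hp z)]; exact hu z
  have hgi' : Integrable (fun z => (g z)⁻¹) μ := integrable_of_abs_le hg.inv (c := a⁻¹) fun z => by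
    rw [abs_of_pos (inv_pos.2 (hp z))]; exact inv_anti₀ ha (hl z)
  have h1 : a ≤ ∫ z, g z ∂μ := by
    calc a = ∫ _, a ∂μ := by simp
      _ ≤ _ := integral_mono (integrable_const _) hgi hl
  have hpos := ha.trans_le h1
  refine ⟨hpos, ?_⟩
  set c := ∫ z, g z ∂μ with hc
  -- The integrand is the tangent line of the inverse function at the mean `c`; it lies below the
  -- graph, the gap being a square times a positive factor.
  calc c⁻¹ = ∫ z, (2 * c⁻¹ - c⁻¹ ^ 2 * g z) ∂μ := by
        rw [integral_sub (integrable_const _) (hgi.const_mul _), integral_const, integral_const_mul]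
        simp only [← hc, probReal_univ, one_smul]
        field_simp
        ring
    _ ≤ _ := by
        refine integral_mono ((integrable_const _).sub (hgi.const_mul _)) hgi' fun z => ?_
        have e : (g z)⁻¹ - (2 * c⁻¹ - c⁻¹ ^ 2 * g z) = (g z)⁻¹ * (1 - c⁻¹ * g z) ^ 2 := by
          have := (hp z).ne'
          field_simp
          ring
        have : 0 ≤ (g z)⁻¹ * (1 - c⁻¹ * g z) ^ 2 :=
          mul_nonneg (inv_pos.2 (hp z)).le (sq_nonneg _)
        simp only
        linarith

/-- The fine (`true`) or coarse (`false`) component of a pair. -/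
def side {X : Type} (s : Bool) (x : X × X) : X := bif s then x.1 else x.2

/-- A coupled pair of weighted Markov chains in a random environment: `Z` is the space of pairs of
paths over a unit time interval, `Y` the space of data blocks, `true` is the fine level and `false`
the coarse level. `K` is the coupled transition kernel, `g` the potentials, `e` the endpoint maps,
`D` measures the distance of the two paths and `ε` is the strong error. -/
structure CoupledSystem (X Z Y : Type) [MeasurableSpace X] [MeasurableSpace Z]
    [MeasurableSpace Y] where
  ν : Measure Y
  g : Bool → Z → Y → ℝ
  e : Bool → Z → X
  K : Kernel (X × X) Z
  x0 : X
  z0 : Z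
  d : X → X → ℝ≥0
  D : Z → ℝ≥0
  ε : ℝ≥0
  isProb : IsProbabilityMeasure ν
  isMarkov : IsMarkovKernel K
  measurable_g : ∀ s, Measurable (Function.uncurry (g s))
  measurable_e : ∀ s, Measurable (e s)
  measurable_D : Measurable D
  d_self : d x0 x0 = 0
  -- These two bounds hold for fixed data and may degenerate with it. They give integrability and
  -- nonzero denominators, never a quantitative estimate.
  g_lower : ∀ s y, ∃ c, 0 < c ∧ ∀ z, c ≤ g s z y
  g_upper : ∀ s y, ∃ c, ∀ z, g s z y ≤ c
  -- Each level of the coupled kernel moves according to its own starting point. Only the joint law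
  -- of weight and endpoint at that level matters for the filter.
  marginal : ∀ s x x', side s x = side s x' → ∀ y,
    (K x).map (fun z => (g s z y, e s z)) = (K x').map (fun z => (g s z y, e s z))

attribute [instance] CoupledSystem.isProb CoupledSystem.isMarkov

variable {X Z Y : Type} [MeasurableSpace X] [MeasurableSpace Z] [MeasurableSpace Y]

namespace CoupledSystem

variable (S : CoupledSystem X Z Y)

/-- Quantitative assumptions on a coupled system, with moment constants `C`. -/
structure Good (C : ℕ → ℝ≥0) : Prop where
  g_lo : ∀ s z, LO S.ν (S.g s z) 1 C
  inv_lo : ∀ s z, LO S.ν (fun y => (S.g s z y)⁻¹) 1 C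
  diff_lo : ∀ z, LO S.ν (fun y => S.g true z y - S.g false z y) (S.D z) C
  d_le : ∀ z, S.d (S.e true z) (S.e false z) + S.ε ≤ S.D z
  eps_le_one : S.ε ≤ 1
  D_moment : ∀ x r, ∫⁻ z, (S.D z : ℝ≥0∞) ^ r ∂(S.K x) ≤
    C r * ((S.d x.1 x.2 + S.ε : ℝ≥0) : ℝ≥0∞) ^ r

lemma g_pos (s : Bool) (z : Z) (y : Y) : 0 < S.g s z y := by
  obtain ⟨c, hc, h⟩ := S.g_lower s y
  exact hc.trans_le (h z)

/-- Pairs of random test functions at time `p`, depending on the data. -/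
structure Nice (p : ℕ) (φ : Bool → X → (ℕ → Y) → ℝ) (C : ℕ → ℝ≥0) : Prop where
  meas : ∀ s, Measurable (Function.uncurry (φ s))
  -- For fixed data only, to guarantee integrability; the uniform information is in `lo` and `diff`.
  bdd : ∀ s y, ∃ c, ∀ x, |φ s x y| ≤ c
  lo : ∀ s x, CLO S.ν p (φ s x) 1 C
  diff : ∀ x x', CLO S.ν p (fun y => φ true x y - φ false x' y) (S.d x x' + S.ε) C

/-- The constant test function. -/
def one : Bool → X → (ℕ → Y) → ℝ := fun _ _ _ => 1

lemma nice_one (p : ℕ) : S.Nice p one (fun _ => 1) where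
  meas _ := measurable_const
  bdd _ _ := ⟨1, fun _ => by simp [one]⟩
  lo _ _ := CLO.const 1 (by simp)
  diff _ _ := by simpa [one] using CLO.const (ν := S.ν) (p := p) 0 (by simp; positivity)

/-- The weighted test function `g φ` on the path space at time `p`. -/
def gf (p : ℕ) (φ : Bool → X → (ℕ → Y) → ℝ) (s : Bool) (z : Z) (y : ℕ → Y) : ℝ :=
  S.g s z (y p) * φ s (S.e s z) y

lemma gf_one (p : ℕ) (s : Bool) (z : Z) (y : ℕ → Y) : S.gf p one s z y = S.g s z (y p) := by
  simp [gf, one]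

/-- The one-step operator `P φ (x) = ∫ g φ dK`. -/
def step (p : ℕ) (φ : Bool → X → (ℕ → Y) → ℝ) (s : Bool) (x : X) (y : ℕ → Y) : ℝ :=
  ∫ z, S.gf p φ s z y ∂(S.K (x, x))

variable {S} {p : ℕ} {φ : Bool → X → (ℕ → Y) → ℝ} {C Cs Cκ : ℕ → ℝ≥0} {s : Bool}

lemma measurable_gf (hφ : Measurable (Function.uncurry (φ s))) :
    Measurable (Function.uncurry (S.gf p φ s)) := by
  have h1 : Measurable fun q : Z × (ℕ → Y) => S.g s q.1 (q.2 p) :=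
    (S.measurable_g s).comp (measurable_fst.prodMk ((measurable_pi_apply p).comp measurable_snd))
  have h2 : Measurable fun q : Z × (ℕ → Y) => φ s (S.e s q.1) q.2 :=
    hφ.comp (((S.measurable_e s).comp measurable_fst).prodMk measurable_snd)
  exact h1.mul h2

lemma measurable_gf_left (hφ : Measurable (Function.uncurry (φ s))) (y : ℕ → Y) :
    Measurable fun z => S.gf p φ s z y :=
  (measurable_gf hφ).comp measurable_prodMk_right

lemma gf_bdd (hφ : ∀ y, ∃ c, ∀ x, |φ s x y| ≤ c) (y : ℕ → Y) : ∃ c, ∀ z, |S.gf p φ s z y| ≤ c := by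
  obtain ⟨c, hc⟩ := hφ y
  obtain ⟨b, hb⟩ := S.g_upper s (y p)
  refine ⟨b * c, fun z => ?_⟩
  rw [gf, abs_mul, abs_of_pos (S.g_pos s z _)]
  have := S.g_pos s z (y p)
  exact mul_le_mul (hb z) (hc _) (abs_nonneg _) (this.le.trans (hb z))

lemma integrable_gf (hφ : Measurable (Function.uncurry (φ s)))
    (hb : ∀ y, ∃ c, ∀ x, |φ s x y| ≤ c) (y : ℕ → Y) (μ : Measure Z) [IsFiniteMeasure μ] :
    Integrable (fun z => S.gf p φ s z y) μ := by
  obtain ⟨c, hc⟩ := gf_bdd (S := S) (p := p) hb y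
  exact integrable_of_abs_le (measurable_gf_left hφ y) hc

/-- By `marginal`, the second starting point may be replaced by a copy of the relevant one. -/
lemma integral_gf_K (hφ : Measurable (Function.uncurry (φ s))) (x : X × X) (y : ℕ → Y) :
    ∫ z, S.gf p φ s z y ∂(S.K x) = S.step p φ s (side s x) y := by
  have hm : Measurable fun z => (S.g s z (y p), S.e s z) :=
    ((S.measurable_g s).comp measurable_prodMk_right).prodMk (S.measurable_e s)
  have hF : Measurable fun q : ℝ × X => q.1 * φ s q.2 y :=
    measurable_fst.mul (hφ.comp (by fun_prop : Measurable fun q : ℝ × X => (q.2, y)))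
  have h : ∀ x, ∫ z, S.gf p φ s z y ∂(S.K x)
      = ∫ q, q.1 * φ s q.2 y ∂((S.K x).map fun z => (S.g s z (y p), S.e s z)) := fun x => by
    rw [integral_map hm.aemeasurable hF.aestronglyMeasurable]; rfl
  rw [step, h, h, S.marginal s x (side s x, side s x) (by cases s <;> rfl)]

/-- Moment constants of weighted differences. -/
def diffC (Cs C : ℕ → ℝ≥0) : ℕ → ℝ≥0 := addC (mulC Cs C) (mulC Cs C)

/-- The weight reads the data block at time `p`, while φ is controlled given the data before `p +
1`; both bounds hold given the data before `p`. -/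
lemma gf_lo (hS : S.Good Cs) (hφ : S.Nice (p + 1) φ C) (s : Bool) (z : Z) :
    CLO S.ν p (S.gf p φ s z) 1 (mulC Cs C) := by
  have h1 : CLO S.ν p (fun y => S.g s z (y p)) 1 Cs := CLO.eval (hS.g_lo s z) le_rfl
  have h2 := (hφ.lo s (S.e s z)).tower (Nat.le_succ p)
  have h3 := h1.mul h2
  rw [mul_one] at h3
  exact h3

/-- Product rule: the weights differ by `S.D z`, and so do the test functions, since `S.D z`
dominates the distance of the endpoints plus ε. -/
lemma gf_diff (hS : S.Good Cs) (hφ : S.Nice (p + 1) φ C) (z : Z) :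
    CLO S.ν p (fun y => S.gf p φ true z y - S.gf p φ false z y) (S.D z) (diffC Cs C) := by
  have h1 : CLO S.ν p (fun y => S.g true z (y p) - S.g false z (y p)) (S.D z) Cs :=
    CLO.eval (hS.diff_lo z) le_rfl
  have h2 := (hφ.lo true (S.e true z)).tower (Nat.le_succ p)
  have h3 : CLO S.ν p (fun y => S.g false z (y p)) 1 Cs := CLO.eval (hS.g_lo false z) le_rfl
  have h4 := ((hφ.diff (S.e true z) (S.e false z)).tower (Nat.le_succ p)).mono (hS.d_le z)
  have h5 := h1.mul h2
  have h6 := h3.mul h4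
  rw [mul_one] at h5
  rw [one_mul] at h6
  have e : (fun y => S.gf p φ true z y - S.gf p φ false z y) = fun y =>
      (S.g true z (y p) - S.g false z (y p)) * φ true (S.e true z) y
        + S.g false z (y p) * (φ true (S.e true z) y - φ false (S.e false z) y) := by
    funext y; simp only [gf]; ring
  rw [e]
  exact h5.add h6

/-- Moment constants of the test function after one step. -/
def stepC (Cs C Cκ : ℕ → ℝ≥0) (r : ℕ) : ℝ≥0 :=
  mulC Cκ (mulC Cs C) r + mulC Cκ (fun r => diffC Cs C r * Cs r) r

lemma dependsOn_const (μ : Measure Z) :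
    DependsOn (Kernel.const (ℕ → Y) μ) (Set.Iio p) := fun _ _ _ => rfl

lemma measurable_step (hφ : Measurable (Function.uncurry (φ s))) :
    Measurable (Function.uncurry (S.step p φ s)) := by
  have : StronglyMeasurable fun q : X × (ℕ → Y) => ∫ z, S.gf p φ s z q.2
      ∂((S.K.comap (fun q : X × (ℕ → Y) => (q.1, q.1)) (by fun_prop)) q) :=
    StronglyMeasurable.integral_kernel_prod_right
      (f := fun (q : X × (ℕ → Y)) z => S.gf p φ s z q.2)
      ((measurable_gf hφ).comp (measurable_snd.prodMk
        (measurable_snd.comp measurable_fst))).stronglyMeasurable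
  exact this.measurable

lemma step_bdd (hb : ∀ y, ∃ c, ∀ x, |φ s x y| ≤ c) (y : ℕ → Y) :
    ∃ c, ∀ x, |S.step p φ s x y| ≤ c := by
  obtain ⟨c, hc⟩ := gf_bdd (S := S) (p := p) hb y
  refine ⟨c, fun x => ?_⟩
  have := norm_integral_le_of_norm_le_const (μ := S.K (x, x)) (f := fun z => S.gf p φ s z y)
    (ae_of_all _ hc)
  rw [probReal_univ, mul_one] at this
  exact this

/-- Stability of the class of test functions under backward propagation. The random factor `κ` is
not determined by the data before `p`, so it cannot be taken out of conditional moments; it is made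
part of the test function. In the linearized error it will be an inverse normalizing constant. -/
lemma Nice.mul_step (hS : S.Good Cs) (hφ : S.Nice (p + 1) φ C) {κ : (ℕ → Y) → ℝ}
    (hκ : CLO S.ν p κ 1 Cκ) :
    S.Nice p (fun s x y => κ y * S.step p φ s x y) (stepC Cs C Cκ) where
  meas s := by
    have y0 : ℕ → Y := (nonempty_of_isProbabilityMeasure (seqLaw S.ν)).some
    exact ((hκ y0).meas.comp measurable_snd).mul (measurable_step (hφ.meas s))
  bdd s y := by
    obtain ⟨c, hc⟩ := step_bdd (S := S) (p := p) (hφ.bdd s) y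
    exact ⟨|κ y| * c, fun x => by rw [abs_mul]; gcongr; exact hc x⟩
  lo s x := by
    have h1 : CLO S.ν p (S.step p φ s x) 1 (mulC Cs C) :=
      CLO.integral (m := Kernel.const _ (S.K (x, x))) (dependsOn_const _)
        (measurable_gf (hφ.meas s)) (gf_lo hS hφ s)
    have h2 := hκ.mul h1
    rw [mul_one] at h2
    exact h2.mono_const fun r => le_self_add
  diff x x' := by
    -- The two one-level integrals are written under one coupled kernel started at `(x, x')`, where
    -- the paths are close.
    have h1 : CLO S.ν p (fun y => ∫ z, (S.gf p φ true z y - S.gf p φ false z y) ∂(S.K (x, x')))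
        (S.d x x' + S.ε) (fun r => diffC Cs C r * Cs r) :=
      CLO.integral_of_moments (m := Kernel.const _ (S.K (x, x'))) (dependsOn_const _)
        ((measurable_gf (hφ.meas true)).sub (measurable_gf (hφ.meas false))) (gf_diff hS hφ)
        fun y r => hS.D_moment (x, x') r
    have h2 := hκ.mul h1
    rw [one_mul] at h2
    have e : (fun y => κ y * S.step p φ true x y - κ y * S.step p φ false x' y) = fun y =>
        κ y * ∫ z, (S.gf p φ true z y - S.gf p φ false z y) ∂(S.K (x, x')) := by
      funext y
      rw [integral_sub (integrable_gf (hφ.meas true) (hφ.bdd true) y _)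
        (integrable_gf (hφ.meas false) (hφ.bdd false) y _),
        integral_gf_K (hφ.meas true), integral_gf_K (hφ.meas false)]
      simp only [side, cond_true, cond_false]
      ring
    rw [e]
    exact h2.mono_const fun r => le_add_self

lemma Nice.step (hS : S.Good Cs) (hφ : S.Nice (p + 1) φ C) :
    S.Nice p (S.step p φ) (stepC Cs C fun _ => 1) := by
  simpa using hφ.mul_step hS (CLO.const (ν := S.ν) (p := p) 1 (by simp))

/-! ### Exact filters as kernels from the data -/

section ExactFilter

variable (S)

/-- The exact predictive law of the path over `[p, p + 1]` from the exact filter at time `p`. -/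
def predict (η : Kernel (ℕ → Y) X) : Kernel (ℕ → Y) Z :=
  (S.K.comap (fun x => (x, x)) (by fun_prop)) ∘ₖ η

instance (η : Kernel (ℕ → Y) X) [IsMarkovKernel η] : IsMarkovKernel (S.predict η) := by
  unfold predict; infer_instance

/-- The density of the updated law with respect to the predictive law. -/
def density (s : Bool) (p : ℕ) (π : Kernel (ℕ → Y) Z) (y : ℕ → Y) (z : Z) : ℝ≥0∞ :=
  ENNReal.ofReal (S.g s z (y p)) / ∫⁻ z', ENNReal.ofReal (S.g s z' (y p)) ∂(π y)

/-- Update of the predictive law by the potential at time `p`. -/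
def update (s : Bool) (p : ℕ) (π : Kernel (ℕ → Y) Z) [IsSFiniteKernel π] : Kernel (ℕ → Y) X :=
  (π.withDensity (S.density s p π)).map (S.e s)

lemma measurable_density (s : Bool) (p : ℕ) (π : Kernel (ℕ → Y) Z) [IsSFiniteKernel π] :
    Measurable (Function.uncurry (S.density s p π)) := by
  have h1 : Measurable fun q : (ℕ → Y) × Z => ENNReal.ofReal (S.g s q.2 (q.1 p)) :=
    ((S.measurable_g s).comp (measurable_snd.prodMk
      ((measurable_pi_apply p).comp measurable_fst))).ennreal_ofReal
  have h2 : Measurable fun y : ℕ → Y => ∫⁻ z', ENNReal.ofReal (S.g s z' (y p)) ∂(π y) :=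
    Measurable.lintegral_kernel_prod_right (f := fun (y : ℕ → Y) z' => ENNReal.ofReal (S.g s z' (y p))) h1
  exact h1.div (h2.comp measurable_fst)

lemma integrable_g (s : Bool) (y : Y) (μ : Measure Z) [IsFiniteMeasure μ] :
    Integrable (fun z => S.g s z y) μ := by
  obtain ⟨b, hb⟩ := S.g_upper s y
  exact integrable_of_abs_le ((S.measurable_g s).comp measurable_prodMk_right) (c := b) fun z => by
    rw [abs_of_pos (S.g_pos s z y)]; exact hb z

lemma inv_integral_g_le (s : Bool) (y : Y) (μ : Measure Z) [IsProbabilityMeasure μ] :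
    0 < ∫ z, S.g s z y ∂μ ∧ (∫ z, S.g s z y ∂μ)⁻¹ ≤ ∫ z, (S.g s z y)⁻¹ ∂μ := by
  obtain ⟨b, hb⟩ := S.g_upper s y
  obtain ⟨a, ha, hab⟩ := S.g_lower s y
  exact inv_integral_le ((S.measurable_g s).comp measurable_prodMk_right) ha hab hb

variable {S}

lemma lintegral_g {s : Bool} (y : Y) (μ : Measure Z) [IsFiniteMeasure μ] :
    ∫⁻ z, ENNReal.ofReal (S.g s z y) ∂μ = ENNReal.ofReal (∫ z, S.g s z y ∂μ) :=
  (ofReal_integral_eq_lintegral_ofReal (S.integrable_g s y μ)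
    (ae_of_all _ fun z => (S.g_pos s z y).le)).symm

lemma density_eq {s : Bool} {p : ℕ} {π : Kernel (ℕ → Y) Z} [IsMarkovKernel π] (y : ℕ → Y) (z : Z) :
    S.density s p π y z = ENNReal.ofReal (S.g s z (y p) / ∫ z', S.g s z' (y p) ∂(π y)) := by
  rw [density, lintegral_g, ENNReal.ofReal_div_of_pos (S.inv_integral_g_le s (y p) (π y)).1]

lemma update_apply {s : Bool} {p : ℕ} {π : Kernel (ℕ → Y) Z} [IsMarkovKernel π] (y : ℕ → Y) :
    S.update s p π y = ((π y).withDensity (S.density s p π y)).map (S.e s) := by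
  rw [update, Kernel.map_apply _ (S.measurable_e s),
    Kernel.withDensity_apply _ (S.measurable_density s p π)]

instance {s : Bool} {p : ℕ} {π : Kernel (ℕ → Y) Z} [IsMarkovKernel π] :
    IsMarkovKernel (S.update s p π) := by
  refine ⟨fun y => ⟨?_⟩⟩
  rw [update_apply, Measure.map_apply (S.measurable_e s) MeasurableSet.univ, Set.preimage_univ,
    withDensity_apply _ MeasurableSet.univ, Measure.restrict_univ]
  have hp := (S.inv_integral_g_le s (y p) (π y)).1
  have hm : Measurable fun z => ENNReal.ofReal (S.g s z (y p)) :=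
    ((S.measurable_g s).comp measurable_prodMk_right).ennreal_ofReal
  simp only [density, div_eq_mul_inv]
  rw [lintegral_mul_const _ hm, lintegral_g]
  exact ENNReal.mul_inv_cancel (by simpa using hp) ENNReal.ofReal_ne_top

lemma integral_update {s : Bool} {p : ℕ} {π : Kernel (ℕ → Y) Z} [IsMarkovKernel π] (y : ℕ → Y)
    {f : X → ℝ} (hf : Measurable f) :
    ∫ x, f x ∂(S.update s p π y) =
      (∫ z, S.g s z (y p) * f (S.e s z) ∂(π y)) / ∫ z, S.g s z (y p) ∂(π y) := by
  have hd : Measurable (S.density s p π y) :=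
    (S.measurable_density s p π).comp measurable_prodMk_left
  rw [update_apply, integral_map (S.measurable_e s).aemeasurable hf.aestronglyMeasurable,
    integral_withDensity_eq_integral_toReal_smul hd
      (ae_of_all _ fun z => by rw [density_eq]; exact ENNReal.ofReal_lt_top), ← integral_div]
  refine integral_congr_ae (ae_of_all _ fun z => ?_)
  have hp := (S.inv_integral_g_le s (y p) (π y)).1
  simp only [density_eq]
  rw [ENNReal.toReal_ofReal (div_nonneg (S.g_pos s z _).le hp.le), smul_eq_mul]
  ring

variable (S)

/-- The exact filters, as kernels from the data. -/
def exactAux (s : Bool) : ℕ → {η : Kernel (ℕ → Y) X // IsMarkovKernel η}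
  | 0 => ⟨Kernel.const _ (Measure.dirac S.x0), inferInstance⟩
  | p + 1 =>
    have := (exactAux s p).2
    ⟨S.update s p (S.predict (exactAux s p).1), inferInstance⟩

/-- The exact filter at time `p`. -/
def exact (s : Bool) (p : ℕ) : Kernel (ℕ → Y) X := (S.exactAux s p).1

instance (s : Bool) (p : ℕ) : IsMarkovKernel (S.exact s p) := (S.exactAux s p).2

/-- The exact predictive path law at time `p`. -/
def exactPath (s : Bool) (p : ℕ) : Kernel (ℕ → Y) Z := S.predict (S.exact s p)

instance (s : Bool) (p : ℕ) : IsMarkovKernel (S.exactPath s p) := by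
  unfold exactPath; infer_instance

lemma exact_succ (s : Bool) (p : ℕ) : S.exact s (p + 1) = S.update s p (S.exactPath s p) := rfl

lemma exact_zero (s : Bool) (y : ℕ → Y) : S.exact s 0 y = Measure.dirac S.x0 := rfl

lemma exactPath_apply (s : Bool) (p : ℕ) (y : ℕ → Y) : S.exactPath s p y =
    (S.exact s p y).bind (S.K.comap (fun x => (x, x)) (by fun_prop)) := rfl

/-- The filter at time `p` uses the potentials of times `0, …, p - 1`; the potential of time `p` is
therefore independent of it. -/
lemma dependsOn_exact (s : Bool) (p : ℕ) : DependsOn (S.exact s p) (Set.Iio p) := by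
  induction p with
  | zero => exact fun _ _ _ => rfl
  | succ p ih =>
    intro y y' h
    have h1 : S.exactPath s p y = S.exactPath s p y' := by
      rw [exactPath_apply, exactPath_apply, ih fun i hi => h i (Nat.lt_succ_of_lt hi)]
    have h2 : y p = y' p := h p (Nat.lt_succ_self p)
    rw [exact_succ, update_apply, update_apply]
    have : S.density s p (S.exactPath s p) y = S.density s p (S.exactPath s p) y' := by
      funext z; simp only [density, h1, h2]
    rw [h1, this]

lemma dependsOn_exactPath (s : Bool) (p : ℕ) : DependsOn (S.exactPath s p) (Set.Iio p) :=
  fun y y' h => by rw [exactPath_apply, exactPath_apply, S.dependsOn_exact s p h]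

/-- Integrals of test functions under the exact filter. -/
def exactInt (p : ℕ) (φ : Bool → X → (ℕ → Y) → ℝ) (s : Bool) (y : ℕ → Y) : ℝ :=
  ∫ x, φ s x y ∂(S.exact s p y)

variable {S}

lemma integral_gf_exactPath (hφ : Measurable (Function.uncurry (φ s)))
    (hb : ∀ y, ∃ c, ∀ x, |φ s x y| ≤ c) (y : ℕ → Y) :
    ∫ z, S.gf p φ s z y ∂(S.exactPath s p y) = S.exactInt p (S.step p φ) s y := by
  have hi := integrable_gf (S := S) (p := p) hφ hb y (S.exactPath s p y)
  rw [exactPath, predict] at hi ⊢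
  rw [Kernel.integral_comp hi]
  rfl

lemma exactInt_zero (y : ℕ → Y) (hφ : Measurable (Function.uncurry (φ s))) :
    S.exactInt 0 φ s y = φ s S.x0 y := by
  rw [exactInt, exact_zero]
  exact integral_dirac' (fun x => φ s x y) S.x0 (hφ.comp measurable_prodMk_right).stronglyMeasurable

/-- One step of time is moved into the test function. This recursion drives the inductions on the
exact filter, since it leaves a filter at the earlier time `p`. -/
lemma exactInt_succ (hφ : Measurable (Function.uncurry (φ s)))
    (hb : ∀ y, ∃ c, ∀ x, |φ s x y| ≤ c) (y : ℕ → Y) :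
    S.exactInt (p + 1) φ s y =
      S.exactInt p (S.step p φ) s y * (S.exactInt p (S.step p one) s y)⁻¹ := by
  rw [← integral_gf_exactPath hφ hb,
    ← integral_gf_exactPath measurable_const fun _ => ⟨1, by simp [one]⟩, exactInt, exact_succ,
    integral_update y (f := fun x => φ s x y) (hφ.comp measurable_prodMk_right), ← div_eq_mul_inv]
  simp only [gf, one, mul_one]

/-- Averages of the potential are bounded below in the mean. -/
lemma inv_integral_lo (hS : S.Good Cs) {m : Kernel (ℕ → Y) Z} [IsMarkovKernel m]
    (hm : DependsOn m (Set.Iio p)) (s : Bool) :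
    CLO S.ν p (fun y => (∫ z, S.gf p one s z y ∂(m y))⁻¹) 1 Cs := by
  have hg : Measurable (Function.uncurry (S.gf p one s)) := measurable_gf measurable_const
  have hgi : Measurable (Function.uncurry fun z y => (S.gf p one s z y)⁻¹) := hg.inv
  have hmeas : Measurable fun y => ∫ z, S.gf p one s z y ∂(m y) :=
    (StronglyMeasurable.integral_kernel_prod_right (f := fun y z => S.gf p one s z y)
      (hg.comp measurable_swap).stronglyMeasurable).measurable
  -- Jensen puts the inverse inside the average, where inverse moments are available particle by
  -- particle; no lower bound uniform in the data is needed.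
  have h : CLO S.ν p (fun y => ∫ z, (S.gf p one s z y)⁻¹ ∂(m y)) 1 Cs :=
    CLO.integral hm hgi fun z => by
      simp only [gf_one]
      exact CLO.eval (f := fun y => (S.g s z y)⁻¹) (hS.inv_lo s z) le_rfl
  intro y
  refine (h y).of_abs_le hmeas.inv fun y' => ?_
  simp only [gf_one]
  obtain ⟨h1, h2⟩ := S.inv_integral_g_le s (y' p) (m y')
  rw [abs_of_pos (inv_pos.2 h1)]
  exact h2.trans (le_abs_self _)

lemma exactInt_step_lo (hS : S.Good Cs) (hφ : S.Nice (p + 1) φ C) (s : Bool) :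
    CLO S.ν p (S.exactInt p (S.step p φ) s) 1 (mulC Cs C) := by
  have : S.exactInt p (S.step p φ) s = fun y => ∫ z, S.gf p φ s z y ∂(S.exactPath s p y) :=
    funext fun y => (integral_gf_exactPath (hφ.meas s) (hφ.bdd s) y).symm
  rw [this]
  exact CLO.integral (S.dependsOn_exactPath s p) (measurable_gf (hφ.meas s)) (gf_lo hS hφ s)

lemma inv_exactInt_step_one_lo (hS : S.Good Cs) (p : ℕ) (s : Bool) :
    CLO S.ν p (fun y => (S.exactInt p (S.step p one) s y)⁻¹) 1 Cs := by
  have : S.exactInt p (S.step p one) s = fun y => ∫ z, S.gf p one s z y ∂(S.exactPath s p y) :=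
    funext fun y => (integral_gf_exactPath ((S.nice_one p).meas s) ((S.nice_one p).bdd s) y).symm
  rw [this]
  exact inv_integral_lo hS (S.dependsOn_exactPath s p) s

lemma exactInt_step_one_pos (p : ℕ) (s : Bool) (y : ℕ → Y) :
    0 < S.exactInt p (S.step p one) s y := by
  rw [← integral_gf_exactPath ((S.nice_one p).meas s) ((S.nice_one p).bdd s) y]
  simp only [gf_one]
  exact (S.inv_integral_g_le s (y p) _).1

end ExactFilter

end CoupledSystem

/-- The difference of the exact filters at the two levels is of the order of the strong error. -/
theorem exactInt_diff_lo (p : ℕ) : ∀ Cs C : ℕ → ℝ≥0, ∃ C' : ℕ → ℝ≥0, ∀ {X Z Y : Type}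
    [MeasurableSpace X] [MeasurableSpace Z] [MeasurableSpace Y] (S : CoupledSystem X Z Y),
    S.Good Cs → ∀ φ, S.Nice p φ C →
      LO (seqLaw S.ν) (fun y => S.exactInt p φ true y - S.exactInt p φ false y) S.ε C' := by
  induction p with
  | zero =>
    intro Cs C
    refine ⟨C, fun S hS φ hφ => ?_⟩
    have := (hφ.diff S.x0 S.x0).seqLaw
    simp only [CoupledSystem.exactInt_zero _ (hφ.meas _)]
    rwa [S.d_self, zero_add] at this
  | succ p ih =>
    intro Cs C
    obtain ⟨C1, h1⟩ := ih Cs (CoupledSystem.stepC Cs C fun _ => 1)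
    obtain ⟨C2, h2⟩ := ih Cs (CoupledSystem.stepC Cs (fun _ => 1) fun _ => 1)
    -- The witness is left open and is read off from `t` at the end.
    constructor
    intro X Z Y _ _ _ S hS φ hφ
    have hone := S.nice_one (p + 1)
    have a1 := h1 S hS _ (hφ.step hS)
    have b1 := h2 S hS _ (hone.step hS)
    have i1 := (CoupledSystem.inv_exactInt_step_one_lo hS p true).seqLaw
    have i0 := (CoupledSystem.inv_exactInt_step_one_lo hS p false).seqLaw
    have a0 := (CoupledSystem.exactInt_step_lo hS hφ false).seqLaw
    -- Difference of ratios: α₁/β₁ - α₀/β₀ = (α₁ - α₀)/β₁ - α₀ (β₁ - β₀)/(β₁ β₀), where α and β are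
    -- the integrals of `step φ` and `step 1`.
    have t := (a1.mul i1).sub ((((a0.mul i1).mul i0).mul b1).mono (δ := S.ε * 1) (by simp))
    rw [mul_one] at t
    convert t using 2 with y
    rw [CoupledSystem.exactInt_succ (hφ.meas _) (hφ.bdd _),
      CoupledSystem.exactInt_succ (hφ.meas _) (hφ.bdd _)]
    have p1 := (CoupledSystem.exactInt_step_one_pos (S := S) p true y).ne'
    have p0 := (CoupledSystem.exactInt_step_one_pos (S := S) p false y).ne'
    field_simp
    ring

end CoupledPF

namespace CoupledPF

/-! ### Maximal coupling of two weight vectors -/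

section MaximalCoupling

variable {N : ℕ} {a a' : Fin N → ℝ}

lemma sum_residual (ha : ∑ i, a i = 1) : ∑ k, (a k - min (a k) (a' k)) = 1 - ∑ k, min (a k) (a' k) := by
  rw [Finset.sum_sub_distrib, ha]

lemma sum_residual' (ha' : ∑ i, a' i = 1) :
    ∑ k, (a' k - min (a k) (a' k)) = 1 - ∑ k, min (a k) (a' k) := by
  rw [Finset.sum_sub_distrib, ha']

lemma one_sub_sum_min_nonneg (ha : ∑ i, a i = 1) : 0 ≤ 1 - ∑ k, min (a k) (a' k) := by
  rw [← sum_residual ha]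
  exact Finset.sum_nonneg fun k _ => sub_nonneg.2 (min_le_left _ _)

lemma maxCouplingMass_nonneg (h : ∀ i, 0 ≤ a i) (h' : ∀ i, 0 ≤ a' i) (ha : ∑ i, a i = 1)
    (i j : Fin N) : 0 ≤ maxCouplingMass a a' i j := by
  unfold maxCouplingMass
  have h1 : ∀ k, 0 ≤ a k - min (a k) (a' k) := fun k => sub_nonneg.2 (min_le_left _ _)
  have h2 : ∀ k, 0 ≤ a' k - min (a k) (a' k) := fun k => sub_nonneg.2 (min_le_right _ _)
  have h3 := one_sub_sum_min_nonneg (a' := a') ha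
  have h4 : 0 ≤ ∑ k, (a k - min (a k) (a' k)) := Finset.sum_nonneg fun k _ => h1 k
  have h5 : 0 ≤ ∑ k, (a' k - min (a k) (a' k)) := Finset.sum_nonneg fun k _ => h2 k
  have h6 : 0 ≤ if i = j then min (a i) (a' i) else 0 := by
    split_ifs
    · exact le_min (h i) (h' i)
    · exact le_rfl
  have h7 := h1 i
  have h8 := h2 j
  positivity

/-- If the total residual mass is zero then each residual vanishes, so the convention `0 / 0 = 0`
gives the right value. -/
lemma residual_div_mul (ha : ∑ i, a i = 1) (i : Fin N) :
    (1 - ∑ k, min (a k) (a' k)) * ((a i - min (a i) (a' i)) / ∑ k, (a k - min (a k) (a' k))) =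
      a i - min (a i) (a' i) := by
  have h1 : ∀ k, 0 ≤ a k - min (a k) (a' k) := fun k => sub_nonneg.2 (min_le_left _ _)
  by_cases h : 1 - ∑ k, min (a k) (a' k) = 0
  · have h2 := sum_residual (a' := a') ha
    rw [h] at h2
    have := (Finset.sum_eq_zero_iff_of_nonneg fun k _ => h1 k).1 h2 i (Finset.mem_univ i)
    rw [this, h, zero_mul]
  · rw [sum_residual ha]; field_simp

lemma residual_div_mul' (ha' : ∑ i, a' i = 1) (i : Fin N) :
    (1 - ∑ k, min (a k) (a' k)) * ((a' i - min (a i) (a' i)) / ∑ k, (a' k - min (a k) (a' k))) =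
      a' i - min (a i) (a' i) := by
  simpa only [min_comm] using residual_div_mul (a := a') (a' := a) ha' i

lemma residual_sum_div (ha : ∑ i, a i = 1) :
    (1 - ∑ k, min (a k) (a' k)) * ∑ i, ((a i - min (a i) (a' i)) / ∑ k, (a k - min (a k) (a' k))) =
      1 - ∑ k, min (a k) (a' k) := by
  rw [Finset.mul_sum, Finset.sum_congr rfl fun i _ => residual_div_mul ha i, sum_residual ha]

lemma residual_sum_div' (ha' : ∑ i, a' i = 1) :
    (1 - ∑ k, min (a k) (a' k)) *
        ∑ i, ((a' i - min (a i) (a' i)) / ∑ k, (a' k - min (a k) (a' k))) =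
      1 - ∑ k, min (a k) (a' k) := by
  rw [Finset.mul_sum, Finset.sum_congr rfl fun i _ => residual_div_mul' ha' i, sum_residual' ha']

lemma sum_maxCouplingMass_right (ha : ∑ i, a i = 1) (ha' : ∑ i, a' i = 1) (i : Fin N) :
    ∑ j, maxCouplingMass a a' i j = a i := by
  unfold maxCouplingMass
  rw [Finset.sum_add_distrib, Finset.sum_ite_eq, if_pos (Finset.mem_univ i), ← Finset.mul_sum,
    mul_right_comm, residual_sum_div' ha', residual_div_mul ha]
  ring

lemma sum_maxCouplingMass_left (ha : ∑ i, a i = 1) (ha' : ∑ i, a' i = 1) (j : Fin N) :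
    ∑ i, maxCouplingMass a a' i j = a' j := by
  unfold maxCouplingMass
  rw [Finset.sum_add_distrib, Finset.sum_ite_eq', if_pos (Finset.mem_univ j), ← Finset.sum_mul,
    ← Finset.mul_sum, residual_sum_div ha, residual_div_mul' ha']
  ring

/-- The diagonal part of the coupling is dominated by `a`. The independent part has total mass 1 - ∑
min, at most the ℓ¹ distance of the weights, and `f` costs at most one there. -/
lemma sum_sum_maxCouplingMass_mul_le (ha : ∑ i, a i = 1) (ha' : ∑ i, a' i = 1)
    {f : Fin N → Fin N → ℝ} (hf0 : ∀ i, 0 ≤ f i i)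
    (hf1 : ∀ i j, f i j ≤ 1) :
    ∑ i, ∑ j, maxCouplingMass a a' i j * f i j ≤ ∑ i, a i * f i i + ∑ i, |a i - a' i| := by
  have hr : ∀ k, 0 ≤ a k - min (a k) (a' k) := fun k => sub_nonneg.2 (min_le_left _ _)
  have hr' : ∀ k, 0 ≤ a' k - min (a k) (a' k) := fun k => sub_nonneg.2 (min_le_right _ _)
  have h4 : 0 ≤ ∑ k, (a k - min (a k) (a' k)) := Finset.sum_nonneg fun k _ => hr k
  have h5 : 0 ≤ ∑ k, (a' k - min (a k) (a' k)) := Finset.sum_nonneg fun k _ => hr' k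
  have h3 := one_sub_sum_min_nonneg (a' := a') ha
  set t := 1 - ∑ k, min (a k) (a' k) with ht
  set ρ := fun i => (a i - min (a i) (a' i)) / ∑ k, (a k - min (a k) (a' k)) with hρ
  set ρ' := fun i => (a' i - min (a i) (a' i)) / ∑ k, (a' k - min (a k) (a' k)) with hρ'
  have ρ0 : ∀ i, 0 ≤ ρ i := fun i => div_nonneg (hr i) h4
  have ρ0' : ∀ i, 0 ≤ ρ' i := fun i => div_nonneg (hr' i) h5
  have e : ∀ i j, maxCouplingMass a a' i j
      = (if i = j then min (a i) (a' i) else 0) + t * ρ i * ρ' j := fun i j => rfl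
  have k1 : ∑ i, ∑ j, (if i = j then min (a i) (a' i) else 0) * f i j ≤ ∑ i, a i * f i i := by
    refine Finset.sum_le_sum fun i _ => ?_
    simp only [ite_mul, zero_mul, Finset.sum_ite_eq, Finset.mem_univ, if_true]
    exact mul_le_mul_of_nonneg_right (min_le_left _ _) (hf0 i)
  have k2 : ∑ i, ∑ j, t * ρ i * ρ' j * f i j ≤ t := by
    calc ∑ i, ∑ j, t * ρ i * ρ' j * f i j ≤ ∑ i, ∑ j, t * ρ i * ρ' j := by
          refine Finset.sum_le_sum fun i _ => Finset.sum_le_sum fun j _ => ?_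
          have := mul_nonneg (mul_nonneg h3 (ρ0 i)) (ρ0' j)
          exact mul_le_of_le_one_right this (hf1 i j)
      _ = (t * ∑ j, ρ' j) * ∑ i, ρ i := by
          rw [Finset.mul_sum]
          refine Finset.sum_congr rfl fun i _ => ?_
          rw [← Finset.mul_sum]
          ring
      _ = t := by rw [residual_sum_div' ha', residual_sum_div ha]
  have k3 : t ≤ ∑ i, |a i - a' i| := by
    rw [ht, ← sum_residual (a' := a') ha]
    refine Finset.sum_le_sum fun i _ => ?_
    rcases le_total (a i) (a' i) with h | h
    · rw [min_eq_left h, sub_self]; positivity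
    · rw [min_eq_right h]; exact le_abs_self _
  simp only [e, add_mul, Finset.sum_add_distrib]
  linarith

end MaximalCoupling

/-! ### Empirical measures and product kernels -/

section Averages

/-- The empirical measure. -/
def emp {N : ℕ} {Z : Type*} [MeasurableSpace Z] (w : Fin N → Z) : Measure Z :=
  (N : ℝ≥0∞)⁻¹ • ∑ i, Measure.dirac (w i)

variable {N : ℕ} [NeZero N] {Z : Type*} [MeasurableSpace Z]

instance (w : Fin N → Z) : IsProbabilityMeasure (emp w) := by
  constructor
  simp only [emp, Measure.smul_apply, Measure.coe_finsetSum, Finset.sum_apply, measure_univ,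
    Finset.sum_const, Finset.card_univ, Fintype.card_fin, nsmul_eq_mul, mul_one, smul_eq_mul]
  exact ENNReal.inv_mul_cancel (by simpa using NeZero.ne N) (ENNReal.natCast_ne_top N)

lemma integral_emp (w : Fin N → Z) {f : Z → ℝ} (hf : Measurable f) :
    ∫ z, f z ∂(emp w) = empMean w f := by
  have hi : ∀ i, Integrable f (Measure.dirac (w i)) := fun i =>
    ⟨hf.aestronglyMeasurable, by
      rw [HasFiniteIntegral, lintegral_dirac' _ hf.enorm]; exact enorm_lt_top⟩
  rw [emp, integral_smul_measure, integral_finsetSum_measure fun i _ => hi i, empMean]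
  simp only [integral_dirac' _ _ hf.stronglyMeasurable, ENNReal.toReal_inv, ENNReal.toReal_natCast,
    smul_eq_mul, one_div]

lemma lintegral_emp (w : Fin N → Z) {f : Z → ℝ≥0∞} (hf : Measurable f) :
    ∫⁻ z, f z ∂(emp w) = (N : ℝ≥0∞)⁻¹ * ∑ i, f (w i) := by
  rw [emp, lintegral_smul_measure, lintegral_finsetSum_measure]
  simp only [lintegral_dirac' _ hf, smul_eq_mul]

lemma measurable_empMean {N : ℕ} {Z E : Type*} [MeasurableSpace Z] [MeasurableSpace E]
    {F : Z → E → ℝ} (hF : Measurable (Function.uncurry F)) :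
    Measurable (Function.uncurry fun (w : Fin N → Z) y => empMean w fun z => F z y) := by
  have h : ∀ i, Measurable fun q : (Fin N → Z) × E => F (q.1 i) q.2 := fun i =>
    hF.comp (by fun_prop : Measurable fun q : (Fin N → Z) × E => (q.1 i, q.2))
  exact (Finset.measurable_fun_sum _ fun i _ => h i).const_mul _

/-- Measurability of product measures with i.i.d. factors in a parameter. -/
lemma measurable_pi_kernel {α : Type*} [MeasurableSpace α] (κ : Kernel α Z) [IsMarkovKernel κ]
    (N : ℕ) : Measurable fun a => Measure.pi fun _ : Fin N => κ a := by
  refine Measurable.measure_of_isPiSystem_of_isProbabilityMeasure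
    (generateFrom_pi (α := fun _ : Fin N => Z)).symm isPiSystem_pi ?_
  rintro _ ⟨t, ht, rfl⟩
  simp only [Measure.pi_pi]
  exact Finset.measurable_fun_prod _ fun i _ => κ.measurable_coe (ht i (Set.mem_univ i))

end Averages

variable {X Z Y : Type} [MeasurableSpace X] [MeasurableSpace Z] [MeasurableSpace Y]

namespace CoupledSystem

/-! ### Laws of the generations of particle pairs -/

section Particles

variable (S : CoupledSystem X Z Y) {N : ℕ}

/-- Normalized resampling weights. -/
def wt (s : Bool) (p : ℕ) (y : ℕ → Y) (w : Fin N → Z) (i : Fin N) : ℝ :=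
  S.g s (w i) (y p) / ∑ k, S.g s (w k) (y p)

/-- The mass of the ancestor pair `(i, j)`. -/
def mass (p : ℕ) (y : ℕ → Y) (w : Fin N → Z) (i j : Fin N) : ℝ :=
  maxCouplingMass (S.wt true p y w) (S.wt false p y w) i j

/-- The conditional law of a particle pair of generation `p`. -/
def singleLaw : ℕ → (ℕ → Y) × (Fin N → Z) → Measure Z
  | 0, _ => S.K (S.x0, S.x0)
  | p + 1, q => ∑ i, ∑ j, ENNReal.ofReal (S.mass p q.1 q.2 i j) •
      S.K (S.e true (q.2 i), S.e false (q.2 j))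

variable {S}

lemma measurable_wt (s : Bool) (p : ℕ) (i : Fin N) :
    Measurable fun q : (ℕ → Y) × (Fin N → Z) => S.wt s p q.1 q.2 i := by
  have h : ∀ i, Measurable fun q : (ℕ → Y) × (Fin N → Z) => S.g s (q.2 i) (q.1 p) := fun i =>
    (S.measurable_g s).comp
      (by fun_prop : Measurable fun q : (ℕ → Y) × (Fin N → Z) => (q.2 i, q.1 p))
  exact (h i).div (Finset.measurable_fun_sum _ fun k _ => h k)

lemma measurable_mass (p : ℕ) (i j : Fin N) :
    Measurable fun q : (ℕ → Y) × (Fin N → Z) => S.mass p q.1 q.2 i j := by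
  have h := fun s i => measurable_wt (S := S) (N := N) s p i
  have hmin : ∀ k, Measurable fun q : (ℕ → Y) × (Fin N → Z) =>
      min (S.wt true p q.1 q.2 k) (S.wt false p q.1 q.2 k) := fun k => (h true k).min (h false k)
  have hs : Measurable fun q : (ℕ → Y) × (Fin N → Z) =>
      ∑ k, min (S.wt true p q.1 q.2 k) (S.wt false p q.1 q.2 k) :=
    Finset.measurable_fun_sum _ fun k _ => hmin k
  unfold mass maxCouplingMass
  refine Measurable.add ?_ (((hs.const_sub 1).mul (((h true i).sub (hmin i)).div
    (Finset.measurable_fun_sum _ fun k _ => (h true k).sub (hmin k)))).mul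
      (((h false j).sub (hmin j)).div
        (Finset.measurable_fun_sum _ fun k _ => (h false k).sub (hmin k))))
  split_ifs
  · exact hmin i
  · exact measurable_const

lemma measurable_singleLaw (p : ℕ) : Measurable (S.singleLaw (N := N) p) := by
  cases p with
  | zero => exact measurable_const
  | succ p =>
    refine Measure.measurable_of_measurable_coe _ fun A hA => ?_
    simp only [singleLaw, Measure.coe_finsetSum, Finset.sum_apply, Measure.smul_apply, smul_eq_mul]
    refine Finset.measurable_fun_sum _ fun i _ => Finset.measurable_fun_sum _ fun j _ => ?_
    refine (measurable_mass p i j).ennreal_ofReal.mul ((S.K.measurable_coe hA).comp ?_)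
    exact ((S.measurable_e true).comp ((measurable_pi_apply i).comp measurable_snd)).prodMk
      ((S.measurable_e false).comp ((measurable_pi_apply j).comp measurable_snd))

variable (S) in
/-- The conditional law of a particle pair, as a kernel. -/
def single (p : ℕ) : Kernel ((ℕ → Y) × (Fin N → Z)) Z := ⟨S.singleLaw p, measurable_singleLaw p⟩

lemma wt_nonneg (s : Bool) (p : ℕ) (y : ℕ → Y) (w : Fin N → Z) (i : Fin N) :
    0 ≤ S.wt s p y w i :=
  div_nonneg (S.g_pos s _ _).le (Finset.sum_nonneg fun _ _ => (S.g_pos s _ _).le)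

lemma sum_g_pos [NeZero N] (s : Bool) (p : ℕ) (y : ℕ → Y) (w : Fin N → Z) :
    0 < ∑ k, S.g s (w k) (y p) :=
  Finset.sum_pos (fun _ _ => S.g_pos s _ _) Finset.univ_nonempty

lemma sum_wt [NeZero N] (s : Bool) (p : ℕ) (y : ℕ → Y) (w : Fin N → Z) :
    ∑ i, S.wt s p y w i = 1 := by
  simp only [wt]
  rw [← Finset.sum_div, div_self (sum_g_pos s p y w).ne']

lemma mass_nonneg [NeZero N] (p : ℕ) (y : ℕ → Y) (w : Fin N → Z) (i j : Fin N) :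
    0 ≤ S.mass p y w i j :=
  maxCouplingMass_nonneg (wt_nonneg true p y w) (wt_nonneg false p y w) (sum_wt true p y w) i j

lemma sum_sum_mass [NeZero N] (p : ℕ) (y : ℕ → Y) (w : Fin N → Z) :
    ∑ i, ∑ j, S.mass p y w i j = 1 := by
  simp only [mass, sum_maxCouplingMass_right (sum_wt true p y w) (sum_wt false p y w)]
  exact sum_wt true p y w

instance [NeZero N] (p : ℕ) : IsMarkovKernel (S.single (N := N) p) := by
  refine ⟨fun q => ⟨?_⟩⟩
  cases p with
  | zero => exact measure_univ (μ := S.K (S.x0, S.x0))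
  | succ p =>
    change S.singleLaw (p + 1) q Set.univ = 1
    simp only [singleLaw, Measure.coe_finsetSum, Finset.sum_apply, Measure.smul_apply, smul_eq_mul,
      measure_univ, mul_one]
    rw [← ENNReal.ofReal_one, ← sum_sum_mass (S := S) p q.1 q.2,
      ENNReal.ofReal_sum_of_nonneg fun i _ => Finset.sum_nonneg fun j _ => mass_nonneg _ _ _ _ _]
    exact Finset.sum_congr rfl fun i _ =>
      (ENNReal.ofReal_sum_of_nonneg fun j _ => mass_nonneg _ _ _ _ _).symm

variable (S) in
/-- The conditional law of generation `p` given the data and generation `p - 1`. -/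
def gen (p : ℕ) [NeZero N] : Kernel ((ℕ → Y) × (Fin N → Z)) (Fin N → Z) :=
  ⟨fun q => Measure.pi fun _ => S.single p q, measurable_pi_kernel _ N⟩

lemma gen_apply [NeZero N] (p : ℕ) (q : (ℕ → Y) × (Fin N → Z)) :
    S.gen p q = Measure.pi fun _ => S.single p q := rfl

instance [NeZero N] (p : ℕ) : IsMarkovKernel (S.gen (N := N) p) :=
  ⟨fun q => by rw [gen_apply]; infer_instance⟩

variable (S N) in
/-- The law of generation `p - 1` given the data (for `p = 0`, a dummy generation). -/
def gens [NeZero N] : ℕ → Kernel (ℕ → Y) (Fin N → Z)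
  | 0 => Kernel.const _ (Measure.dirac fun _ => S.z0)
  | p + 1 => Kernel.snd (gens p ⊗ₖ S.gen p)

instance [NeZero N] (p : ℕ) : IsMarkovKernel (S.gens N p) := by
  induction p with
  | zero => unfold gens; infer_instance
  | succ p ih => unfold gens; infer_instance

variable (S N) in
/-- The law of one particle pair of generation `p` given the data. -/
def part [NeZero N] (p : ℕ) : Kernel (ℕ → Y) Z := Kernel.snd (S.gens N p ⊗ₖ S.single p)

instance [NeZero N] (p : ℕ) : IsMarkovKernel (S.part N p) := by
  unfold part; infer_instance

lemma lintegral_gens_succ [NeZero N] (p : ℕ) (y : ℕ → Y) {F : (Fin N → Z) → ℝ≥0∞}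
    (hF : Measurable F) :
    ∫⁻ v, F v ∂(S.gens N (p + 1) y) = ∫⁻ w, ∫⁻ v, F v ∂(S.gen p (y, w)) ∂(S.gens N p y) := by
  rw [gens, Kernel.lintegral_snd _ _ hF, Kernel.lintegral_compProd _ _ _ (f := fun bc => F bc.2) (hF.comp measurable_snd)]

lemma lintegral_part [NeZero N] (p : ℕ) (y : ℕ → Y) {F : Z → ℝ≥0∞} (hF : Measurable F) :
    ∫⁻ z, F z ∂(S.part N p y) = ∫⁻ w, ∫⁻ z, F z ∂(S.single p (y, w)) ∂(S.gens N p y) := by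
  rw [part, Kernel.lintegral_snd _ _ hF, Kernel.lintegral_compProd _ _ _ (f := fun bc => F bc.2) (hF.comp measurable_snd)]

lemma single_congr (p : ℕ) {y y' : ℕ → Y} (h : ∀ i < p, y i = y' i) (w : Fin N → Z) :
    S.single p (y, w) = S.single p (y', w) := by
  change S.singleLaw p (y, w) = S.singleLaw p (y', w)
  cases p with
  | zero => rfl
  | succ p =>
    have hy := h p (Nat.lt_succ_self p)
    have e : ∀ s, S.wt s p y w = S.wt s p y' w := fun s => by funext i; simp only [wt, hy]
    simp only [singleLaw, mass, e]

/-- Shifted index: `gens (p + 1)` is the law of generation `p`, whose resampling used the data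
blocks up to `p - 1`. The second, weaker statement is the one needed for `part`. -/
lemma dependsOn_gens [NeZero N] (p : ℕ) : DependsOn (S.gens N (p + 1)) (Set.Iio p) ∧
    DependsOn (S.gens N p) (Set.Iio p) := by
  induction p with
  | zero =>
    have h0 : DependsOn (S.gens N 0) (Set.Iio 0) := fun _ _ _ => rfl
    refine ⟨fun y y' h => ?_, h0⟩
    refine Measure.ext_of_lintegral _ fun F hF => ?_
    rw [lintegral_gens_succ _ _ hF, lintegral_gens_succ _ _ hF, h0 h]
    rfl
  | succ p ih =>
    have h0 : DependsOn (S.gens N (p + 1)) (Set.Iio (p + 1)) := fun y y' h =>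
      ih.1 fun i hi => h i (Nat.lt_succ_of_lt hi)
    refine ⟨fun y y' h => ?_, h0⟩
    refine Measure.ext_of_lintegral _ fun F hF => ?_
    rw [lintegral_gens_succ _ _ hF, lintegral_gens_succ _ _ hF, h0 h]
    simp only [gen_apply, single_congr (p + 1) h]

lemma dependsOn_part [NeZero N] (p : ℕ) : DependsOn (S.part N p) (Set.Iio p) := fun y y' h => by
  refine Measure.ext_of_lintegral _ fun F hF => ?_
  rw [lintegral_part _ _ hF, lintegral_part _ _ hF, (dependsOn_gens p).2 h]
  simp only [single_congr p h]

/-- Particles of a generation have the same law. -/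
lemma lintegral_gens_average [NeZero N] (p : ℕ) (y : ℕ → Y) {F : Z → ℝ≥0∞} (hF : Measurable F) :
    ∫⁻ v, (N : ℝ≥0∞)⁻¹ * ∑ i, F (v i) ∂(S.gens N (p + 1) y) = ∫⁻ z, F z ∂(S.part N p y) := by
  have hF' : ∀ i, Measurable fun v : Fin N → Z => F (v i) := fun i => hF.comp (measurable_pi_apply i)
  rw [lintegral_gens_succ _ _ ((Finset.measurable_fun_sum _ fun i _ => hF' i).const_mul _),
    lintegral_part _ _ hF]
  refine lintegral_congr fun w => ?_
  rw [lintegral_const_mul _ (Finset.measurable_fun_sum _ fun i _ => hF' i),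
    lintegral_finsetSum _ fun i _ => hF' i]
  have : ∀ i : Fin N, ∫⁻ v, F (v i) ∂(S.gen p (y, w)) = ∫⁻ z, F z ∂(S.single p (y, w)) := fun i =>
    (measurePreserving_eval (fun _ : Fin N => S.single p (y, w)) i).lintegral_comp hF
  simp only [this, Finset.sum_const, Finset.card_univ, Fintype.card_fin, nsmul_eq_mul]
  rw [← mul_assoc, ENNReal.inv_mul_cancel (by simpa using NeZero.ne N) (ENNReal.natCast_ne_top N),
    one_mul]

variable (S N) in
/-- The joint law of the data and generation `p - 1`. -/
def joint [NeZero N] (p : ℕ) : Measure ((ℕ → Y) × (Fin N → Z)) := seqLaw S.ν ⊗ₘ S.gens N p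

instance [NeZero N] (p : ℕ) : IsProbabilityMeasure (S.joint N p) := by
  unfold joint; infer_instance

variable (S N) in
/-- The joint law of the data and generations `p - 1`, `p`. -/
def joint₂ [NeZero N] (p : ℕ) : Measure (((ℕ → Y) × (Fin N → Z)) × (Fin N → Z)) :=
  S.joint N p ⊗ₘ S.gen p

instance [NeZero N] (p : ℕ) : IsProbabilityMeasure (S.joint₂ N p) := by
  unfold joint₂; infer_instance

lemma lintegral_joint [NeZero N] (p : ℕ) {F : (ℕ → Y) × (Fin N → Z) → ℝ≥0∞} (hF : Measurable F) :
    ∫⁻ q, F q ∂(S.joint N p) = ∫⁻ y, ∫⁻ w, F (y, w) ∂(S.gens N p y) ∂(seqLaw S.ν) :=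
  Measure.lintegral_compProd hF

lemma measurePreserving_joint_fst [NeZero N] (p : ℕ) :
    MeasurePreserving Prod.fst (S.joint N p) (seqLaw S.ν) :=
  ⟨measurable_fst, Measure.fst_compProd _ _⟩

lemma measurePreserving_joint₂_fst [NeZero N] (p : ℕ) :
    MeasurePreserving Prod.fst (S.joint₂ N p) (S.joint N p) :=
  ⟨measurable_fst, Measure.fst_compProd _ _⟩

lemma measurePreserving_joint₂ [NeZero N] (p : ℕ) :
    MeasurePreserving (fun r : ((ℕ → Y) × (Fin N → Z)) × (Fin N → Z) => (r.1.1, r.2))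
      (S.joint₂ N p) (S.joint N (p + 1)) := by
  have hm : Measurable fun r : ((ℕ → Y) × (Fin N → Z)) × (Fin N → Z) => (r.1.1, r.2) := by fun_prop
  refine ⟨hm, Measure.ext_of_lintegral _ fun F hF => ?_⟩
  rw [lintegral_map hF hm, joint₂, Measure.lintegral_compProd
    (f := fun r : ((ℕ → Y) × (Fin N → Z)) × (Fin N → Z) => F (r.1.1, r.2)) (hF.comp hm), lintegral_joint p,
    lintegral_joint _ hF]
  · refine lintegral_congr fun y => ?_
    rw [lintegral_gens_succ p y (F := fun v => F (y, v)) (hF.comp measurable_prodMk_left)]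
  · exact Measurable.lintegral_kernel_prod_right
      (f := fun (q : (ℕ → Y) × (Fin N → Z)) v => F (q.1, v)) (hF.comp hm)

/-- Conditional moment bounds for functions of the particles integrate to moment bounds. -/
lemma lo_joint [NeZero N] {p : ℕ} {F : (Fin N → Z) → (ℕ → Y) → ℝ} {ε : ℝ≥0} {C : ℕ → ℝ≥0}
    (hF : Measurable (Function.uncurry F)) (h : ∀ w, CLO S.ν p (F w) ε C) :
    LO (S.joint N (p + 1)) (fun q => F q.2 q.1) ε C where
  meas := hF.comp measurable_swap
  bound r := by
    have hFe : Measurable (Function.uncurry fun w y => ‖F w y‖ₑ ^ r) := hF.enorm.pow_const r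
    rw [lintegral_joint _ (F := fun q => ‖F q.2 q.1‖ₑ ^ r) (hFe.comp measurable_swap)]
    refine (lintegral_seqLaw_kernel_le S.ν (dependsOn_gens p).1 hFe
      (B := fun _ => C r * (ε : ℝ≥0∞) ^ r) fun y w => (h w y).bound r).trans ?_
    simp

/-- Given the data and the previous generation, the new pairs are i.i.d., so Marcinkiewicz–Zygmund
applies conditionally. Its right-hand side is a moment and not a supremum, hence it averages to a
moment under the law of a single pair. -/
lemma lintegral_joint₂_local [NeZero N] {p : ℕ} {F : Z → (ℕ → Y) → ℝ}
    (hF : Measurable (Function.uncurry F)) (hb : ∀ y, ∃ c, ∀ z, |F z y| ≤ c) (m : ℕ) :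
    ∫⁻ r, ‖empMean r.2 (fun z => F z r.1.1) - ∫ z, F z r.1.1 ∂(S.single p r.1)‖ₑ ^ (2 * m)
      ∂(S.joint₂ N p) ≤ (mzConst m * 2 ^ (2 * m + 1) : ℝ≥0) * (fluct N : ℝ≥0∞) ^ (2 * m) *
        ∫⁻ y, ∫⁻ z, ‖F z y‖ₑ ^ (2 * m) ∂(S.part N p y) ∂(seqLaw S.ν) := by
  have m1 : Measurable fun r : ((ℕ → Y) × (Fin N → Z)) × (Fin N → Z) =>
      empMean r.2 (fun z => F z r.1.1) := by
    exact (measurable_empMean hF).comp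
      (by fun_prop : Measurable fun r : ((ℕ → Y) × (Fin N → Z)) × (Fin N → Z) => (r.2, r.1.1))
  have m2 : Measurable fun q : (ℕ → Y) × (Fin N → Z) => ∫ z, F z q.1 ∂(S.single p q) :=
    (StronglyMeasurable.integral_kernel_prod_right (κ := S.single (N := N) p)
      (f := fun q z => F z q.1) (hF.comp (measurable_snd.prodMk
        (measurable_fst.comp measurable_fst))).stronglyMeasurable).measurable
  have hFe : Measurable (Function.uncurry fun z y => ‖F z y‖ₑ ^ (2 * m)) := hF.enorm.pow_const _
  have m3 : Measurable fun q : (ℕ → Y) × (Fin N → Z) => ∫⁻ z, ‖F z q.1‖ₑ ^ (2 * m)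
      ∂(S.single p q) :=
    Measurable.lintegral_kernel_prod_right (κ := S.single (N := N) p)
      (f := fun q z => ‖F z q.1‖ₑ ^ (2 * m))
      (hFe.comp (measurable_snd.prodMk (measurable_fst.comp measurable_fst)))
  rw [joint₂, Measure.lintegral_compProd (f := fun r => ‖empMean r.2 (fun z => F z r.1.1)
    - ∫ z, F z r.1.1 ∂(S.single p r.1)‖ₑ ^ (2 * m)) ((m1.sub (m2.comp measurable_fst)).enorm.pow_const _)]
  calc _ ≤ ∫⁻ q, (mzConst m * 2 ^ (2 * m + 1) : ℝ≥0) * (fluct N : ℝ≥0∞) ^ (2 * m) *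
        ∫⁻ z, ‖F z q.1‖ₑ ^ (2 * m) ∂(S.single p q) ∂(S.joint N p) := by
        refine lintegral_mono fun q => ?_
        obtain ⟨c, hc⟩ := hb q.1
        exact lintegral_empMean_sub_pow_le (μ := S.single p q) (f := fun z => F z q.1)
          (hF.comp measurable_prodMk_right) hc m (Nat.one_le_iff_ne_zero.2 (NeZero.ne N))
    _ = _ := by
        rw [lintegral_const_mul _ m3, lintegral_joint _ m3]
        congr 1
        refine lintegral_congr fun y => ?_
        rw [lintegral_part p y (F := fun z => ‖F z y‖ₑ ^ (2 * m)) (hFe.comp measurable_prodMk_right)]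

lemma measurable_local [NeZero N] {p : ℕ} {F : Z → (ℕ → Y) → ℝ}
    (hF : Measurable (Function.uncurry F)) :
    Measurable fun r : ((ℕ → Y) × (Fin N → Z)) × (Fin N → Z) =>
      empMean r.2 (fun z => F z r.1.1) - ∫ z, F z r.1.1 ∂(S.single p r.1) := by
  have m1 : Measurable fun r : ((ℕ → Y) × (Fin N → Z)) × (Fin N → Z) =>
      empMean r.2 (fun z => F z r.1.1) := by
    exact (measurable_empMean hF).comp
      (by fun_prop : Measurable fun r : ((ℕ → Y) × (Fin N → Z)) × (Fin N → Z) => (r.2, r.1.1))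
  have m2 : Measurable fun q : (ℕ → Y) × (Fin N → Z) => ∫ z, F z q.1 ∂(S.single p q) :=
    (StronglyMeasurable.integral_kernel_prod_right (κ := S.single (N := N) p)
      (f := fun q z => F z q.1) (hF.comp (measurable_snd.prodMk
        (measurable_fst.comp measurable_fst))).stronglyMeasurable).measurable
  exact m1.sub (m2.comp measurable_fst)

/-- Moment constants of sampling errors. -/
def localC (C : ℕ → ℝ≥0) (r : ℕ) : ℝ≥0 := mzConst r * 2 ^ (2 * r + 1) * C (2 * r) + 1

/-- The sampling error is of order `N ^ (-1 / 2)`. -/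
lemma local_lo [NeZero N] {p : ℕ} {F : Z → (ℕ → Y) → ℝ} {C : ℕ → ℝ≥0}
    (hF : Measurable (Function.uncurry F)) (hb : ∀ y, ∃ c, ∀ z, |F z y| ≤ c)
    (h : ∀ z, CLO S.ν p (F z) 1 C) :
    LO (S.joint₂ N p) (fun r => empMean r.2 (fun z => F z r.1.1)
      - ∫ z, F z r.1.1 ∂(S.single p r.1)) (fluct N) (localC C) := by
  refine LO.of_even (C := fun m => mzConst m * 2 ^ (2 * m + 1) * C (2 * m)) (measurable_local hF)
    fun m => (lintegral_joint₂_local hF hb m).trans ?_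
  have hFe : Measurable (Function.uncurry fun z y => ‖F z y‖ₑ ^ (2 * m)) := hF.enorm.pow_const _
  have := lintegral_seqLaw_kernel_le S.ν (dependsOn_part (S := S) (N := N) p) hFe
    (B := fun _ => C (2 * m)) fun y z => by simpa using (h z y).bound (2 * m)
  calc _ ≤ (mzConst m * 2 ^ (2 * m + 1) : ℝ≥0) * (fluct N : ℝ≥0∞) ^ (2 * m) *
        ∫⁻ y, ∫⁻ _, C (2 * m) ∂(S.part N p y) ∂(seqLaw S.ν) := by gcongr
    _ = _ := by simp; ring

end Particles

/-! ### The particle filter at one level and its fluctuations -/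

section ParticleFilter

variable (S : CoupledSystem X Z Y) {N : ℕ}

/-- The particle approximation of the filter at time `p`. -/
def partInt : ℕ → (Bool → X → (ℕ → Y) → ℝ) → Bool → (ℕ → Y) → (Fin N → Z) → ℝ
  | 0, φ, s, y, _ => φ s S.x0 y
  | p + 1, φ, s, y, w => empMean w (fun z => S.gf p φ s z y) *
      (empMean w fun z => S.gf p one s z y)⁻¹

variable {S} {p : ℕ} {φ : Bool → X → (ℕ → Y) → ℝ} {C Cs Cκ : ℕ → ℝ≥0} {s : Bool}

lemma partInt_succ_eq [NeZero N] (y : ℕ → Y) (w : Fin N → Z) :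
    S.partInt (p + 1) φ s y w = ∑ i, S.wt s p y w i * φ s (S.e s (w i)) y := by
  have hN : (N : ℝ) ≠ 0 := by simpa using NeZero.ne N
  have hs := (sum_g_pos (S := S) s p y w).ne'
  simp only [partInt, empMean, gf, one, mul_one, wt]
  rw [Finset.mul_sum, Finset.sum_mul]
  refine Finset.sum_congr rfl fun i _ => ?_
  field_simp

/-- The mean of a weighted test function of a new particle is the particle filter of the
propagated test function. -/
lemma integral_gf_single [NeZero N] (hφ : Measurable (Function.uncurry (φ s)))
    (hb : ∀ y, ∃ c, ∀ x, |φ s x y| ≤ c) (y : ℕ → Y) (w : Fin N → Z) :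
    ∫ z, S.gf p φ s z y ∂(S.single p (y, w)) = S.partInt p (S.step p φ) s y w := by
  cases p with
  | zero =>
    change ∫ z, S.gf 0 φ s z y ∂(S.K (S.x0, S.x0)) = S.step 0 φ s S.x0 y
    rw [integral_gf_K hφ]
    cases s <;> rfl
  | succ p =>
    change ∫ z, S.gf (p + 1) φ s z y ∂(S.singleLaw (p + 1) (y, w)) = _
    have hi : ∀ i j : Fin N, Integrable (fun z => S.gf (p + 1) φ s z y)
        (ENNReal.ofReal (S.mass p y w i j) • S.K (S.e true (w i), S.e false (w j))) := fun i j =>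
      (integrable_gf hφ hb y _).smul_measure ENNReal.ofReal_ne_top
    rw [singleLaw, integral_finsetSum_measure fun i _ =>
      integrable_finsetSum_measure.2 fun j _ => hi i j]
    have e : ∀ i j : Fin N, ∫ z, S.gf (p + 1) φ s z y
        ∂(ENNReal.ofReal (S.mass p y w i j) • S.K (S.e true (w i), S.e false (w j))) =
        S.mass p y w i j * S.step (p + 1) φ s (side s (S.e true (w i), S.e false (w j))) y := by
      intro i j
      rw [integral_smul_measure, integral_gf_K hφ, ENNReal.toReal_ofReal (mass_nonneg p y w i j),
        smul_eq_mul]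
    rw [partInt_succ_eq]
    have e2 : ∀ i : Fin N, ∫ z, S.gf (p + 1) φ s z y ∂(∑ j, ENNReal.ofReal (S.mass p y w i j) •
        S.K (S.e true (w i), S.e false (w j))) = ∑ j, S.mass p y w i j *
          S.step (p + 1) φ s (side s (S.e true (w i), S.e false (w j))) y := fun i => by
      rw [integral_finsetSum_measure fun j _ => hi i j]
      exact Finset.sum_congr rfl fun j _ => e i j
    rw [Finset.sum_congr rfl fun i _ => e2 i]
    -- The coupling has the two weight vectors as marginals: summing over the coarse ancestor leaves
    -- the fine weights, and conversely.
    cases s with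
    | true =>
      refine Finset.sum_congr rfl fun i _ => ?_
      simp only [side, cond_true]
      rw [← Finset.sum_mul]
      simp only [mass, sum_maxCouplingMass_right (sum_wt true p y w) (sum_wt false p y w)]
    | false =>
      rw [Finset.sum_comm]
      refine Finset.sum_congr rfl fun j _ => ?_
      simp only [side, cond_false]
      rw [← Finset.sum_mul]
      simp only [mass, sum_maxCouplingMass_left (sum_wt true p y w) (sum_wt false p y w)]

/-- For frozen particles the empirical measure does not depend on the data, so this is an average
under a constant kernel. -/
lemma empMean_clo [NeZero N] {F : Z → (ℕ → Y) → ℝ} (hF : Measurable (Function.uncurry F))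
    {ε : ℝ≥0} (h : ∀ z, CLO S.ν p (F z) ε C) (w : Fin N → Z) :
    CLO S.ν p (fun y => empMean w fun z => F z y) ε C := by
  have := CLO.integral (m := Kernel.const (ℕ → Y) (emp w)) (dependsOn_const _) hF h
  have e : (fun y => empMean w fun z => F z y) = fun y => ∫ z, F z y ∂(emp w) := funext fun y =>
    (integral_emp w (f := fun z => F z y) (hF.comp measurable_prodMk_right)).symm
  rw [e]
  exact this

lemma inv_empMean_clo [NeZero N] (hS : S.Good Cs) (p : ℕ) (s : Bool) (w : Fin N → Z) :
    CLO S.ν p (fun y => (empMean w fun z => S.gf p one s z y)⁻¹) 1 Cs := by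
  have := inv_integral_lo (p := p) hS (m := Kernel.const (ℕ → Y) (emp w)) (dependsOn_const _) s
  have hg := measurable_gf (S := S) (p := p) (φ := one) (s := s) measurable_const
  have e : (fun y => (empMean w fun z => S.gf p one s z y)⁻¹)
      = fun y => (∫ z, S.gf p one s z y ∂(emp w))⁻¹ := funext fun y => by
    rw [integral_emp w (f := fun z => S.gf p one s z y) (hg.comp measurable_prodMk_right)]
  rw [e]
  exact this

lemma empMean_one_pos [NeZero N] (p : ℕ) (s : Bool) (w : Fin N → Z) (y : ℕ → Y) :
    0 < empMean w fun z => S.gf p one s z y := by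
  simp only [gf_one, empMean]
  have : (0 : ℝ) < N := by exact_mod_cast Nat.pos_of_ne_zero (NeZero.ne N)
  have := sum_g_pos (S := S) s p y w
  positivity

end ParticleFilter

end CoupledSystem

lemma LO.of_comp {Ω Ω' : Type*} [MeasurableSpace Ω] [MeasurableSpace Ω'] {μ : Measure Ω}
    {μ' : Measure Ω'} {T : Ω' → Ω} (hT : MeasurePreserving T μ' μ) {f : Ω → ℝ} (hf : Measurable f)
    {ε : ℝ≥0} {C : ℕ → ℝ≥0} (h : LO μ' (fun ω => f (T ω)) ε C) : LO μ f ε C where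
  meas := hf
  bound r := by
    rw [← hT.lintegral_comp (hf.enorm.pow_const r)]
    exact h.bound r

/-- Fluctuations of the weighted empirical means. -/
lemma empMean_sub_lo_of_partInt {p : ℕ} {Cs C C1 : ℕ → ℝ≥0} {S : CoupledSystem X Z Y}
    (hS : S.Good Cs) {φ : Bool → X → (ℕ → Y) → ℝ} (hφ : S.Nice (p + 1) φ C) {N : ℕ} [NeZero N]
    {s : Bool} (h : LO (S.joint N p) (fun q => S.partInt p (S.step p φ) s q.1 q.2
      - S.exactInt p (S.step p φ) s q.1) (fluct N) C1) :
    LO (S.joint N (p + 1)) (fun q => empMean q.2 (fun z => S.gf p φ s z q.1)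
      - S.exactInt p (S.step p φ) s q.1) (fluct N) (addC (CoupledSystem.localC (mulC Cs C)) C1) := by
  have hgf := CoupledSystem.measurable_gf (S := S) (p := p) (hφ.meas s)
  have hex := (CoupledSystem.exactInt_step_lo hS hφ s).seqLaw.meas
  have hmeas : Measurable fun q : (ℕ → Y) × (Fin N → Z) => empMean q.2 (fun z => S.gf p φ s z q.1)
      - S.exactInt p (S.step p φ) s q.1 :=
    ((measurable_empMean hgf).comp measurable_swap).sub (hex.comp measurable_fst)
  -- On the joint law of two successive generations the error is the sampling error of the new
  -- generation plus the error of the old one for `step φ`.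
  refine LO.of_comp (CoupledSystem.measurePreserving_joint₂ p) hmeas ?_
  have h1 := CoupledSystem.local_lo (N := N) hgf (CoupledSystem.gf_bdd (hφ.bdd s))
    (CoupledSystem.gf_lo hS hφ s)
  have h2 := h.comp (CoupledSystem.measurePreserving_joint₂_fst p)
  convert h1.add h2 using 2 with r
  rw [CoupledSystem.integral_gf_single (hφ.meas s) (hφ.bdd s) r.1.1 r.1.2]
  ring

/-- Fluctuations of the particle filter at one level. -/
theorem partInt_sub_lo (p : ℕ) : ∀ Cs C : ℕ → ℝ≥0, ∃ C' : ℕ → ℝ≥0, ∀ {X Z Y : Type}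
    [MeasurableSpace X] [MeasurableSpace Z] [MeasurableSpace Y] (S : CoupledSystem X Z Y),
    S.Good Cs → ∀ φ, S.Nice p φ C → ∀ (N : ℕ) [NeZero N] (s : Bool),
      LO (S.joint N p) (fun q => S.partInt p φ s q.1 q.2 - S.exactInt p φ s q.1)
        (fluct N) C' := by
  induction p with
  | zero =>
    intro Cs C
    refine ⟨fun _ => 1, fun S hS φ hφ N _ s => ?_⟩
    simp only [CoupledSystem.exactInt_zero _ (hφ.meas _), CoupledSystem.partInt, sub_self]
    exact LO.const 0 (by simp)
  | succ p ih =>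
    intro Cs C
    obtain ⟨C1, h1⟩ := ih Cs (CoupledSystem.stepC Cs C fun _ => 1)
    obtain ⟨C2, h2⟩ := ih Cs (CoupledSystem.stepC Cs (fun _ => 1) fun _ => 1)
    constructor
    intro X Z Y _ _ _ S hS φ hφ N _ s
    have hone := S.nice_one (p + 1)
    have A := empMean_sub_lo_of_partInt hS hφ (h1 S hS _ (hφ.step hS) N s)
    have B := empMean_sub_lo_of_partInt hS hone (h2 S hS _ (hone.step hS) N s)
    have hinv : LO (S.joint N (p + 1))
        (fun q => (empMean q.2 fun z => S.gf p CoupledSystem.one s z q.1)⁻¹) 1 Cs :=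
      CoupledSystem.lo_joint (measurable_empMean
        (CoupledSystem.measurable_gf measurable_const)).inv
          fun w => CoupledSystem.inv_empMean_clo hS p s w
    have hq := ((CoupledSystem.exactInt_step_lo hS hφ s).seqLaw.mul
      (CoupledSystem.inv_exactInt_step_one_lo hS p s).seqLaw).comp
        (CoupledSystem.measurePreserving_joint_fst (N := N) (p + 1))
    -- With `a`, `b` the empirical means and α, β their limits: a/b - α/β = b⁻¹ (a - α) - b⁻¹ (α/β)
    -- (b - β).
    have t := ((hinv.mul A).mono (δ := fluct N) (by simp)).sub
      (((hinv.mul hq).mul B).mono (δ := fluct N) (by simp))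
    convert t using 2 with q
    rw [CoupledSystem.exactInt_succ (hφ.meas _) (hφ.bdd _), CoupledSystem.partInt]
    have p1 := (CoupledSystem.exactInt_step_one_pos (S := S) p s q.1).ne'
    have p2 := (CoupledSystem.empMean_one_pos (S := S) p s q.2 q.1).ne'
    field_simp
    ring

end CoupledPF

namespace CoupledPF

/-! ### Random variables with a second moment of a given order -/

section SecondMoments

variable {Ω Ω' : Type*} [MeasurableSpace Ω] [MeasurableSpace Ω'] {μ : Measure Ω} {μ' : Measure Ω'}

/-- The second moment of `f` is of order `ρ`. -/
structure SO (μ : Measure Ω) (f : Ω → ℝ) (ρ c : ℝ≥0) : Prop where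
  meas : Measurable f
  bound : ∫⁻ ω, ‖f ω‖ₑ ^ 2 ∂μ ≤ c * (ρ : ℝ≥0∞)

variable {f g : Ω → ℝ} {ρ ρ' c c' ε δ η : ℝ≥0} {C C' : ℕ → ℝ≥0}

lemma LO.so (hf : LO μ f ε C) (h : ε ^ 2 ≤ ρ) : SO μ f ρ (C 2) where
  meas := hf.meas
  bound := (hf.bound 2).trans (by gcongr; exact_mod_cast h)

namespace SO

lemma mono (hf : SO μ f ρ c) (h : ρ ≤ ρ') : SO μ f ρ' c where
  meas := hf.meas
  bound := hf.bound.trans (by gcongr)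

lemma neg (hf : SO μ f ρ c) : SO μ (fun ω => -f ω) ρ c where
  meas := hf.meas.neg
  bound := by simpa using hf.bound

lemma add (hf : SO μ f ρ c) (hg : SO μ g ρ c') : SO μ (fun ω => f ω + g ω) ρ (4 * (c + c')) where
  meas := hf.meas.add hg.meas
  bound := by
    have key : ∀ x y : ℝ≥0∞, (x + y) ^ 2 ≤ 4 * (x ^ 2 + y ^ 2) := by
      intro x y
      wlog h : x ≤ y generalizing x y
      · rw [add_comm x y, add_comm (x ^ 2)]; exact this y x (le_of_not_ge h)
      calc (x + y) ^ 2 ≤ (2 * y) ^ 2 := by rw [two_mul]; gcongr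
        _ = 4 * y ^ 2 := by ring
        _ ≤ _ := by gcongr; exact le_add_self
    have h1 := hf.meas.enorm.pow_const 2
    have h2 := hg.meas.enorm.pow_const 2
    calc ∫⁻ ω, ‖f ω + g ω‖ₑ ^ 2 ∂μ ≤ ∫⁻ ω, 4 * (‖f ω‖ₑ ^ 2 + ‖g ω‖ₑ ^ 2) ∂μ :=
          lintegral_mono fun ω => (pow_le_pow_left' (enorm_add_le _ _) 2).trans (key _ _)
      _ = 4 * ((∫⁻ ω, ‖f ω‖ₑ ^ 2 ∂μ) + ∫⁻ ω, ‖g ω‖ₑ ^ 2 ∂μ) := by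
          rw [← lintegral_add_left h1]
          exact lintegral_const_mul _ (h1.add h2)
      _ ≤ 4 * (c * ρ + c' * ρ) := by
          gcongr
          · exact hf.bound
          · exact hg.bound
      _ = _ := by push_cast; ring

lemma sub (hf : SO μ f ρ c) (hg : SO μ g ρ c') : SO μ (fun ω => f ω - g ω) ρ (4 * (c + c')) := by
  simpa only [sub_eq_add_neg] using hf.add hg.neg

lemma of_comp {T : Ω' → Ω} (hT : MeasurePreserving T μ' μ) (hf : Measurable f)
    (h : SO μ' (fun ω => f (T ω)) ρ c) : SO μ f ρ c where
  meas := hf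
  bound := by
    rw [← hT.lintegral_comp (hf.enorm.pow_const 2)]
    exact h.bound

lemma comp {T : Ω' → Ω} (hT : MeasurePreserving T μ' μ) (h : SO μ f ρ c) :
    SO μ' (fun ω => f (T ω)) ρ c where
  meas := h.meas.comp hT.measurable
  bound := by
    rw [hT.lintegral_comp (f := fun ω => ‖f ω‖ₑ ^ 2) (h.meas.enorm.pow_const 2)]
    exact h.bound

lemma mul (hf : SO μ f (η ^ 2) c) (hf' : LO μ f δ C) (hg : LO μ g δ C') :
    SO μ (fun ω => f ω * g ω) (η * δ ^ 3) (c + mulC (mulC C C') C' 2) where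
  meas := hf.meas.mul hg.meas
  bound := by
    have := lintegral_sq_mul_le (η := η) (by simpa using hf.bound) hf' hg
    simpa using this

end SO

end SecondMoments

lemma enorm_empMean_pow_le {N : ℕ} [NeZero N] {Z : Type*} [MeasurableSpace Z] (w : Fin N → Z)
    {f : Z → ℝ} (hf : Measurable f) (r : ℕ) :
    ‖empMean w f‖ₑ ^ r ≤ (N : ℝ≥0∞)⁻¹ * ∑ i, ‖f (w i)‖ₑ ^ r := by
  rw [← integral_emp w hf, ← lintegral_emp w (hf.enorm.pow_const r)]
  exact (pow_le_pow_left' (enorm_integral_le_lintegral_enorm _) r).trans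
    (pow_lintegral_le hf.enorm.aemeasurable r)

lemma empMean_sub {N : ℕ} {Z : Type*} (w : Fin N → Z) (f g : Z → ℝ) :
    empMean w f - empMean w g = empMean w fun z => f z - g z := by
  simp only [empMean, Finset.sum_sub_distrib, mul_sub]

lemma empMean_const_mul {N : ℕ} {Z : Type*} (w : Fin N → Z) (c : ℝ) (f : Z → ℝ) :
    c * empMean w f = empMean w fun z => c * f z := by
  simp only [empMean, Finset.mul_sum]
  exact Finset.sum_congr rfl fun i _ => by ring

/-- The total variation distance of normalized weights. -/
lemma sum_abs_div_sub_div_le {N : ℕ} {g g' : Fin N → ℝ} (hg : 0 < ∑ i, g i)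
    (h : ∀ i, 0 ≤ g' i) (hg' : 0 < ∑ i, g' i) :
    ∑ i, |g i / ∑ k, g k - g' i / ∑ k, g' k| ≤ 2 * (∑ i, |g i - g' i|) / ∑ k, g k := by
  set G := ∑ i, g i with hG
  set G' := ∑ i, g' i with hG'
  have h1 : |G' - G| ≤ ∑ i, |g i - g' i| := by
    rw [abs_sub_comm, hG, hG', ← Finset.sum_sub_distrib]
    exact Finset.abs_sum_le_sum_abs _ _
  have h2 : ∀ i, |g i / G - g' i / G'| ≤ |g i - g' i| / G + g' i * (|G' - G| / (G * G')) := by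
    intro i
    have e : g i / G - g' i / G' = (g i - g' i) / G + g' i * ((G' - G) / (G * G')) := by
      field_simp; ring
    rw [e]
    refine (abs_add_le _ _).trans (le_of_eq ?_)
    rw [abs_mul, abs_div, abs_div, abs_of_pos hg, abs_of_pos (mul_pos hg hg'), abs_of_nonneg (h i)]
  calc ∑ i, |g i / G - g' i / G'| ≤ ∑ i, (|g i - g' i| / G + g' i * (|G' - G| / (G * G'))) :=
        Finset.sum_le_sum fun i _ => h2 i
    _ = (∑ i, |g i - g' i|) / G + |G' - G| / G := by
        rw [Finset.sum_add_distrib, ← Finset.sum_div, ← Finset.sum_mul, ← hG']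
        field_simp
    _ ≤ (∑ i, |g i - g' i|) / G + (∑ i, |g i - g' i|) / G := by gcongr
    _ = _ := by ring

variable {X Z Y : Type} [MeasurableSpace X] [MeasurableSpace Z] [MeasurableSpace Y]

/-! ### Closeness of the particle pairs in the mean -/

namespace CoupledSystem

variable {S : CoupledSystem X Z Y} {N : ℕ} {p : ℕ} {φ : Bool → X → (ℕ → Y) → ℝ}
  {C Cs Cκ : ℕ → ℝ≥0} {s : Bool}

variable (S) in
/-- The truncated distance of the paths of a pair. -/
def dist₁ (z : Z) : ℝ≥0 := min 1 (S.D z)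

lemma measurable_dist₁ : Measurable S.dist₁ := measurable_const.min S.measurable_D

variable (S N) in
/-- The mean truncated distance of the particle pairs of generation `p`. -/
def meanDist [NeZero N] (p : ℕ) : ℝ≥0∞ := ∫⁻ y, ∫⁻ z, S.dist₁ z ∂(S.part N p y) ∂(seqLaw S.ν)

/-- Truncation is kept on both sides: for starting points at distance less than one the moment bound
applies, otherwise the trivial bound one is enough. -/
lemma lintegral_K_dist₁_le (hS : S.Good Cs) (x : X × X) :
    ∫⁻ z, S.dist₁ z ∂(S.K x) ≤ (Cs 1 + 1 : ℝ≥0) * ((min 1 (S.d x.1 x.2) + S.ε : ℝ≥0) : ℝ≥0∞) := by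
  rcases le_total (S.d x.1 x.2) 1 with h | h
  · rw [min_eq_right h]
    calc ∫⁻ z, S.dist₁ z ∂(S.K x) ≤ ∫⁻ z, (S.D z : ℝ≥0∞) ^ 1 ∂(S.K x) := by
          refine lintegral_mono fun z => ?_
          rw [pow_one]
          exact ENNReal.coe_le_coe.2 (min_le_right _ _)
      _ ≤ _ := hS.D_moment x 1
      _ ≤ _ := by rw [pow_one]; gcongr; exact le_self_add
  · rw [min_eq_left h]
    calc ∫⁻ z, S.dist₁ z ∂(S.K x) ≤ ∫⁻ _, 1 ∂(S.K x) := by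
          refine lintegral_mono fun z => ?_
          exact (ENNReal.coe_le_coe.2 (min_le_left 1 (S.D z))).trans_eq ENNReal.coe_one
      _ = ((1 * 1 : ℝ≥0) : ℝ≥0∞) := by simp
      _ ≤ _ := by
          rw [ENNReal.coe_mul]
          gcongr
          · exact le_add_self
          · exact le_self_add

/-- Each summand is bounded given the data before `p`, where the particles are frozen, by a function
of one pair; then the average over the generation becomes an integral under the law of a single
pair. -/
lemma lintegral_joint_average_le [NeZero N] {F : Fin N → (Fin N → Z) → (ℕ → Y) → ℝ≥0∞}
    (hF : ∀ i, Measurable (Function.uncurry (F i))) {c : ℝ≥0}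
    (h : ∀ i w y, ∫⁻ y', F i w y' ∂(fut S.ν p y) ≤ c * (S.dist₁ (w i) : ℝ≥0∞)) :
    ∫⁻ y, ∫⁻ w, (N : ℝ≥0∞)⁻¹ * ∑ i, F i w y ∂(S.gens N (p + 1) y) ∂(seqLaw S.ν) ≤
      c * S.meanDist N p := by
  have hm : Measurable (Function.uncurry fun w y => (N : ℝ≥0∞)⁻¹ * ∑ i, F i w y) :=
    (Finset.measurable_fun_sum _ fun i _ => hF i).const_mul _
  have hd : Measurable fun z => (c : ℝ≥0∞) * (S.dist₁ z : ℝ≥0∞) :=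
    measurable_dist₁.coe_nnreal_ennreal.const_mul _
  refine (lintegral_seqLaw_kernel_le S.ν (dependsOn_gens p).1 hm
    (B := fun w => (N : ℝ≥0∞)⁻¹ * ∑ i, (c : ℝ≥0∞) * (S.dist₁ (w i) : ℝ≥0∞)) fun y w => ?_).trans ?_
  · have hF' : ∀ i, Measurable (F i w) := fun i => (hF i).comp measurable_prodMk_left
    rw [lintegral_const_mul _ (Finset.measurable_fun_sum _ fun i _ => hF' i),
      lintegral_finsetSum _ fun i _ => hF' i]
    gcongr with i
    exact h i w y
  · refine le_of_eq ?_
    rw [meanDist, ← lintegral_const_mul' _ _ ENNReal.coe_ne_top]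
    refine lintegral_congr fun y => ?_
    rw [lintegral_gens_average p y (F := fun z => (c : ℝ≥0∞) * (S.dist₁ z : ℝ≥0∞)) hd,
      lintegral_const_mul' _ _ ENNReal.coe_ne_top]

/-- The weighted average that controls the decoupling of the resampled ancestors. -/
lemma sum_mass_mul_le [NeZero N] (hS : S.Good Cs) (p : ℕ) (y : ℕ → Y) (w : Fin N → Z) :
    ∑ i, ∑ j, ENNReal.ofReal (S.mass p y w i j) *
        ((min 1 (S.d (S.e true (w i)) (S.e false (w j))) : ℝ≥0) : ℝ≥0∞) ≤
      (N : ℝ≥0∞)⁻¹ * ∑ i, ENNReal.ofReal ((empMean w fun z => S.gf p one true z y)⁻¹ *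
        (S.g true (w i) (y p) * S.dist₁ (w i)
          + 2 * |S.g true (w i) (y p) - S.g false (w i) (y p)|)) := by
  have hb := empMean_one_pos (S := S) p true w y
  -- Pairs with equal ancestors inherit the distance of their parents; the other pairs are charged
  -- the maximal truncated distance, one, with total mass at most the ℓ¹ distance of the weights.
  have h1 := sum_sum_maxCouplingMass_mul_le (sum_wt (S := S) true p y w)
    (sum_wt (S := S) false p y w)
    (f := fun i j => ((min 1 (S.d (S.e true (w i)) (S.e false (w j))) : ℝ≥0) : ℝ))
    (fun i => NNReal.coe_nonneg _) (fun i j => by exact_mod_cast min_le_left _ _)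
  have h2 := sum_abs_div_sub_div_le (sum_g_pos (S := S) true p y w)
    (fun i => (S.g_pos false (w i) (y p)).le) (sum_g_pos (S := S) false p y w)
  have hN : (0 : ℝ) < N := by exact_mod_cast Nat.pos_of_ne_zero (NeZero.ne N)
  have hG := sum_g_pos (S := S) true p y w
  have e1 : ∀ i j, ENNReal.ofReal (S.mass p y w i j) *
      ((min 1 (S.d (S.e true (w i)) (S.e false (w j))) : ℝ≥0) : ℝ≥0∞) =
      ENNReal.ofReal (S.mass p y w i j * ((min 1 (S.d (S.e true (w i)) (S.e false (w j))) : ℝ≥0) : ℝ)) :=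
    fun i j => by
      rw [ENNReal.ofReal_mul (mass_nonneg p y w i j), ENNReal.ofReal_coe_nnreal]
  have n1 : ∀ i j, 0 ≤ S.mass p y w i j *
      ((min 1 (S.d (S.e true (w i)) (S.e false (w j))) : ℝ≥0) : ℝ) := fun i j =>
    mul_nonneg (mass_nonneg p y w i j) (NNReal.coe_nonneg _)
  have n2 : ∀ i, 0 ≤ (empMean w fun z => S.gf p one true z y)⁻¹ *
        (S.g true (w i) (y p) * S.dist₁ (w i)
          + 2 * |S.g true (w i) (y p) - S.g false (w i) (y p)|) := fun i => by
    have := (S.g_pos true (w i) (y p)).le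
    positivity
  have e2 : (N : ℝ≥0∞)⁻¹ = ENNReal.ofReal (N : ℝ)⁻¹ := by
    rw [ENNReal.ofReal_inv_of_pos hN, ENNReal.ofReal_natCast]
  simp only [e1]
  rw [e2, ← ENNReal.ofReal_sum_of_nonneg fun i _ => n2 i, ← ENNReal.ofReal_mul (by positivity)]
  simp only [← ENNReal.ofReal_sum_of_nonneg fun j _ => n1 _ j]
  rw [← ENNReal.ofReal_sum_of_nonneg fun i _ => Finset.sum_nonneg fun j _ => n1 i j]
  refine ENNReal.ofReal_le_ofReal (h1.trans ?_)
  have h3 : ∑ i, S.wt true p y w i *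
      ((min 1 (S.d (S.e true (w i)) (S.e false (w i))) : ℝ≥0) : ℝ) ≤
      ∑ i, S.g true (w i) (y p) * S.dist₁ (w i) / ∑ k, S.g true (w k) (y p) := by
    refine Finset.sum_le_sum fun i _ => ?_
    have h4 : min 1 (S.d (S.e true (w i)) (S.e false (w i))) ≤ S.dist₁ (w i) :=
      min_le_min_left _ (le_self_add.trans (hS.d_le (w i)))
    have h5 := (S.g_pos true (w i) (y p)).le
    rw [wt, div_mul_eq_mul_div]
    gcongr
  refine (add_le_add h3 h2).trans (le_of_eq ?_)
  have e3 : (empMean w fun z => S.gf p one true z y)⁻¹ = N / ∑ k, S.g true (w k) (y p) := by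
    simp only [empMean, gf_one]
    field_simp
  rw [e3, ← Finset.mul_sum, Finset.sum_add_distrib, ← Finset.sum_div, ← Finset.mul_sum]
  field_simp

lemma lintegral_single_succ [NeZero N] (p : ℕ) (y : ℕ → Y) (w : Fin N → Z) {F : Z → ℝ≥0∞} :
    ∫⁻ z, F z ∂(S.single (p + 1) (y, w)) = ∑ i, ∑ j, ENNReal.ofReal (S.mass p y w i j) *
      ∫⁻ z, F z ∂(S.K (S.e true (w i), S.e false (w j))) := by
  change ∫⁻ z, F z ∂(S.singleLaw (p + 1) (y, w)) = _
  simp only [singleLaw, lintegral_finsetSum_measure, lintegral_smul_measure, smul_eq_mul]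

lemma meanDist_zero_le [NeZero N] (hS : S.Good Cs) :
    S.meanDist N 0 ≤ (Cs 1 + 1 : ℝ≥0) * (S.ε : ℝ≥0∞) := by
  have h : ∀ y, ∫⁻ z, S.dist₁ z ∂(S.part N 0 y) ≤ (Cs 1 + 1 : ℝ≥0) * (S.ε : ℝ≥0∞) := by
    intro y
    rw [lintegral_part 0 y (F := fun z => (S.dist₁ z : ℝ≥0∞)) measurable_dist₁.coe_nnreal_ennreal]
    have h1 := lintegral_K_dist₁_le hS (S.x0, S.x0)
    rw [S.d_self, min_eq_right zero_le_one, zero_add] at h1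
    calc _ ≤ ∫⁻ _, (Cs 1 + 1 : ℝ≥0) * (S.ε : ℝ≥0∞) ∂(S.gens N 0 y) := lintegral_mono fun w => h1
      _ = _ := by simp
  calc _ ≤ ∫⁻ _, (Cs 1 + 1 : ℝ≥0) * (S.ε : ℝ≥0∞) ∂(seqLaw S.ν) := lintegral_mono h
    _ = _ := by simp

lemma measurable_inv_empMean_one [NeZero N] (p : ℕ) (s : Bool) : Measurable
    (Function.uncurry fun (w : Fin N → Z) y => (empMean w fun z => S.gf p one s z y)⁻¹) :=
  (measurable_empMean (measurable_gf measurable_const)).inv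

/-- A recursion that is linear in the mean truncated distance. Inherited distances contribute
linearly, and so does decoupling, because its probability is controlled by differences of
potentials, which are of the order of the distance of the paths. Every transition adds the strong
error once more. -/
lemma meanDist_succ_le [NeZero N] (hS : S.Good Cs) (p : ℕ) :
    S.meanDist N (p + 1) ≤ (Cs 1 + 1 : ℝ≥0) * ((mulC Cs Cs 1
      + 2 * (mulC Cs (addC Cs Cs) 1 + mulC Cs Cs 1) : ℝ≥0) * S.meanDist N p + S.ε) := by
  have hK := lintegral_K_dist₁_le hS
  generalize Cs 1 + 1 = c0 at hK ⊢
  set F : Fin N → (Fin N → Z) → (ℕ → Y) → ℝ≥0∞ := fun i w y =>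
    ENNReal.ofReal ((empMean w fun z => S.gf p one true z y)⁻¹ *
        (S.g true (w i) (y p) * S.dist₁ (w i)
          + 2 * |S.g true (w i) (y p) - S.g false (w i) (y p)|)) with hF
  have hg : ∀ s i, Measurable fun q : (Fin N → Z) × (ℕ → Y) => S.g s (q.1 i) (q.2 p) := fun s i =>
    (S.measurable_g s).comp (by fun_prop : Measurable fun q : (Fin N → Z) × (ℕ → Y) => (q.1 i, q.2 p))
  have hD : ∀ i, Measurable fun q : (Fin N → Z) × (ℕ → Y) => (S.dist₁ (q.1 i) : ℝ) := fun i =>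
    (measurable_dist₁ (S := S)).coe_nnreal_real.comp
      (by fun_prop : Measurable fun q : (Fin N → Z) × (ℕ → Y) => q.1 i)
  have hFm : ∀ i, Measurable (Function.uncurry (F i)) := fun i =>
    ((measurable_inv_empMean_one p true).mul (((hg true i).mul (hD i)).add
      (((hg true i).sub (hg false i)).abs.const_mul 2))).ennreal_ofReal
  have key : ∀ y (w : Fin N → Z), ∫⁻ z, S.dist₁ z ∂(S.single (p + 1) (y, w)) ≤
      c0 * ((N : ℝ≥0∞)⁻¹ * ∑ i, F i w y + S.ε) := by
    intro y w
    rw [lintegral_single_succ]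
    calc _ ≤ ∑ i, ∑ j, ENNReal.ofReal (S.mass p y w i j) * ((c0 : ℝ≥0∞) *
          ((min 1 (S.d (S.e true (w i)) (S.e false (w j))) + S.ε : ℝ≥0) : ℝ≥0∞)) := by
          gcongr with i _ j
          exact hK (S.e true (w i), S.e false (w j))
      _ = c0 * (∑ i, ∑ j, ENNReal.ofReal (S.mass p y w i j) *
          ((min 1 (S.d (S.e true (w i)) (S.e false (w j))) : ℝ≥0) : ℝ≥0∞)
          + (∑ i, ∑ j, ENNReal.ofReal (S.mass p y w i j)) * S.ε) := by
          simp only [Finset.sum_mul, ← Finset.sum_add_distrib, Finset.mul_sum]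
          refine Finset.sum_congr rfl fun i _ => Finset.sum_congr rfl fun j _ => ?_
          rw [ENNReal.coe_add]; ring
      _ = c0 * (∑ i, ∑ j, ENNReal.ofReal (S.mass p y w i j) *
          ((min 1 (S.d (S.e true (w i)) (S.e false (w j))) : ℝ≥0) : ℝ≥0∞) + S.ε) := by
          have : ∑ i, ∑ j, ENNReal.ofReal (S.mass p y w i j) = 1 := by
            simp only [← ENNReal.ofReal_sum_of_nonneg fun j _ => mass_nonneg p y w _ j]
            rw [← ENNReal.ofReal_sum_of_nonneg fun i _ =>
              Finset.sum_nonneg fun j _ => mass_nonneg p y w i j, sum_sum_mass, ENNReal.ofReal_one]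
          rw [this, one_mul]
      _ ≤ _ := by
          gcongr
          exact sum_mass_mul_le hS p y w
  have hcond : ∀ i (w : Fin N → Z) y, ∫⁻ y', F i w y' ∂(fut S.ν p y) ≤
      (mulC Cs Cs 1 + 2 * (mulC Cs (addC Cs Cs) 1 + mulC Cs Cs 1) : ℝ≥0)
        * (S.dist₁ (w i) : ℝ≥0∞) := by
    intro i w y
    have b := inv_empMean_clo hS p true w
    have g1 : ∀ s, CLO S.ν p (fun y => S.g s (w i) (y p)) 1 Cs := fun s =>
      CLO.eval (hS.g_lo s (w i)) le_rfl
    have gd : CLO S.ν p (fun y => S.g true (w i) (y p) - S.g false (w i) (y p)) (S.D (w i)) Cs :=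
      CLO.eval (hS.diff_lo (w i)) le_rfl
    have t1 := ((b.mul (g1 true)) y).bound_one
    have u1 := b.mul ((g1 true).sub (g1 false))
    have u2 := b.mul gd
    rw [mul_one] at u1 t1
    rw [one_mul] at u2
    -- Two bounds for the same difference of weights, of order one and of order `S.D`, give the
    -- truncated distance.
    have t2 := u1.lintegral_le_min u2 y
    have e : ∀ y', F i w y' = ‖(empMean w fun z => S.gf p one true z y')⁻¹ *
        S.g true (w i) (y' p)‖ₑ * S.dist₁ (w i) + 2 * ‖(empMean w fun z => S.gf p one true z y')⁻¹ *
        (S.g true (w i) (y' p) - S.g false (w i) (y' p))‖ₑ := by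
      intro y'
      have hb := empMean_one_pos (S := S) p true w y'
      have h1 := S.g_pos true (w i) (y' p)
      simp only [hF]
      rw [mul_add, ENNReal.ofReal_add (by positivity) (by positivity), ← mul_assoc,
        ENNReal.ofReal_mul (by positivity), ENNReal.ofReal_coe_nnreal,
        Real.enorm_eq_ofReal (by positivity), mul_left_comm, ENNReal.ofReal_mul zero_le_two,
        ← ofReal_norm, Real.norm_eq_abs, abs_mul, abs_of_pos (inv_pos.2 hb)]
      simp
    have m1 := (b.mul (g1 true) y).meas.enorm
    have m2 := (b.mul gd y).meas.enorm
    simp only [e]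
    rw [lintegral_add_left (m1.mul_const _), lintegral_mul_const _ m1, lintegral_const_mul _ m2]
    calc _ ≤ (mulC Cs Cs 1 : ℝ≥0∞) * ((1 : ℝ≥0) : ℝ≥0∞) * (S.dist₁ (w i) : ℝ≥0∞) + 2 *
          ((mulC Cs (addC Cs Cs) 1 + mulC Cs Cs 1 : ℝ≥0) * (S.dist₁ (w i) : ℝ≥0∞)) := by
          gcongr
          exact t2
      _ = _ := by push_cast; ring
  have hav := lintegral_joint_average_le hFm hcond
  have hmi : Measurable fun y => ∫⁻ w, (N : ℝ≥0∞)⁻¹ * ∑ i, F i w y ∂(S.gens N (p + 1) y) :=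
    measurable_lintegral_kernel (m := S.gens N (p + 1))
      (F := fun w y => (N : ℝ≥0∞)⁻¹ * ∑ i, F i w y)
      ((Finset.measurable_fun_sum _ fun i _ => hFm i).const_mul _)
  calc S.meanDist N (p + 1) = ∫⁻ y, ∫⁻ w, ∫⁻ z, S.dist₁ z ∂(S.single (p + 1) (y, w))
        ∂(S.gens N (p + 1) y) ∂(seqLaw S.ν) := by
        refine lintegral_congr fun y => ?_
        exact lintegral_part (p + 1) y (F := fun z => (S.dist₁ z : ℝ≥0∞))
          measurable_dist₁.coe_nnreal_ennreal
    _ ≤ ∫⁻ y, ∫⁻ w, c0 * ((N : ℝ≥0∞)⁻¹ * ∑ i, F i w y + S.ε) ∂(S.gens N (p + 1) y)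
        ∂(seqLaw S.ν) := lintegral_mono fun y => lintegral_mono fun w => key y w
    _ = c0 * (∫⁻ y, ∫⁻ w, (N : ℝ≥0∞)⁻¹ * ∑ i, F i w y ∂(S.gens N (p + 1) y) ∂(seqLaw S.ν)
        + S.ε) := by
        simp only [lintegral_const_mul' _ _ ENNReal.coe_ne_top,
          lintegral_add_right _ measurable_const, lintegral_const, measure_univ, mul_one]
    _ ≤ _ := by gcongr

end CoupledSystem

/-- The particle pairs stay close, on average. -/
theorem meanDist_le (p : ℕ) (Cs : ℕ → ℝ≥0) : ∃ c : ℝ≥0, ∀ {X Z Y : Type}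
    [MeasurableSpace X] [MeasurableSpace Z] [MeasurableSpace Y] (S : CoupledSystem X Z Y),
    S.Good Cs → ∀ (N : ℕ) [NeZero N], S.meanDist N p ≤ c * (S.ε : ℝ≥0∞) := by
  induction p with
  | zero => exact ⟨_, fun S hS N _ => CoupledSystem.meanDist_zero_le hS⟩
  | succ p ih =>
    obtain ⟨c, hc⟩ := ih
    refine ⟨(Cs 1 + 1) * ((mulC Cs Cs 1 + 2 * (mulC Cs (addC Cs Cs) 1 + mulC Cs Cs 1)) * c + 1),
      fun S hS N _ => (CoupledSystem.meanDist_succ_le hS p).trans ?_⟩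
    calc _ ≤ (Cs 1 + 1 : ℝ≥0) * ((mulC Cs Cs 1
      + 2 * (mulC Cs (addC Cs Cs) 1 + mulC Cs Cs 1) : ℝ≥0) * (c * (S.ε : ℝ≥0∞)) + S.ε) := by
          gcongr
          exact hc S hS N
      _ = _ := by push_cast; ring

namespace CoupledSystem

variable {S : CoupledSystem X Z Y} {N : ℕ} {p : ℕ} {φ : Bool → X → (ℕ → Y) → ℝ}
  {C Cs Cκ : ℕ → ℝ≥0} {s : Bool}

/-- Level differences of weighted empirical means are of the order of the square root of the strong
error in mean square. -/
lemma empMean_diff_so [NeZero N] (hS : S.Good Cs) (hφ : S.Nice (p + 1) φ C) {c : ℝ≥0}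
    (hc : S.meanDist N p ≤ c * (S.ε : ℝ≥0∞)) {κ : (Fin N → Z) → (ℕ → Y) → ℝ}
    (hκm : Measurable (Function.uncurry κ)) (hκ : ∀ w, CLO S.ν p (κ w) 1 Cκ) :
    SO (S.joint N (p + 1)) (fun q => κ q.2 q.1 * (empMean q.2 (fun z => S.gf p φ true z q.1)
      - empMean q.2 fun z => S.gf p φ false z q.1)) S.ε
      ((mulC Cκ (addC (mulC Cs C) (mulC Cs C)) 2 + mulC Cκ (diffC Cs C) 2) * c) where
  meas := (hκm.comp measurable_swap).mul (((measurable_empMean (measurable_gf (hφ.meas true))).comp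
    measurable_swap).sub ((measurable_empMean (measurable_gf (hφ.meas false))).comp
      measurable_swap))
  bound := by
    set F : Z → (Fin N → Z) → (ℕ → Y) → ℝ := fun z w y =>
      κ w y * (S.gf p φ true z y - S.gf p φ false z y) with hF
    have hg : ∀ s i, Measurable fun q : (Fin N → Z) × (ℕ → Y) => S.gf p φ s (q.1 i) q.2 :=
      fun s i => (measurable_gf (hφ.meas s)).comp
        (by fun_prop : Measurable fun q : (Fin N → Z) × (ℕ → Y) => (q.1 i, q.2))
    have hFm : ∀ i, Measurable (Function.uncurry fun (w : Fin N → Z) y => ‖F (w i) w y‖ₑ ^ 2) :=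
      fun i => (hκm.mul ((hg true i).sub (hg false i))).enorm.pow_const 2
    have hcond : ∀ i (w : Fin N → Z) y, ∫⁻ y', ‖F (w i) w y'‖ₑ ^ 2 ∂(fut S.ν p y) ≤
        (mulC Cκ (addC (mulC Cs C) (mulC Cs C)) 2 + mulC Cκ (diffC Cs C) 2 : ℝ≥0)
          * (S.dist₁ (w i) : ℝ≥0∞) := by
      intro i w y
      -- As the integrand is of order one and also of order `S.D`, its second moment is bounded by
      -- the truncated distance, whose mean is known.
      have u1 := (hκ w).mul ((gf_lo hS hφ true (w i)).sub (gf_lo hS hφ false (w i)))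
      have u2 := (hκ w).mul (gf_diff hS hφ (w i))
      rw [mul_one] at u1
      rw [one_mul] at u2
      exact u1.lintegral_sq_le_min u2 y
    have hmeas : Measurable (Function.uncurry fun (w : Fin N → Z) y => κ w y *
        (empMean w (fun z => S.gf p φ true z y) - empMean w fun z => S.gf p φ false z y)) :=
      hκm.mul ((measurable_empMean (measurable_gf (hφ.meas true))).sub
        (measurable_empMean (measurable_gf (hφ.meas false))))
    rw [lintegral_joint _ (F := fun q => ‖κ q.2 q.1 * (empMean q.2 (fun z => S.gf p φ true z q.1)
      - empMean q.2 fun z => S.gf p φ false z q.1)‖ₑ ^ 2)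
      ((hmeas.comp measurable_swap).enorm.pow_const 2)]
    calc _ ≤ ∫⁻ y, ∫⁻ w, (N : ℝ≥0∞)⁻¹ * ∑ i, ‖F (w i) w y‖ₑ ^ 2 ∂(S.gens N (p + 1) y)
          ∂(seqLaw S.ν) := by
          refine lintegral_mono fun y => lintegral_mono fun w => ?_
          simp only
          rw [empMean_sub, empMean_const_mul]
          exact enorm_empMean_pow_le w (((measurable_gf_left (hφ.meas true) y).sub
            (measurable_gf_left (hφ.meas false) y)).const_mul _) 2
      _ ≤ _ := lintegral_joint_average_le hFm hcond
      _ ≤ _ := by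
          rw [ENNReal.coe_mul, mul_assoc]
          gcongr

lemma empMean_gf_clo [NeZero N] (hS : S.Good Cs) (hφ : S.Nice (p + 1) φ C) (s : Bool)
    (w : Fin N → Z) : CLO S.ν p (fun y => empMean w fun z => S.gf p φ s z y) 1 (mulC Cs C) :=
  empMean_clo (measurable_gf (hφ.meas s)) (gf_lo hS hφ s) w

/-- The particle filters at the two levels are close in mean square. -/
lemma partInt_diff_so [NeZero N] (hS : S.Good Cs) (hφ : S.Nice (p + 1) φ C) {c : ℝ≥0}
    (hc : S.meanDist N p ≤ c * (S.ε : ℝ≥0∞)) :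
    SO (S.joint N (p + 1)) (fun q => S.partInt (p + 1) φ true q.1 q.2
      - S.partInt (p + 1) φ false q.1 q.2) S.ε
      (4 * ((mulC Cs (addC (mulC Cs C) (mulC Cs C)) 2 + mulC Cs (diffC Cs C) 2) * c +
        (mulC (mulC (mulC (mulC Cs C) Cs) Cs) (addC (mulC Cs fun _ => 1) (mulC Cs fun _ => 1)) 2
          + mulC (mulC (mulC (mulC Cs C) Cs) Cs) (diffC Cs fun _ => 1) 2) * c)) := by
  have m1 := measurable_inv_empMean_one (S := S) (N := N) p true
  have m0 := measurable_inv_empMean_one (S := S) (N := N) p false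
  have ma := measurable_empMean (N := N) (measurable_gf (S := S) (p := p) (hφ.meas false))
  have i1 := fun w : Fin N → Z => inv_empMean_clo hS p true w
  have i0 := fun w : Fin N → Z => inv_empMean_clo hS p false w
  have k := fun w : Fin N → Z => (((empMean_gf_clo hS hφ false w).mul (i0 w)).mul (i1 w))
  simp only [mul_one] at k
  have A := empMean_diff_so hS hφ hc m1 i1
  -- In the difference of ratios, the difference of the denominators is multiplied by α₀/(β₀ β₁), a
  -- function of particles and data with bounded conditional moments.
  have B := empMean_diff_so hS (S.nice_one (p + 1)) hc (κ := fun w y =>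
    empMean w (fun z => S.gf p φ false z y) * (empMean w fun z => S.gf p one false z y)⁻¹
      * (empMean w fun z => S.gf p one true z y)⁻¹) ((ma.mul m0).mul m1) k
  convert A.sub B using 2 with q
  have p1 := (empMean_one_pos (S := S) p true q.2 q.1).ne'
  have p0 := (empMean_one_pos (S := S) p false q.2 q.1).ne'
  simp only [partInt]
  change _ = _ - (empMean q.2 (fun z => S.gf p φ false z q.1)
    * (empMean q.2 fun z => S.gf p one false z q.1)⁻¹
    * (empMean q.2 fun z => S.gf p one true z q.1)⁻¹) * _
  field_simp
  ring

variable (S N) in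
/-- The order of the mean square error. -/
def rate : ℝ≥0 := S.ε * fluct N ^ 2 + NNReal.sqrt S.ε * fluct N ^ 3

variable (S N) in
/-- The error of the particle estimate of the level difference. -/
def err [NeZero N] (p : ℕ) (φ : Bool → X → (ℕ → Y) → ℝ) (q : (ℕ → Y) × (Fin N → Z)) : ℝ :=
  (S.partInt p φ true q.1 q.2 - S.exactInt p φ true q.1)
    - (S.partInt p φ false q.1 q.2 - S.exactInt p φ false q.1)

/-- The filters are linear over functions of the data. This is what allows a random coefficient to
be absorbed in the test function and the induction hypothesis to be applied to the product. -/
lemma partInt_mul (κ : (ℕ → Y) → ℝ) (p : ℕ) (s : Bool) (y : ℕ → Y) (w : Fin N → Z) :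
    S.partInt p (fun s x y => κ y * φ s x y) s y w = κ y * S.partInt p φ s y w := by
  cases p with
  | zero => rfl
  | succ p =>
    simp only [partInt, gf]
    rw [← mul_assoc, empMean_const_mul]
    congr 2
    funext z
    ring

lemma exactInt_mul (κ : (ℕ → Y) → ℝ) (p : ℕ) (s : Bool) (y : ℕ → Y) :
    S.exactInt p (fun s x y => κ y * φ s x y) s y = κ y * S.exactInt p φ s y :=
  integral_const_mul _ _

/-- Error of the level difference of weighted empirical means. -/
lemma linear_so [NeZero N] (hS : S.Good Cs) (hφ : S.Nice (p + 1) φ C) {c c' : ℝ≥0}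
    (hc : S.meanDist N p ≤ c * (S.ε : ℝ≥0∞)) {κ : (ℕ → Y) → ℝ} (hκ : CLO S.ν p κ 1 Cκ)
    (h : SO (S.joint N p) (S.err N p fun s x y => κ y * S.step p φ s x y) (S.rate N) c') :
    SO (S.joint N (p + 1)) (fun q => κ q.1 *
      ((empMean q.2 (fun z => S.gf p φ true z q.1) - S.exactInt p (S.step p φ) true q.1)
        - (empMean q.2 (fun z => S.gf p φ false z q.1) - S.exactInt p (S.step p φ) false q.1)))
      (S.rate N) (4 * (mzConst 1 * 2 ^ (2 * 1 + 1) * ((mulC Cκ (addC (mulC Cs C) (mulC Cs C)) 2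
        + mulC Cκ (diffC Cs C) 2) * c) + c')) := by
  obtain ⟨y0⟩ := nonempty_of_isProbabilityMeasure (seqLaw S.ν)
  have hκm : Measurable κ := (hκ y0).meas
  have hgf := fun s => measurable_gf (S := S) (p := p) (hφ.meas s)
  have hex := fun s => (exactInt_step_lo hS hφ s).seqLaw.meas
  have hmeas : Measurable fun q : (ℕ → Y) × (Fin N → Z) => κ q.1 *
      ((empMean q.2 (fun z => S.gf p φ true z q.1) - S.exactInt p (S.step p φ) true q.1)
        - (empMean q.2 (fun z => S.gf p φ false z q.1) - S.exactInt p (S.step p φ) false q.1)) :=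
    (hκm.comp measurable_fst).mul ((((measurable_empMean (hgf true)).comp measurable_swap).sub
      ((hex true).comp measurable_fst)).sub (((measurable_empMean (hgf false)).comp
        measurable_swap).sub ((hex false).comp measurable_fst)))
  -- Two generations are needed at once: the fresh sampling error is estimated given the previous
  -- generation, and what remains is the error of that generation for `κ` times the propagated test
  -- function.
  refine SO.of_comp (measurePreserving_joint₂ p) hmeas ?_
  set F : Z → (ℕ → Y) → ℝ := fun z y => κ y * (S.gf p φ true z y - S.gf p φ false z y) with hF
  have hFm : Measurable (Function.uncurry F) :=
    (hκm.comp measurable_snd).mul ((hgf true).sub (hgf false))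
  have hFb : ∀ y, ∃ b, ∀ z, |F z y| ≤ b := by
    intro y
    obtain ⟨b1, h1⟩ := gf_bdd (S := S) (p := p) (hφ.bdd true) y
    obtain ⟨b0, h0⟩ := gf_bdd (S := S) (p := p) (hφ.bdd false) y
    refine ⟨|κ y| * (b1 + b0), fun z => ?_⟩
    rw [abs_mul]
    gcongr
    exact (abs_sub _ _).trans (add_le_add (h1 z) (h0 z))
  have hloc : SO (S.joint₂ N p) (fun r => empMean r.2 (fun z => F z r.1.1)
      - ∫ z, F z r.1.1 ∂(S.single p r.1)) (S.rate N) (mzConst 1 * 2 ^ (2 * 1 + 1) *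
        ((mulC Cκ (addC (mulC Cs C) (mulC Cs C)) 2 + mulC Cκ (diffC Cs C) 2) * c)) := by
    refine ⟨measurable_local hFm, (lintegral_joint₂_local hFm hFb 1).trans ?_⟩
    -- Variance of the level difference at a single pair, of the order of the mean truncated
    -- distance. Dividing by N yields the ε/N part of the rate.
    have hsec : ∫⁻ y, ∫⁻ z, ‖F z y‖ₑ ^ (2 * 1) ∂(S.part N p y) ∂(seqLaw S.ν) ≤
        (mulC Cκ (addC (mulC Cs C) (mulC Cs C)) 2 + mulC Cκ (diffC Cs C) 2 : ℝ≥0)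
          * (c * (S.ε : ℝ≥0∞)) := by
      refine (lintegral_seqLaw_kernel_le S.ν (dependsOn_part (S := S) (N := N) p)
        (F := fun z y => ‖F z y‖ₑ ^ (2 * 1)) (hFm.enorm.pow_const _)
        (B := fun z => (mulC Cκ (addC (mulC Cs C) (mulC Cs C)) 2 + mulC Cκ (diffC Cs C) 2 : ℝ≥0)
          * (S.dist₁ z : ℝ≥0∞)) fun y z => ?_).trans ?_
      · have u1 := hκ.mul ((gf_lo hS hφ true z).sub (gf_lo hS hφ false z))
        have u2 := hκ.mul (gf_diff hS hφ z)
        rw [mul_one] at u1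
        rw [one_mul] at u2
        exact u1.lintegral_sq_le_min u2 y
      · simp only [lintegral_const_mul' _ _ ENNReal.coe_ne_top]
        gcongr
        exact hc
    calc _ ≤ (mzConst 1 * 2 ^ (2 * 1 + 1) : ℝ≥0) * (fluct N : ℝ≥0∞) ^ (2 * 1) *
          ((mulC Cκ (addC (mulC Cs C) (mulC Cs C)) 2 + mulC Cκ (diffC Cs C) 2 : ℝ≥0)
          * (c * (S.ε : ℝ≥0∞))) := by gcongr
      _ = (mzConst 1 * 2 ^ (2 * 1 + 1) *
        ((mulC Cκ (addC (mulC Cs C) (mulC Cs C)) 2 + mulC Cκ (diffC Cs C) 2) * c) : ℝ≥0) *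
          ((S.ε * fluct N ^ 2 : ℝ≥0) : ℝ≥0∞) := by
          push_cast; ring
      _ ≤ _ := by
          gcongr
          exact le_self_add
  convert hloc.add (h.comp (measurePreserving_joint₂_fst p)) using 2 with r
  have e1 : ∫ z, F z r.1.1 ∂(S.single p r.1) = κ r.1.1 *
      (S.partInt p (S.step p φ) true r.1.1 r.1.2 - S.partInt p (S.step p φ) false r.1.1 r.1.2) := by
    simp only [hF]
    rw [integral_const_mul, integral_sub (integrable_gf (hφ.meas true) (hφ.bdd true) _ _)
      (integrable_gf (hφ.meas false) (hφ.bdd false) _ _),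
      integral_gf_single (hφ.meas true) (hφ.bdd true) r.1.1 r.1.2,
      integral_gf_single (hφ.meas false) (hφ.bdd false) r.1.1 r.1.2]
  have e2 : empMean r.2 (fun z => F z r.1.1) = κ r.1.1 * (empMean r.2 (fun z => S.gf p φ true z r.1.1)
      - empMean r.2 (fun z => S.gf p φ false z r.1.1)) := by
    rw [empMean_sub, empMean_const_mul]
  rw [e1, e2]
  simp only [err, partInt_mul, exactInt_mul]
  ring

end CoupledSystem

end CoupledPF

/-! ### Mean square error of the level difference -/

namespace CoupledPF

/-- Algebraic decomposition of the error of a difference of ratios. -/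
lemma ratio_error_decomposition {a b α β a' b' α' β' : ℝ} (hb : b ≠ 0) (hb' : b' ≠ 0) (hβ : β ≠ 0)
    (hβ' : β' ≠ 0) :
    (a * b⁻¹ - α * β⁻¹) - (a' * b'⁻¹ - α' * β'⁻¹) =
      -- The linear terms are multiplied by exact quantities only: these are functions of the data
      -- and can be absorbed in test functions. The empirical denominators occur only inside errors
      -- of ratios, whose sizes are already known. In every other term, one factor is a level
      -- difference and another is a fluctuation.
      β⁻¹ * ((a - α) - (a' - α')) - (α * β⁻¹ * β⁻¹) * ((b - β) - (b' - β'))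
      - ((a * b⁻¹ - α * β⁻¹) - (a' * b'⁻¹ - α' * β'⁻¹)) * ((b - β) * β⁻¹)
      - ((b - β) - (b' - β')) * ((a' * b'⁻¹ - α' * β'⁻¹) * β⁻¹)
      + (a' - α') * (β⁻¹ - β'⁻¹)
      - (b' - β') * (α * β⁻¹ * β⁻¹ - α' * β'⁻¹ * β'⁻¹)
      - (b' - β') * ((a' * b'⁻¹ - α' * β'⁻¹) * (β⁻¹ - β'⁻¹)) := by
  field_simp
  ring

/-- The mean square error of the estimate of the level difference. -/
theorem err_so (p : ℕ) : ∀ Cs C : ℕ → ℝ≥0, ∃ c : ℝ≥0, ∀ {X Z Y : Type}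
    [MeasurableSpace X] [MeasurableSpace Z] [MeasurableSpace Y] (S : CoupledSystem X Z Y),
    S.Good Cs → ∀ φ, S.Nice p φ C → ∀ (N : ℕ) [NeZero N],
      SO (S.joint N p) (S.err N p φ) (S.rate N) c := by
  induction p with
  | zero =>
    intro Cs C
    refine ⟨0, fun S hS φ hφ N _ => ?_⟩
    have : S.err N 0 φ = fun _ => 0 := by
      funext q
      simp only [CoupledSystem.err, CoupledSystem.exactInt_zero _ (hφ.meas _),
        CoupledSystem.partInt, sub_self]
    rw [this]
    exact ⟨measurable_const, by simp⟩
  | succ p ih =>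
    intro Cs C
    obtain ⟨cd, hd⟩ := meanDist_le p Cs
    obtain ⟨C1, h1⟩ := exactInt_diff_lo p Cs (CoupledSystem.stepC Cs C fun _ => 1)
    obtain ⟨C2, h2⟩ := exactInt_diff_lo p Cs (CoupledSystem.stepC Cs (fun _ => 1) fun _ => 1)
    obtain ⟨C3, h3⟩ := exactInt_diff_lo (p + 1) Cs C
    obtain ⟨C4, h4⟩ := partInt_sub_lo p Cs (CoupledSystem.stepC Cs C fun _ => 1)
    obtain ⟨C5, h5⟩ := partInt_sub_lo p Cs (CoupledSystem.stepC Cs (fun _ => 1) fun _ => 1)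
    obtain ⟨C6, h6⟩ := partInt_sub_lo (p + 1) Cs C
    -- The induction hypothesis is applied to `step φ` times β⁻¹ and to `step 1` times α β⁻², the
    -- coefficients of the linear terms; their moment constants enter here.
    obtain ⟨c7, h7⟩ := ih Cs (CoupledSystem.stepC Cs C Cs)
    obtain ⟨c8, h8⟩ := ih Cs (CoupledSystem.stepC Cs (fun _ => 1) (mulC (mulC (mulC Cs C) Cs) Cs))
    constructor
    intro X Z Y _ _ _ S hS φ hφ N _
    have hone := S.nice_one (p + 1)
    have hfst := CoupledSystem.measurePreserving_joint_fst (S := S) (N := N) (p + 1)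
    have hε := hS.eps_le_one
    have hεε : S.ε ^ 2 ≤ S.ε := by rw [sq]; exact mul_le_of_le_one_left' hε
    have hF1 := fluct_le_one N
    have hr1 : ((S.ε : ℝ≥0) * fluct N) ^ 2 ≤ S.rate N := by
      rw [mul_pow]
      exact (mul_le_mul_left hεε _).trans le_self_add
    have hr2 : NNReal.sqrt S.ε * fluct N ^ 3 ≤ S.rate N := le_add_self
    have dist := hd S hS N
    -- conditional bounds for the exact quantities
    have β1 := CoupledSystem.inv_exactInt_step_one_lo hS p true
    have α1 := CoupledSystem.exactInt_step_lo hS hφ true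
    have κ := (α1.mul β1).mul β1
    simp only [mul_one] at κ
    have iβ1 := β1.seqLaw
    have iβ0 := (CoupledSystem.inv_exactInt_step_one_lo hS p false).seqLaw
    have iα0 := (CoupledSystem.exactInt_step_lo hS hφ false).seqLaw
    -- differences of exact quantities
    have dα := h1 S hS _ (hφ.step hS)
    have dβ := h2 S hS _ (hone.step hS)
    have dx := h3 S hS _ hφ
    have dβi : LO (seqLaw S.ν) (fun y => (S.exactInt p (S.step p CoupledSystem.one) true y)⁻¹
        - (S.exactInt p (S.step p CoupledSystem.one) false y)⁻¹) S.ε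
        (mulC (mulC Cs Cs) C2) := by
      have t := ((iβ1.mul iβ0).mul dβ).neg.mono (δ := S.ε) (by simp)
      convert t using 2 with y
      have p1 := (CoupledSystem.exactInt_step_one_pos (S := S) p true y).ne'
      have p0 := (CoupledSystem.exactInt_step_one_pos (S := S) p false y).ne'
      field_simp
      ring
    have dκ : LO (seqLaw S.ν) (fun y => S.exactInt p (S.step p φ) true y
          * (S.exactInt p (S.step p CoupledSystem.one) true y)⁻¹
          * (S.exactInt p (S.step p CoupledSystem.one) true y)⁻¹
        - S.exactInt p (S.step p φ) false y
          * (S.exactInt p (S.step p CoupledSystem.one) false y)⁻¹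
          * (S.exactInt p (S.step p CoupledSystem.one) false y)⁻¹) S.ε
        (addC (mulC (mulC C1 Cs) Cs) (mulC (mulC (mulC Cs C) (mulC (mulC Cs Cs) C2))
          (addC Cs Cs))) := by
      have t := (((dα.mul iβ1).mul iβ1).mono (δ := S.ε) (by simp)).add
        (((iα0.mul dβi).mul (iβ1.add iβ0)).mono (δ := S.ε) (by simp))
      convert t using 2 with y
      ring
    -- errors at one level
    have A := fun s => empMean_sub_lo_of_partInt hS hφ (h4 S hS _ (hφ.step hS) N s)
    have B := fun s => empMean_sub_lo_of_partInt hS hone (h5 S hS _ (hone.step hS) N s)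
    have x := fun s => h6 S hS _ hφ N s
    -- the linear terms
    have L1 := CoupledSystem.linear_so hS hφ dist β1 (h7 S hS _ (hφ.mul_step hS β1) N)
    have L2 := CoupledSystem.linear_so hS hone dist κ (h8 S hS _ (hone.mul_step hS κ) N)
    -- second order terms
    have hsq : NNReal.sqrt S.ε ^ 2 = S.ε := NNReal.sq_sqrt _
    -- The error is a level difference of particle filters minus one of exact filters. Its second
    -- moment is of order ε, the exact part contributing ε² ≤ ε. Writing ε as a square of √ε fits it
    -- to `SO.mul`.
    have ξ := (CoupledSystem.partInt_diff_so hS hφ dist).sub ((dx.comp hfst).so hεε)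
    rw [← hsq] at ξ
    -- The same error is also a difference of two one-level errors, hence of size N^(-1/2) in all
    -- moments. Interpolating the two facts against a further fluctuation gives √ε N^(-3/2).
    have Q1 := (SO.mul (f := S.err N (p + 1) φ)
      (by convert ξ using 2 with q; simp only [CoupledSystem.err]; ring) ((x true).sub (x false))
      (((B true).mul (iβ1.comp hfst)).mono (δ := fluct N) (by simp))).mono hr2
    have dB := (CoupledSystem.empMean_diff_so hS hone dist (κ := fun _ _ => 1) measurable_const
      (fun w => CLO.const 1 (by simp))).sub ((dβ.comp hfst).so hεε)
    rw [← hsq] at dB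
    have Q2 := (SO.mul (f := fun q : (ℕ → Y) × (Fin N → Z) =>
        (empMean q.2 (fun z => S.gf p CoupledSystem.one true z q.1)
          - S.exactInt p (S.step p CoupledSystem.one) true q.1)
        - (empMean q.2 (fun z => S.gf p CoupledSystem.one false z q.1)
          - S.exactInt p (S.step p CoupledSystem.one) false q.1))
      (by convert dB using 2 with q; ring) ((B true).sub (B false))
      (((x false).mul (iβ1.comp hfst)).mono (δ := fluct N) (by simp))).mono hr2
    -- terms with differences of exact quantities
    have R1 := (((A false).mul (dβi.comp hfst)).mono (δ := S.ε * fluct N) (by rw [mul_comm])).so hr1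
    have R2 := (((B false).mul (dκ.comp hfst)).mono (δ := S.ε * fluct N) (by rw [mul_comm])).so hr1
    have R3 := (((B false).mul ((x false).mul (dβi.comp hfst))).mono (δ := S.ε * fluct N) (by
      calc fluct N * (fluct N * S.ε) = fluct N * (S.ε * fluct N) := by ring
        _ ≤ 1 * (S.ε * fluct N) := by gcongr
        _ = _ := one_mul _)).so hr1
    have T := (((((L1.sub L2).sub Q1).sub Q2).add R1).sub R2).sub R3
    convert T using 2 with q
    have p1 := (CoupledSystem.exactInt_step_one_pos (S := S) p true q.1).ne'
    have p0 := (CoupledSystem.exactInt_step_one_pos (S := S) p false q.1).ne'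
    have q1 := (CoupledSystem.empMean_one_pos (S := S) p true q.2 q.1).ne'
    have q0 := (CoupledSystem.empMean_one_pos (S := S) p false q.2 q.1).ne'
    simp only [CoupledSystem.err, CoupledSystem.exactInt_succ (hφ.meas _) (hφ.bdd _),
      CoupledSystem.partInt]
    exact ratio_error_decomposition q1 q0 p1 p0

end CoupledPF

namespace CoupledPF

lemma stepSize_pos (l : ℕ) : 0 < stepSize l := by unfold stepSize; positivity

lemma stepSize_le_one (l : ℕ) : stepSize l ≤ 1 :=
  inv_le_one_of_one_le₀ (one_le_pow₀ one_le_two)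

lemma stepSize_mul (l : ℕ) : stepSize l * 2 ^ l = 1 := inv_mul_cancel₀ (by positivity)

lemma stepSize_succ (l : ℕ) : stepSize l = 2 * stepSize (l + 1) := by
  simp only [stepSize, pow_succ]; field_simp

/-! ### Moments of the exponential weights -/

section Gaussian

variable {d l : ℕ}

variable (d l) in
/-- The law of an increment of a standard Brownian motion over a time step `Δ_l`. -/
def incr : Measure (Vec d) := (stdGaussian (Vec d)).map fun z => Real.sqrt (stepSize l) • z

instance : IsProbabilityMeasure (incr d l) :=
  Measure.isProbabilityMeasure_map (by fun_prop)

lemma incrementLaw_eq : incrementLaw d l = Measure.pi fun _ => incr d l := rfl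

instance : IsProbabilityMeasure (incrementLaw d l) := by
  rw [incrementLaw_eq]; infer_instance

lemma map_inner_incr (a : Vec d) : (incr d l).map (fun z => inner ℝ a z) =
    gaussianReal 0 (stepSize l * ‖a‖ ^ 2).toNNReal := by
  have h := IsGaussian.map_eq_gaussianReal (μ := stdGaussian (Vec d))
    (innerSL ℝ (Real.sqrt (stepSize l) • a))
  rw [integral_strongDual_stdGaussian, variance_dual_stdGaussian, innerSL_apply_norm, norm_smul,
    mul_pow, Real.norm_eq_abs, sq_abs, Real.sq_sqrt (stepSize_pos l).le] at h
  rw [incr, Measure.map_map (by fun_prop) (by fun_prop), ← h]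
  congr 1
  funext z
  simp [inner_smul_right]

lemma integrable_exp_inner_incr (a : Vec d) :
    Integrable (fun z => Real.exp (inner ℝ a z)) (incr d l) := by
  have h := integrable_exp_mul_gaussianReal (μ := 0) (v := (stepSize l * ‖a‖ ^ 2).toNNReal) 1
  rw [← map_inner_incr, integrable_map_measure (by fun_prop) (by fun_prop)] at h
  simpa [Function.comp_def] using h

lemma integral_exp_inner_incr (a : Vec d) :
    ∫ z, Real.exp (inner ℝ a z) ∂(incr d l) = Real.exp (stepSize l / 2 * ‖a‖ ^ 2) := by
  have h := mgf_gaussianReal (map_inner_incr (l := l) a) 1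
  have hp := stepSize_pos l
  simp only [mgf, one_mul] at h
  rw [h, Real.coe_toNNReal _ (by positivity)]
  congr 1
  ring

/-- The linear form with coefficients `H`. -/
def linForm {m : ℕ} (H y : Fin m → Vec d) : ℝ := ∑ k, inner ℝ (H k) (y k)

lemma measurable_linForm {m : ℕ} :
    Measurable fun q : (Fin m → Vec d) × (Fin m → Vec d) => linForm q.1 q.2 := by
  unfold linForm
  fun_prop

lemma linForm_smul {m : ℕ} (c : ℝ) (H y : Fin m → Vec d) :
    linForm (fun k => c • H k) y = c * linForm H y := by
  simp [linForm, inner_smul_left, Finset.mul_sum]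

lemma linForm_sub {m : ℕ} (H G y : Fin m → Vec d) :
    linForm (fun k => H k - G k) y = linForm H y - linForm G y := by
  simp [linForm, inner_sub_left]

lemma lintegral_exp_linForm (H : Fin (2 ^ l) → Vec d) :
    ∫⁻ y, ENNReal.ofReal (Real.exp (linForm H y)) ∂(incrementLaw d l) =
      ENNReal.ofReal (Real.exp (stepSize l / 2 * ∑ k, ‖H k‖ ^ 2)) := by
  have e : ∀ y, Real.exp (linForm H y) = ∏ k, Real.exp (inner ℝ (H k) (y k)) := fun y => by
    rw [linForm, Real.exp_sum]
  have hi : Integrable (fun y => Real.exp (linForm H y)) (incrementLaw d l) := by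
    simp only [e]
    exact Integrable.fintype_prod fun k => integrable_exp_inner_incr (H k)
  rw [← ofReal_integral_eq_lintegral_ofReal hi (ae_of_all _ fun y => (Real.exp_pos _).le)]
  simp only [e]
  rw [incrementLaw_eq, integral_fintype_prod_eq_prod (f := fun k z => Real.exp (inner ℝ (H k) z)),
    Finset.prod_congr rfl fun k _ => integral_exp_inner_incr (l := l) (H k), ← Real.exp_sum,
    Finset.mul_sum]

/-- Moment constants of centred Gaussian variables. -/
def gaussC (r : ℕ) : ℝ≥0 := r.factorial * (2 * (Real.exp (1 / 2)).toNNReal)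

lemma one_le_gaussC (r : ℕ) : 1 ≤ gaussC r := by
  have h1 : (1 : ℝ≥0) ≤ r.factorial := by exact_mod_cast Nat.one_le_iff_ne_zero.2 r.factorial_ne_zero
  have h2 : (1 : ℝ≥0) ≤ (Real.exp (1 / 2)).toNNReal := by
    rw [← Real.toNNReal_one]
    exact Real.toNNReal_le_toNNReal (Real.one_le_exp (by norm_num))
  calc (1 : ℝ≥0) = 1 * (1 * 1) := by ring
    _ ≤ _ := by unfold gaussC; gcongr; exact one_le_two

/-- One term of the exponential series. It turns Gaussian exponential moments into polynomial ones,
with constants that do not see the number of grid points. -/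
lemma abs_pow_le_factorial_mul (x : ℝ) (r : ℕ) :
    |x| ^ r ≤ r.factorial * (Real.exp x + Real.exp (-x)) := by
  have h := Real.pow_div_factorial_le_exp |x| (abs_nonneg x) r
  rw [div_le_iff₀ (by positivity)] at h
  have h2 : Real.exp |x| ≤ Real.exp x + Real.exp (-x) := by
    rcases abs_cases x with ⟨h, _⟩ | ⟨h, _⟩ <;> rw [h]
    · linarith [Real.exp_pos (-x)]
    · linarith [Real.exp_pos x]
  calc |x| ^ r ≤ Real.exp |x| * r.factorial := h
    _ ≤ (Real.exp x + Real.exp (-x)) * r.factorial := by gcongr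
    _ = _ := mul_comm _ _

lemma measurable_linForm_left {m : ℕ} (H : Fin m → Vec d) : Measurable (linForm H) := by
  have h : linForm H = fun y => ∑ k, inner ℝ (H k) (y k) := funext fun y => rfl
  rw [h]
  exact Finset.measurable_fun_sum _ fun k _ => (measurable_pi_apply k).const_inner

/-- Moments of Gaussian linear forms. -/
lemma linForm_lo {G : Fin (2 ^ l) → Vec d} {τ : ℝ≥0}
    (h : stepSize l * ∑ k, ‖G k‖ ^ 2 ≤ τ ^ 2) : LO (incrementLaw d l) (linForm G) τ gaussC := by
  have hp := stepSize_pos l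
  -- The rescaling by `τ⁻¹` below is impossible for `τ = 0`; in that case the form vanishes
  -- identically.
  rcases eq_or_ne τ 0 with rfl | hτ
  · have h0 : ∑ k, ‖G k‖ ^ 2 ≤ 0 := by
      by_contra hc
      have := mul_pos hp (not_le.1 hc)
      simp only [NNReal.coe_zero] at h
      linarith
    have h1 := (Finset.sum_eq_zero_iff_of_nonneg fun k _ => sq_nonneg ‖G k‖).1
      (le_antisymm h0 (Finset.sum_nonneg fun k _ => sq_nonneg _))
    have e : linForm G = fun _ => 0 := by
      funext y
      refine Finset.sum_eq_zero fun k hk => ?_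
      rw [norm_eq_zero.1 (pow_eq_zero_iff two_ne_zero |>.1 (h1 k hk)), inner_zero_left]
    rw [e]
    exact (LO.const 0 (by simp)).mono_const one_le_gaussC
  · refine ⟨measurable_linForm_left G, fun r => ?_⟩
    have hτ' : (0 : ℝ) < τ := by positivity
    -- After rescaling the variance is at most one, so the exponential moment is at most e^(1/2);
    -- both signs of `c` are used.
    have key : ∀ c : ℝ, c ^ 2 = (τ : ℝ)⁻¹ ^ 2 →
        ∫⁻ y, ENNReal.ofReal (Real.exp (c * linForm G y)) ∂(incrementLaw d l) ≤
          ENNReal.ofReal (Real.exp (1 / 2)) := by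
      intro c hc
      simp only [← linForm_smul, lintegral_exp_linForm]
      refine ENNReal.ofReal_le_ofReal (Real.exp_le_exp.2 ?_)
      simp only [norm_smul, mul_pow, ← Finset.mul_sum, Real.norm_eq_abs, sq_abs, hc]
      calc stepSize l / 2 * ((τ : ℝ)⁻¹ ^ 2 * ∑ k, ‖G k‖ ^ 2)
          = 1 / 2 * ((τ : ℝ)⁻¹ ^ 2 * (stepSize l * ∑ k, ‖G k‖ ^ 2)) := by ring
        _ ≤ 1 / 2 * ((τ : ℝ)⁻¹ ^ 2 * (τ : ℝ) ^ 2) := by gcongr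
        _ = 1 / 2 := by field_simp
    have m1 : ∀ c : ℝ, Measurable fun y => ENNReal.ofReal (Real.exp (c * linForm G y)) := fun c =>
      ((measurable_linForm_left G).const_mul c).exp.ennreal_ofReal
    have hpt : ∀ y, ‖linForm G y‖ₑ ^ r ≤ (τ : ℝ≥0∞) ^ r * (r.factorial *
        (ENNReal.ofReal (Real.exp ((τ : ℝ)⁻¹ * linForm G y))
          + ENNReal.ofReal (Real.exp (-(τ : ℝ)⁻¹ * linForm G y)))) := by
      intro y
      have h1 := abs_pow_le_factorial_mul ((τ : ℝ)⁻¹ * linForm G y) r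
      rw [← ofReal_norm, Real.norm_eq_abs, ← ENNReal.ofReal_pow (abs_nonneg _),
        ← ENNReal.ofReal_add (Real.exp_pos _).le (Real.exp_pos _).le, ← ENNReal.ofReal_natCast,
        ← ENNReal.ofReal_mul (by positivity), ← ENNReal.ofReal_coe_nnreal,
        ← ENNReal.ofReal_pow hτ'.le, ← ENNReal.ofReal_mul (by positivity)]
      refine ENNReal.ofReal_le_ofReal ?_
      rw [neg_mul]
      calc |linForm G y| ^ r = (τ : ℝ) ^ r * |(τ : ℝ)⁻¹ * linForm G y| ^ r := by
            rw [abs_mul, abs_of_pos (inv_pos.2 hτ'), ← mul_pow, mul_inv_cancel_left₀ hτ'.ne']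
        _ ≤ _ := by gcongr
    calc ∫⁻ y, ‖linForm G y‖ₑ ^ r ∂(incrementLaw d l)
        ≤ ∫⁻ y, (τ : ℝ≥0∞) ^ r * (r.factorial *
        (ENNReal.ofReal (Real.exp ((τ : ℝ)⁻¹ * linForm G y))
          + ENNReal.ofReal (Real.exp (-(τ : ℝ)⁻¹ * linForm G y)))) ∂(incrementLaw d l) :=
          lintegral_mono hpt
      _ = (τ : ℝ≥0∞) ^ r * (r.factorial *
          (∫⁻ y, ENNReal.ofReal (Real.exp ((τ : ℝ)⁻¹ * linForm G y)) ∂(incrementLaw d l)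
          + ∫⁻ y, ENNReal.ofReal (Real.exp (-(τ : ℝ)⁻¹ * linForm G y)) ∂(incrementLaw d l))) := by
          rw [lintegral_const_mul' _ _ (ENNReal.pow_ne_top ENNReal.coe_ne_top),
            lintegral_const_mul' _ _ (ENNReal.natCast_ne_top _), lintegral_add_left (m1 _)]
      _ ≤ (τ : ℝ≥0∞) ^ r * (r.factorial * (ENNReal.ofReal (Real.exp (1 / 2))
          + ENNReal.ofReal (Real.exp (1 / 2)))) := by
          gcongr
          · exact key _ rfl
          · exact key _ (by ring)
      _ = _ := by
          rw [gaussC, ENNReal.ofReal]; push_cast; ring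

/-- The exponential weight with coefficients `H`. -/
def expWeight (H y : Fin (2 ^ l) → Vec d) : ℝ :=
  Real.exp (linForm H y - stepSize l / 2 * ∑ k, ‖H k‖ ^ 2)

lemma measurable_expWeight :
    Measurable fun q : (Fin (2 ^ l) → Vec d) × (Fin (2 ^ l) → Vec d) => expWeight q.1 q.2 := by
  refine (measurable_linForm.sub (Measurable.const_mul ?_ _)).exp
  fun_prop

lemma sum_sq_le {H : Fin (2 ^ l) → Vec d} {B : ℝ≥0} (h : ∀ k, ‖H k‖ ≤ B) :
    stepSize l * ∑ k, ‖H k‖ ^ 2 ≤ B ^ 2 := by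
  have hp := stepSize_pos l
  calc stepSize l * ∑ k, ‖H k‖ ^ 2 ≤ stepSize l * ∑ _k : Fin (2 ^ l), (B : ℝ) ^ 2 := by
        gcongr with k; exact h k
    _ = (stepSize l * 2 ^ l) * B ^ 2 := by simp; ring
    _ = _ := by rw [stepSize_mul, one_mul]

/-- Moment constants of exponential weights. -/
def potC (B : ℝ≥0) (r : ℕ) : ℝ≥0 := (Real.exp ((r : ℝ) ^ 2 * B ^ 2 / 2 + r * B ^ 2 / 2)).toNNReal

/-- The cases `c = 1` and `c = -1` give the weight and its inverse. Powers of the weight are again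
exponentials of a Gaussian form, and the quadratic sums are at most `B ^ 2` over a unit interval
whatever the mesh. -/
lemma expWeight_lo_aux {H : Fin (2 ^ l) → Vec d} {B : ℝ≥0} (h : ∀ k, ‖H k‖ ≤ B) {f : (Fin (2 ^ l) → Vec d) → ℝ}
    (hf : Measurable f) {c : ℝ} (hc : c ^ 2 = 1)
    (hfe : ∀ y, f y = Real.exp (c * linForm H y - c * (stepSize l / 2 * ∑ k, ‖H k‖ ^ 2))) :
    LO (incrementLaw d l) f 1 (potC B) := by
  refine ⟨hf, fun r => ?_⟩
  have hB := sum_sq_le h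
  have hp := stepSize_pos l
  have hs : 0 ≤ stepSize l * ∑ k, ‖H k‖ ^ 2 := by positivity
  have hc' : |c| ≤ 1 := by rw [← sq_le_one_iff_abs_le_one, hc]
  have hpt : ∀ y, ‖f y‖ₑ ^ r ≤ ENNReal.ofReal (Real.exp (r * B ^ 2 / 2)) *
      ENNReal.ofReal (Real.exp (linForm (fun k => (r * c) • H k) y)) := by
    intro y
    rw [hfe, Real.enorm_eq_ofReal (Real.exp_pos _).le, ← ENNReal.ofReal_pow (Real.exp_pos _).le,
      ← ENNReal.ofReal_mul (Real.exp_pos _).le, ← Real.exp_nat_mul, ← Real.exp_add, linForm_smul]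
    refine ENNReal.ofReal_le_ofReal (Real.exp_le_exp.2 ?_)
    have : -(c * (stepSize l * ∑ k, ‖H k‖ ^ 2)) ≤ B ^ 2 := by
      refine (neg_le_abs _).trans ?_
      rw [abs_mul, abs_of_nonneg hs]
      exact (mul_le_of_le_one_left hs hc').trans hB
    have h2 : (r : ℝ) * -(c * (stepSize l * ∑ k, ‖H k‖ ^ 2)) ≤ r * B ^ 2 := by gcongr
    linarith
  refine (lintegral_mono hpt).trans ?_
  rw [lintegral_const_mul' _ _ ENNReal.ofReal_ne_top, lintegral_exp_linForm,
    ← ENNReal.ofReal_mul (Real.exp_pos _).le, ← Real.exp_add, ENNReal.coe_one, one_pow, mul_one, potC]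
  refine ENNReal.ofReal_le_ofReal (Real.exp_le_exp.2 ?_)
  simp only [norm_smul, mul_pow, ← Finset.mul_sum, Real.norm_eq_abs, sq_abs, hc]
  have h3 : (r : ℝ) ^ 2 * (stepSize l * ∑ k, ‖H k‖ ^ 2) ≤ r ^ 2 * B ^ 2 := by gcongr
  linarith

lemma measurable_expWeight_left (H : Fin (2 ^ l) → Vec d) : Measurable (expWeight H) :=
  ((measurable_linForm_left H).sub measurable_const).exp

lemma expWeight_lo {H : Fin (2 ^ l) → Vec d} {B : ℝ≥0} (h : ∀ k, ‖H k‖ ≤ B) :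
    LO (incrementLaw d l) (expWeight H) 1 (potC B) :=
  expWeight_lo_aux h (measurable_expWeight_left H) (c := 1) (by norm_num) fun y => by
    simp [expWeight]

lemma inv_expWeight_lo {H : Fin (2 ^ l) → Vec d} {B : ℝ≥0} (h : ∀ k, ‖H k‖ ≤ B) :
    LO (incrementLaw d l) (fun y => (expWeight H y)⁻¹) 1 (potC B) :=
  expWeight_lo_aux h (measurable_expWeight_left H).inv (c := -1) (by norm_num) fun y => by
    rw [expWeight, ← Real.exp_neg]; congr 1; ring

lemma abs_exp_sub_exp_le (a b : ℝ) : |Real.exp a - Real.exp b| ≤ |a - b| * (Real.exp a + Real.exp b) := by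
  wlog h : b ≤ a generalizing a b
  · rw [abs_sub_comm, abs_sub_comm a, add_comm]; exact this b a (le_of_not_ge h)
  rw [abs_of_nonneg (sub_nonneg.2 (Real.exp_le_exp.2 h)), abs_of_nonneg (sub_nonneg.2 h)]
  have h1 := Real.add_one_le_exp (b - a)
  have h2 : Real.exp b = Real.exp a * Real.exp (b - a) := by rw [← Real.exp_add]; congr 1; ring
  have h3 := Real.exp_pos a
  have h4 := Real.exp_pos b
  have h5 : Real.exp a - Real.exp b ≤ (a - b) * Real.exp a := by rw [h2]; nlinarith
  nlinarith [mul_nonneg (sub_nonneg.2 h) h4.le]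

/-- The drift terms of two exponential weights. -/
lemma abs_sum_sq_sub_le {H G : Fin (2 ^ l) → Vec d} {B τ : ℝ≥0} (hH : ∀ k, ‖H k‖ ≤ B)
    (hG : ∀ k, ‖G k‖ ≤ B) (h : stepSize l * ∑ k, ‖H k - G k‖ ^ 2 ≤ τ ^ 2) :
    |stepSize l / 2 * ∑ k, ‖H k‖ ^ 2 - stepSize l / 2 * ∑ k, ‖G k‖ ^ 2| ≤ (B * τ : ℝ≥0) := by
  have hp := stepSize_pos l
  have h1 : ∀ k, |‖H k‖ ^ 2 - ‖G k‖ ^ 2| ≤ 2 * B * ‖H k - G k‖ := by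
    intro k
    have e : ‖H k‖ ^ 2 - ‖G k‖ ^ 2 = (‖H k‖ + ‖G k‖) * (‖H k‖ - ‖G k‖) := by ring
    rw [e, abs_mul, abs_of_nonneg (by positivity)]
    gcongr
    · linarith [hH k, hG k]
    · exact abs_norm_sub_norm_le _ _
  -- Cauchy–Schwarz on the uniform probability weights of the grid passes from the mean gap to the
  -- quadratic mean gap.
  have h2 : (stepSize l * ∑ k, ‖H k - G k‖) ^ 2 ≤ τ ^ 2 := by
    have := sq_sum_le_card_mul_sum_sq (s := (Finset.univ : Finset (Fin (2 ^ l))))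
      (f := fun k => ‖H k - G k‖)
    rw [Finset.card_univ, Fintype.card_fin] at this
    push_cast at this
    calc (stepSize l * ∑ k, ‖H k - G k‖) ^ 2 = stepSize l ^ 2 * (∑ k, ‖H k - G k‖) ^ 2 := by ring
      _ ≤ stepSize l ^ 2 * (2 ^ l * ∑ k, ‖H k - G k‖ ^ 2) := by gcongr
      _ = (stepSize l * 2 ^ l) * (stepSize l * ∑ k, ‖H k - G k‖ ^ 2) := by ring
      _ ≤ _ := by rw [stepSize_mul, one_mul]; exact h
  have h3 : stepSize l * ∑ k, ‖H k - G k‖ ≤ τ := by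
    exact (le_abs_self _).trans (abs_le_of_sq_le_sq h2 τ.2)
  rw [← mul_sub, ← Finset.sum_sub_distrib, abs_mul, abs_of_pos (by positivity)]
  calc stepSize l / 2 * |∑ k, (‖H k‖ ^ 2 - ‖G k‖ ^ 2)|
      ≤ stepSize l / 2 * ∑ k, 2 * B * ‖H k - G k‖ := by
        gcongr
        exact (Finset.abs_sum_le_sum_abs _ _).trans (Finset.sum_le_sum fun k _ => h1 k)
    _ = B * (stepSize l * ∑ k, ‖H k - G k‖) := by rw [← Finset.mul_sum]; ring
    _ ≤ _ := by push_cast; gcongr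

/-- Differences of exponential weights. -/
lemma expWeight_sub_lo {H G : Fin (2 ^ l) → Vec d} {B τ : ℝ≥0} (hB : 1 ≤ B) (hH : ∀ k, ‖H k‖ ≤ B)
    (hG : ∀ k, ‖G k‖ ≤ B) (h : stepSize l * ∑ k, ‖H k - G k‖ ^ 2 ≤ τ ^ 2) :
    LO (incrementLaw d l) (fun y => expWeight H y - expWeight G y) (B * τ)
      (mulC (addC gaussC fun _ => 1) (addC (potC B) (potC B))) := by
  have h1 : LO (incrementLaw d l) (fun y => linForm (fun k => H k - G k) y) (B * τ) gaussC :=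
    (linForm_lo h).mono (le_mul_of_one_le_left' hB)
  have h2 : LO (incrementLaw d l) (fun _ => stepSize l / 2 * ∑ k, ‖H k‖ ^ 2
      - stepSize l / 2 * ∑ k, ‖G k‖ ^ 2) (B * τ) (fun _ => 1) :=
    LO.const _ (abs_sum_sq_sub_le hH hG h)
  have h3 := (h1.sub h2).mul ((expWeight_lo hH).add (expWeight_lo hG))
  rw [mul_one] at h3
  refine h3.of_abs_le ((measurable_expWeight_left H).sub (measurable_expWeight_left G)) fun y => ?_
  have h4 := abs_exp_sub_exp_le (linForm H y - stepSize l / 2 * ∑ k, ‖H k‖ ^ 2)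
    (linForm G y - stepSize l / 2 * ∑ k, ‖G k‖ ^ 2)
  rw [abs_mul, linForm_sub]
  refine h4.trans ?_
  refine mul_le_mul (le_of_eq ?_) (le_abs_self _) (by positivity) (abs_nonneg _)
  congr 1
  ring

end Gaussian

end CoupledPF

namespace CoupledPF

/-! ### Independence of one term of an i.i.d. sequence from the others -/

section Resampling

variable {Y : Type*} [MeasurableSpace Y] (ν : Measure Y) [IsProbabilityMeasure ν]

lemma measurable_update_prod (k : ℕ) :
    Measurable fun q : (ℕ → Y) × Y => Function.update q.1 k q.2 := by
  refine measurable_pi_lambda _ fun i => ?_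
  by_cases h : i = k
  · subst h; simp only [Function.update_self]; fun_prop
  · simp only [Function.update_of_ne h]; fun_prop

/-- Resampling one term of an i.i.d. sequence preserves its law. -/
lemma measurePreserving_update (k : ℕ) :
    MeasurePreserving (fun q : (ℕ → Y) × Y => Function.update q.1 k q.2)
      ((seqLaw ν).prod ν) (seqLaw ν) := by
  refine ⟨measurable_update_prod k, Measure.eq_infinitePi _ fun s t ht => ?_⟩
  have hpre : (fun q : (ℕ → Y) × Y => Function.update q.1 k q.2) ⁻¹' ((s : Set ℕ).pi t)
      = ((s.erase k : Finset ℕ) : Set ℕ).pi t ×ˢ (if k ∈ s then t k else Set.univ) := by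
    ext q
    simp only [Set.mem_preimage, Set.mem_pi, Set.mem_prod, Finset.mem_coe, Finset.mem_erase]
    constructor
    · intro h
      refine ⟨fun i hi => by simpa [Function.update_of_ne hi.1] using h i hi.2, ?_⟩
      split_ifs with hk
      · simpa using h k hk
      · trivial
    · rintro ⟨h1, h2⟩ i hi
      by_cases hik : i = k
      · subst hik
        rw [if_pos hi] at h2
        simpa using h2
      · simpa [Function.update_of_ne hik] using h1 i ⟨hik, hi⟩
  rw [Measure.map_apply (measurable_update_prod k)
    (MeasurableSet.pi s.countable_toSet fun i _ => ht i), hpre, Measure.prod_prod, seqLaw,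
    Measure.infinitePi_pi _ fun i _ => ht i]
  split_ifs with hk
  · rw [mul_comm, Finset.mul_prod_erase s (fun i => ν (t i)) hk]
  · rw [Finset.erase_eq_of_notMem hk, measure_univ, mul_one]

/-- An integrand adapted to the past of `k` does not notice that the `k`-th term has been replaced
by an independent copy. This is the Markov step for schemes driven by i.i.d. increments. -/
lemma lintegral_seqLaw_coord (k : ℕ) {F : (ℕ → Y) → Y → ℝ≥0∞}
    (hF : Measurable (Function.uncurry F)) (hd : ∀ y y' z, (∀ i < k, y i = y' i) → F y z = F y' z) :
    ∫⁻ y, F y (y k) ∂(seqLaw ν) = ∫⁻ y, ∫⁻ z, F y z ∂ν ∂(seqLaw ν) := by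
  have hm : Measurable fun y : ℕ → Y => F y (y k) :=
    hF.comp (measurable_id.prodMk (measurable_pi_apply k))
  rw [← (measurePreserving_update ν k).lintegral_comp hm, lintegral_prod (fun q : (ℕ → Y) × Y =>
    F (Function.update q.1 k q.2) (Function.update q.1 k q.2 k))
    (hm.comp (measurable_update_prod k)).aemeasurable]
  refine lintegral_congr fun y => lintegral_congr fun z => ?_
  simp only [Function.update_self]
  exact hd _ _ _ fun i hi => Function.update_of_ne hi.ne _ _

end Resampling

/-! ### Common bounds for the coefficients -/

section Coefficients

variable {dx dy : ℕ}

/-- Uniform bounds and Lipschitz bounds of the coefficients. -/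
structure FilterModel.Bounds (M : FilterModel dx dy) (B : ℝ≥0) : Prop where
  one_le : 1 ≤ B
  h_bdd : ∀ x, ‖M.h x‖ ≤ B
  h_lip : ∀ x x', ‖M.h x - M.h x'‖ ≤ B * ‖x - x'‖
  b_bdd : ∀ x, ‖M.b x‖ ≤ B
  b_lip : ∀ x x', ‖M.b x - M.b x'‖ ≤ B * ‖x - x'‖
  s_bdd : ∀ x z, ‖Matrix.toEuclideanLin (M.σ x) z‖ ≤ B * ‖z‖
  s_lip : ∀ x x' z, ‖Matrix.toEuclideanLin (M.σ x) z - Matrix.toEuclideanLin (M.σ x') z‖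
    ≤ B * ‖x - x'‖ * ‖z‖

lemma norm_le_sum_abs {d : ℕ} (v : Vec d) : ‖v‖ ≤ ∑ i, |v i| := by
  rw [EuclideanSpace.norm_eq, Real.sqrt_le_left (Finset.sum_nonneg fun i _ => abs_nonneg _)]
  simp only [Real.norm_eq_abs]
  exact Finset.sum_sq_le_sq_sum_of_nonneg fun i _ => abs_nonneg _

lemma norm_toEuclideanLin_le {d : ℕ} (A : Matrix (Fin d) (Fin d) ℝ) (z : Vec d) :
    ‖Matrix.toEuclideanLin A z‖ ≤ (∑ i, ∑ j, |A i j|) * ‖z‖ := by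
  refine (norm_le_sum_abs _).trans ?_
  rw [Finset.sum_mul]
  refine Finset.sum_le_sum fun i _ => ?_
  rw [Finset.sum_mul]
  have e : Matrix.toEuclideanLin A z i = ∑ j, A i j * z j := rfl
  rw [e]
  refine (Finset.abs_sum_le_sum_abs _ _).trans (Finset.sum_le_sum fun j _ => ?_)
  rw [abs_mul]
  gcongr
  exact PiLp.norm_apply_le z j

/-- Finitely many bounds have a common one. -/
lemma exists_common_bound {ι : Type*} [Finite ι] {p : ι → ℝ → Prop} (h : ∀ i, ∃ K, p i K)
    (hmono : ∀ i K K', K ≤ K' → p i K → p i K') : ∃ K, 0 ≤ K ∧ ∀ i, p i K := by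
  choose K hK using h
  obtain ⟨b, hb⟩ := (Set.finite_range K).bddAbove
  exact ⟨max b 0, le_max_right _ _, fun i => hmono i _ _
    ((hb (Set.mem_range_self i)).trans (le_max_left _ _)) (hK i)⟩

lemma exists_bdd {E ι : Type*} [Finite ι] {f : ι → E → ℝ} (h : ∀ i, IsBddFun (f i)) :
    ∃ K, 0 ≤ K ∧ ∀ i x, |f i x| ≤ K :=
  exists_common_bound h fun _ _ _ hK h x => (h x).trans hK

lemma exists_lip {d : ℕ} {ι : Type*} [Finite ι] {f : ι → Vec d → ℝ} (h : ∀ i, IsLipFun (f i)) :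
    ∃ K, 0 ≤ K ∧ ∀ i x y, |f i x - f i y| ≤ K * ‖x - y‖ :=
  exists_common_bound h fun _ _ _ hK h x y => (h x y).trans (by gcongr)

lemma norm_le_of_entries {d : ℕ} {v : Vec d} {K : ℝ} (h : ∀ i, |v i| ≤ K) : ‖v‖ ≤ d * K :=
  (norm_le_sum_abs v).trans ((Finset.sum_le_sum fun i _ => h i).trans (by simp))

lemma norm_toEuclideanLin_le_of_entries {d : ℕ} {A : Matrix (Fin d) (Fin d) ℝ} {K : ℝ}
    (h : ∀ i j, |A i j| ≤ K) (z : Vec d) : ‖Matrix.toEuclideanLin A z‖ ≤ d * (d * K) * ‖z‖ := by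
  refine (norm_toEuclideanLin_le A z).trans ?_
  gcongr
  exact (Finset.sum_le_sum fun i _ => Finset.sum_le_sum fun j _ => h i j).trans (by simp)

lemma FilterModel.Regular.exists_bounds {M : FilterModel dx dy} (hM : M.Regular) :
    ∃ B, M.Bounds B := by
  obtain ⟨k1, p1, h1⟩ := exists_bdd hM.h_bdd
  obtain ⟨k2, p2, h2⟩ := exists_lip hM.h_lip
  obtain ⟨k3, p3, h3⟩ := exists_bdd hM.b_bdd
  obtain ⟨k4, p4, h4⟩ := exists_lip hM.b_lip
  obtain ⟨k5, p5, h5⟩ := exists_bdd (f := fun q : Fin dx × Fin dx => fun x => M.σ x q.1 q.2)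
    fun q => hM.sigma_bdd q.1 q.2
  obtain ⟨k6, p6, h6⟩ := exists_lip (f := fun q : Fin dx × Fin dx => fun x => M.σ x q.1 q.2)
    fun q => hM.sigma_lip q.1 q.2
  -- A crude sum of all entrywise bounds, weighted by the dimensions that appear in passing to
  -- norms; the summand one ensures `1 ≤ B`.
  set B : ℝ := 1 + dy * k1 + dy * k2 + dx * k3 + dx * k4 + dx * (dx * k5) + dx * (dx * k6) with hB
  have q1 : 0 ≤ dy * k1 := by positivity
  have q2 : 0 ≤ dy * k2 := by positivity
  have q3 : 0 ≤ dx * k3 := by positivity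
  have q4 : 0 ≤ dx * k4 := by positivity
  have q5 : 0 ≤ dx * (dx * k5) := by positivity
  have q6 : 0 ≤ dx * (dx * k6) := by positivity
  have hB0 : 0 ≤ B := by positivity
  obtain ⟨B', hB'⟩ : ∃ B' : ℝ≥0, (B' : ℝ) = B := ⟨B.toNNReal, Real.coe_toNNReal _ hB0⟩
  refine ⟨B', ?_, fun x => ?_, fun x x' => ?_, fun x => ?_, fun x x' => ?_, fun x z => ?_,
    fun x x' z => ?_⟩
  · refine NNReal.coe_le_coe.1 ?_
    rw [hB', NNReal.coe_one]; linarith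
  · refine (norm_le_of_entries fun i => h1 i x).trans ?_
    rw [hB']; linarith
  · refine (norm_le_of_entries (K := k2 * ‖x - x'‖) fun i => h2 i x x').trans ?_
    rw [← mul_assoc]
    gcongr
    rw [hB']; linarith
  · refine (norm_le_of_entries fun i => h3 i x).trans ?_
    rw [hB']; linarith
  · refine (norm_le_of_entries (K := k4 * ‖x - x'‖) fun i => h4 i x x').trans ?_
    rw [← mul_assoc]
    gcongr
    rw [hB']; linarith
  · refine (norm_toEuclideanLin_le_of_entries (fun i j => h5 (i, j) x) z).trans ?_
    gcongr
    rw [hB']; linarith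
  · rw [← LinearMap.sub_apply, ← map_sub]
    refine (norm_toEuclideanLin_le_of_entries (K := k6 * ‖x - x'‖)
      (fun i j => h6 (i, j) x x') z).trans ?_
    have : dx * (dx * (k6 * ‖x - x'‖)) = dx * (dx * k6) * ‖x - x'‖ := by ring
    rw [this]
    gcongr
    rw [hB']; linarith

namespace FilterModel.Bounds

variable {M : FilterModel dx dy} {B : ℝ≥0}

lemma continuous_h (hB : M.Bounds B) : Continuous M.h :=
  (LipschitzWith.of_dist_le_mul (K := B) fun x y => by
    rw [dist_eq_norm, dist_eq_norm]; exact hB.h_lip x y).continuous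

lemma continuous_b (hB : M.Bounds B) : Continuous M.b :=
  (LipschitzWith.of_dist_le_mul (K := B) fun x y => by
    rw [dist_eq_norm, dist_eq_norm]; exact hB.b_lip x y).continuous

lemma measurable_h (hB : M.Bounds B) : Measurable M.h := hB.continuous_h.measurable

lemma measurable_b (hB : M.Bounds B) : Measurable M.b := hB.continuous_b.measurable

/-- The map is Lipschitz in the point with constant proportional to the vector, and linear in the
vector, hence jointly continuous. -/
lemma measurable_s (hB : M.Bounds B) :
    Measurable fun q : Vec dx × Vec dx => Matrix.toEuclideanLin (M.σ q.1) q.2 := by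
  refine Continuous.measurable (continuous_iff_continuousAt.2 fun q => ?_)
  rw [ContinuousAt, tendsto_iff_norm_sub_tendsto_zero]
  have hb : Filter.Tendsto (fun r : Vec dx × Vec dx => B * ‖r.1 - q.1‖ * ‖r.2‖ + B * ‖r.2 - q.2‖)
      (nhds q) (nhds (B * ‖q.1 - q.1‖ * ‖q.2‖ + B * ‖q.2 - q.2‖)) :=
    (Continuous.tendsto (by fun_prop) q)
  simp only [sub_self, norm_zero, mul_zero, zero_mul, add_zero] at hb
  refine squeeze_zero (fun r => norm_nonneg _) (fun r => ?_) hb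
  have e : Matrix.toEuclideanLin (M.σ r.1) r.2 - Matrix.toEuclideanLin (M.σ q.1) q.2 =
      (Matrix.toEuclideanLin (M.σ r.1) r.2 - Matrix.toEuclideanLin (M.σ q.1) r.2)
        + Matrix.toEuclideanLin (M.σ q.1) (r.2 - q.2) := by
    rw [map_sub]; abel
  rw [e]
  exact (norm_add_le _ _).trans (add_le_add (hB.s_lip _ _ _) (hB.s_bdd _ _))

end FilterModel.Bounds

end Coefficients

/-! ### Moments of Brownian increments over one time step -/

section IncrementMoments

variable {d l : ℕ}

variable (d) in
/-- Moments of the standard Gaussian law. -/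
def gMom (r : ℕ) : ℝ := ∫ w, ‖w‖ ^ r ∂(stdGaussian (Vec d))

lemma gMom_nonneg (r : ℕ) : 0 ≤ gMom d r := integral_nonneg fun _ => by positivity

lemma integrable_norm_pow_stdGaussian (r : ℕ) :
    Integrable (fun w => ‖w‖ ^ r) (stdGaussian (Vec d)) := by
  have h := IsGaussian.memLp_id (stdGaussian (Vec d)) (r : ℝ≥0∞) (ENNReal.natCast_ne_top r)
  simpa using h.integrable_norm_pow'

lemma integrable_norm_pow_incr (r : ℕ) : Integrable (fun z => ‖z‖ ^ r) (incr d l) := by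
  rw [incr, integrable_map_measure (by fun_prop) (by fun_prop)]
  have : ((fun z : Vec d => ‖z‖ ^ r) ∘ fun z => Real.sqrt (stepSize l) • z)
      = fun z => Real.sqrt (stepSize l) ^ r * ‖z‖ ^ r := by
    funext z
    simp only [Function.comp_apply, norm_smul, mul_pow, Real.norm_eq_abs,
      abs_of_nonneg (Real.sqrt_nonneg _)]
  rw [this]
  exact (integrable_norm_pow_stdGaussian r).const_mul _

lemma integral_norm_pow_incr (r : ℕ) :
    ∫ z, ‖z‖ ^ r ∂(incr d l) = Real.sqrt (stepSize l) ^ r * gMom d r := by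
  rw [incr, integral_map (by fun_prop) (by fun_prop), gMom, ← integral_const_mul]
  simp only [norm_smul, mul_pow, Real.norm_eq_abs, abs_of_nonneg (Real.sqrt_nonneg _)]

lemma integrable_id_incr : Integrable (fun z => z) (incr d l) := by
  have := integrable_norm_pow_incr (d := d) (l := l) 1
  simp only [pow_one] at this
  exact (integrable_norm_iff (by fun_prop)).1 this

lemma integral_id_incr : ∫ z, z ∂(incr d l) = 0 := by
  rw [incr, integral_map (by fun_prop) (by fun_prop), integral_smul, integral_id_stdGaussian,
    smul_zero]

lemma add_pow_le_two_pow_mul {a b : ℝ} (ha : 0 ≤ a) (hb : 0 ≤ b) (n : ℕ) :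
    (a + b) ^ n ≤ 2 ^ n * (a ^ n + b ^ n) := by
  rcases le_total a b with h | h
  · calc (a + b) ^ n ≤ (2 * b) ^ n := by gcongr; linarith
      _ = 2 ^ n * b ^ n := mul_pow _ _ _
      _ ≤ _ := by gcongr; exact le_add_of_nonneg_left (by positivity)
  · calc (a + b) ^ n ≤ (2 * a) ^ n := by gcongr; linarith
      _ = 2 ^ n * a ^ n := mul_pow _ _ _
      _ ≤ _ := by gcongr; exact le_add_of_nonneg_right (by positivity)

lemma sqrt_stepSize_le_one : Real.sqrt (stepSize l) ≤ 1 :=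
  Real.sqrt_le_one.2 (stepSize_le_one l)

lemma stepSize_le_sqrt : stepSize l ≤ Real.sqrt (stepSize l) := by
  have h := Real.mul_self_sqrt (stepSize_pos l).le
  have := sqrt_stepSize_le_one (l := l)
  nlinarith [Real.sqrt_nonneg (stepSize l)]

lemma integrable_add_norm_pow (r : ℕ) :
    Integrable (fun z => (stepSize l + ‖z‖) ^ r) (incr d l) := by
  refine Integrable.mono' (((integrable_const (stepSize l ^ r)).add
    (integrable_norm_pow_incr (d := d) (l := l) r)).const_mul (2 ^ r)) (by fun_prop)
    (ae_of_all _ fun z => ?_)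
  have := (stepSize_pos l).le
  rw [Real.norm_eq_abs, abs_of_nonneg (by positivity)]
  exact add_pow_le_two_pow_mul this (norm_nonneg z) r

lemma integral_add_norm_pow_le (r : ℕ) :
    ∫ z, (stepSize l + ‖z‖) ^ r ∂(incr d l) ≤
      2 ^ r * (1 + gMom d r) * Real.sqrt (stepSize l) ^ r := by
  have hp := (stepSize_pos l).le
  calc ∫ z, (stepSize l + ‖z‖) ^ r ∂(incr d l)
      ≤ ∫ z, 2 ^ r * (stepSize l ^ r + ‖z‖ ^ r) ∂(incr d l) :=
        integral_mono (integrable_add_norm_pow r) (((integrable_const (stepSize l ^ r)).add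
          (integrable_norm_pow_incr r)).const_mul (2 ^ r)) fun z =>
            add_pow_le_two_pow_mul hp (norm_nonneg z) r
    _ = 2 ^ r * (stepSize l ^ r + Real.sqrt (stepSize l) ^ r * gMom d r) := by
        rw [integral_const_mul, integral_add (integrable_const _) (integrable_norm_pow_incr r),
          integral_const, integral_norm_pow_incr]
        simp
    _ ≤ 2 ^ r * (Real.sqrt (stepSize l) ^ r + Real.sqrt (stepSize l) ^ r * gMom d r) := by
        gcongr
        exact stepSize_le_sqrt
    _ = _ := by ring

end IncrementMoments

end CoupledPF

namespace CoupledPF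

/-! ### Strong error of the coupled Euler schemes in all moments -/

section EulerError

variable {dx dy : ℕ}

namespace FilterModel

variable (M : FilterModel dx dy) {B : ℝ≥0} {l : ℕ}

/-- The increment over one time step of the difference of two Euler schemes. -/
def eulerNoise (Δ : ℝ) (u v z : Vec dx) : Vec dx :=
  Δ • (M.b u - M.b v) + (Matrix.toEuclideanLin (M.σ u) z - Matrix.toEuclideanLin (M.σ v) z)

variable {M}

lemma norm_eulerNoise_le (hB : M.Bounds B) {Δ : ℝ} (hΔ : 0 ≤ Δ) (u v z : Vec dx) :
    ‖M.eulerNoise Δ u v z‖ ≤ B * ‖u - v‖ * (Δ + ‖z‖) := by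
  calc ‖M.eulerNoise Δ u v z‖ ≤ Δ * (B * ‖u - v‖) + B * ‖u - v‖ * ‖z‖ := by
        refine (norm_add_le _ _).trans (add_le_add ?_ (hB.s_lip u v z))
        rw [norm_smul, Real.norm_eq_abs, abs_of_nonneg hΔ]
        gcongr
        exact hB.b_lip u v
    _ = _ := by ring

lemma Bounds.measurable_toEuclideanLin (hB : M.Bounds B) {Ω : Type*} [MeasurableSpace Ω]
    {u z : Ω → Vec dx} (hu : Measurable u) (hz : Measurable z) :
    Measurable fun ω => Matrix.toEuclideanLin (M.σ (u ω)) (z ω) := by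
  have h := hB.measurable_s.comp (hu.prodMk hz)
  simp only [Function.comp_def] at h
  exact h

lemma Bounds.measurable_drift (hB : M.Bounds B) {Ω : Type*} [MeasurableSpace Ω]
    {u : Ω → Vec dx} (hu : Measurable u) (Δ : ℝ) : Measurable fun ω => Δ • M.b (u ω) :=
  (hB.measurable_b.comp hu).const_smul Δ

lemma measurable_eulerNoise (hB : M.Bounds B) (Δ : ℝ) {Ω : Type*} [MeasurableSpace Ω]
    {u v z : Ω → Vec dx} (hu : Measurable u) (hv : Measurable v) (hz : Measurable z) :
    Measurable fun ω => M.eulerNoise Δ (u ω) (v ω) (z ω) := by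
  have h1 : Measurable fun ω => M.b (u ω) := hB.measurable_b.comp hu
  have h2 : Measurable fun ω => M.b (v ω) := hB.measurable_b.comp hv
  have h := ((h1.sub h2).const_smul Δ).add
    ((hB.measurable_toEuclideanLin hu hz).sub (hB.measurable_toEuclideanLin hv hz))
  exact h

lemma measurable_eulerNoise_right (hB : M.Bounds B) (Δ : ℝ) (u v : Vec dx) :
    Measurable fun z => M.eulerNoise Δ u v z :=
  measurable_eulerNoise hB Δ measurable_const measurable_const measurable_id

lemma integrable_norm_pow_eulerNoise (hB : M.Bounds B) (u v : Vec dx) (r : ℕ) :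
    Integrable (fun z => ‖M.eulerNoise (stepSize l) u v z‖ ^ r) (incr dx l) := by
  refine Integrable.mono' ((integrable_add_norm_pow (d := dx) (l := l) r).const_mul
    ((B * ‖u - v‖) ^ r)) ((measurable_eulerNoise_right hB _ u v).norm.pow_const r).aestronglyMeasurable
    (ae_of_all _ fun z => ?_)
  rw [Real.norm_eq_abs, abs_of_nonneg (by positivity), ← mul_pow]
  gcongr
  exact norm_eulerNoise_le hB (stepSize_pos l).le u v z

/-- The increment scales like √Δ, so for exponents at least two its moments are at most of order Δ,
which can be summed over 1/Δ steps. -/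
lemma integral_norm_pow_eulerNoise_le (hB : M.Bounds B) (u v : Vec dx) {r : ℕ} (hr : 2 ≤ r) :
    ∫ z, ‖M.eulerNoise (stepSize l) u v z‖ ^ r ∂(incr dx l) ≤
      stepSize l * ((2 * B) ^ r * (1 + gMom dx r)) * ‖u - v‖ ^ r := by
  have hg := gMom_nonneg (d := dx) r
  calc ∫ z, ‖M.eulerNoise (stepSize l) u v z‖ ^ r ∂(incr dx l)
      ≤ ∫ z, (B * ‖u - v‖) ^ r * (stepSize l + ‖z‖) ^ r ∂(incr dx l) := by
        refine integral_mono (integrable_norm_pow_eulerNoise hB u v r)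
          ((integrable_add_norm_pow r).const_mul _) fun z => ?_
        simp only [← mul_pow]
        gcongr
        exact norm_eulerNoise_le hB (stepSize_pos l).le u v z
    _ ≤ (B * ‖u - v‖) ^ r * (2 ^ r * (1 + gMom dx r) * Real.sqrt (stepSize l) ^ r) := by
        rw [integral_const_mul]
        gcongr
        exact integral_add_norm_pow_le r
    _ ≤ (B * ‖u - v‖) ^ r * (2 ^ r * (1 + gMom dx r) * Real.sqrt (stepSize l) ^ 2) := by
        gcongr ?_ * (?_ * ?_)
        exact pow_le_pow_of_le_one (Real.sqrt_nonneg _) sqrt_stepSize_le_one hr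
    _ = _ := by rw [Real.sq_sqrt (stepSize_pos l).le]; ring

/-- The diffusion part is linear in a centred increment; only the drift survives, with a factor Δ.
-/
lemma integral_eulerNoise (hB : M.Bounds B) (u v : Vec dx) :
    Integrable (M.eulerNoise (stepSize l) u v) (incr dx l) ∧
      ∫ z, M.eulerNoise (stepSize l) u v z ∂(incr dx l) = stepSize l • (M.b u - M.b v) := by
  have hi : Integrable (M.eulerNoise (stepSize l) u v) (incr dx l) := by
    have := integrable_norm_pow_eulerNoise (l := l) hB u v 1
    simp only [pow_one] at this
    exact (integrable_norm_iff (measurable_eulerNoise_right hB _ u v).aestronglyMeasurable).1 this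
  refine ⟨hi, ?_⟩
  set L : Vec dx →L[ℝ] Vec dx :=
    LinearMap.toContinuousLinearMap (Matrix.toEuclideanLin (M.σ u) - Matrix.toEuclideanLin (M.σ v))
  have hL : ∫ z, L z ∂(incr dx l) = 0 := by
    rw [L.integral_comp_comm integrable_id_incr, integral_id_incr, map_zero]
  have e : ∀ z, M.eulerNoise (stepSize l) u v z = stepSize l • (M.b u - M.b v) + L z := fun z => rfl
  simp only [e]
  rw [integral_add (integrable_const _) (L.integrable_comp integrable_id_incr), hL, integral_const]
  simp

variable (dx) in
/-- Growth rate of the moments of the Euler error. -/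
def growth (B : ℝ≥0) (m : ℕ) : ℝ :=
  (2 * (m + 1) * B + evenPowConst m * ((2 * B) ^ 2 * (1 + gMom dx 2)
    + (2 * B) ^ (2 * m + 2) * (1 + gMom dx (2 * m + 2)))) * (1 + 2 ^ (2 * m + 2))

lemma growth_nonneg (B : ℝ≥0) (m : ℕ) : 0 ≤ growth dx B m := by
  have h1 := gMom_nonneg (d := dx) 2
  have h2 := gMom_nonneg (d := dx) (2 * m + 2)
  have h3 := (evenPowConst_pos m).le
  unfold growth
  positivity

lemma pow_mul_le_add {s t : ℝ} (hs : 0 ≤ s) (ht : 0 ≤ t) (i j : ℕ) :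
    s ^ i * t ^ j ≤ s ^ (i + j) + t ^ (i + j) := by
  rcases le_total s t with h | h
  · calc s ^ i * t ^ j ≤ t ^ i * t ^ j := by gcongr
      _ = t ^ (i + j) := (pow_add _ _ _).symm
      _ ≤ _ := le_add_of_nonneg_left (by positivity)
  · calc s ^ i * t ^ j ≤ s ^ i * s ^ j := by gcongr
      _ = s ^ (i + j) := (pow_add _ _ _).symm
      _ ≤ _ := le_add_of_nonneg_right (by positivity)

/-- One step of the moment recursion of the Euler error. -/
lemma lintegral_euler_step (hB : M.Bounds B) (m : ℕ) {a u v : Vec dx} {ρ : ℝ} (hρ : 0 ≤ ρ)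
    (h : ‖u - v‖ ≤ ‖a‖ + ρ) :
    ∫⁻ z, ENNReal.ofReal (‖a + M.eulerNoise (stepSize l) u v z‖ ^ (2 * m + 2)) ∂(incr dx l) ≤
      ENNReal.ofReal (‖a‖ ^ (2 * m + 2)
        + stepSize l * growth dx B m * (‖a‖ ^ (2 * m + 2) + ρ ^ (2 * m + 2))) := by
  obtain ⟨hi, he⟩ := integral_eulerNoise (l := l) hB u v
  refine (lintegral_norm_add_pow_even_le m hi (integrable_norm_pow_eulerNoise hB u v 2)
    (integrable_norm_pow_eulerNoise hB u v (2 * m + 2)) a).trans (ENNReal.ofReal_le_ofReal ?_)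
  rw [he]
  have hp := (stepSize_pos l).le
  have hg2 := gMom_nonneg (d := dx) 2
  have hgm := gMom_nonneg (d := dx) (2 * m + 2)
  have hk := (evenPowConst_pos m).le
  set s := ‖a‖ with hs
  set δ := ‖u - v‖ with hδ
  set Δ := stepSize l
  have s0 : 0 ≤ s := norm_nonneg _
  have δ0 : 0 ≤ δ := norm_nonneg _
  have i1 : inner ℝ a (Δ • (M.b u - M.b v)) ≤ Δ * (B * (s * δ)) := by
    refine (real_inner_le_norm _ _).trans ?_
    rw [norm_smul, Real.norm_eq_abs, abs_of_nonneg hp]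
    calc s * (Δ * ‖M.b u - M.b v‖) ≤ s * (Δ * (B * δ)) := by gcongr; exact hB.b_lip u v
      _ = _ := by ring
  have i2 := integral_norm_pow_eulerNoise_le (l := l) hB u v le_rfl
  have i3 := integral_norm_pow_eulerNoise_le (l := l) hB u v (r := 2 * m + 2) (by lia)
  set Q := s ^ (2 * m + 2) + δ ^ (2 * m + 2) with hQ
  have q1 : s ^ (2 * m) * (s * δ) ≤ Q := by
    have := pow_mul_le_add s0 δ0 (2 * m + 1) 1
    calc s ^ (2 * m) * (s * δ) = s ^ (2 * m + 1) * δ ^ 1 := by ring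
      _ ≤ _ := this
  have q2 : s ^ (2 * m) * δ ^ 2 ≤ Q := pow_mul_le_add s0 δ0 (2 * m) 2
  have q3 : δ ^ (2 * m + 2) ≤ Q := le_add_of_nonneg_left (by positivity)
  have q4 : Q ≤ (1 + 2 ^ (2 * m + 2)) * (s ^ (2 * m + 2) + ρ ^ (2 * m + 2)) := by
    have : δ ^ (2 * m + 2) ≤ 2 ^ (2 * m + 2) * (s ^ (2 * m + 2) + ρ ^ (2 * m + 2)) :=
      (by gcongr : δ ^ (2 * m + 2) ≤ (s + ρ) ^ (2 * m + 2)).trans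
        (add_pow_le_two_pow_mul s0 hρ _)
    have h2 : 0 ≤ ρ ^ (2 * m + 2) := by positivity
    rw [hQ]; linarith
  set c2 := (2 * (B : ℝ)) ^ 2 * (1 + gMom dx 2) with hc2
  set c3 := (2 * (B : ℝ)) ^ (2 * m + 2) * (1 + gMom dx (2 * m + 2)) with hc3
  have c20 : 0 ≤ c2 := by positivity
  have c30 : 0 ≤ c3 := by positivity
  have t1 : 2 * ((m : ℝ) + 1) * s ^ (2 * m) * inner ℝ a (Δ • (M.b u - M.b v)) ≤
      Δ * (2 * (m + 1) * B) * Q := by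
    calc _ ≤ 2 * ((m : ℝ) + 1) * s ^ (2 * m) * (Δ * (B * (s * δ))) := by gcongr
      _ = Δ * (2 * (m + 1) * B) * (s ^ (2 * m) * (s * δ)) := by ring
      _ ≤ _ := by gcongr
  have t2 : evenPowConst m * (s ^ (2 * m) * ∫ z, ‖M.eulerNoise Δ u v z‖ ^ 2 ∂(incr dx l)
      + ∫ z, ‖M.eulerNoise Δ u v z‖ ^ (2 * m + 2) ∂(incr dx l)) ≤
      Δ * (evenPowConst m * (c2 + c3)) * Q := by
    calc _ ≤ evenPowConst m * (s ^ (2 * m) * (Δ * c2 * δ ^ 2) + Δ * c3 * δ ^ (2 * m + 2)) := by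
          gcongr
      _ = Δ * evenPowConst m * (c2 * (s ^ (2 * m) * δ ^ 2) + c3 * δ ^ (2 * m + 2)) := by ring
      _ ≤ Δ * evenPowConst m * (c2 * Q + c3 * Q) := by gcongr
      _ = _ := by ring
  calc _ ≤ s ^ (2 * m + 2) + Δ * (2 * (m + 1) * B) * Q + Δ * (evenPowConst m * (c2 + c3)) * Q :=
        add_le_add (add_le_add_right t1 _) t2
    _ = s ^ (2 * m + 2) + Δ * (2 * (m + 1) * B + evenPowConst m * (c2 + c3)) * Q := by ring
    _ ≤ s ^ (2 * m + 2) + Δ * (2 * (m + 1) * B + evenPowConst m * (c2 + c3)) *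
        ((1 + 2 ^ (2 * m + 2)) * (s ^ (2 * m + 2) + ρ ^ (2 * m + 2))) := by gcongr
    _ = _ := by rw [growth]; ring

variable (M)

/-- The coarse Euler chain driven by the sums of consecutive fine increments. -/
def coarseChain (l : ℕ) (x : Vec dx) (ξ : ℕ → Vec dx) (j : ℕ) : Vec dx :=
  M.eulerChain l x (fun j => ξ (2 * j) + ξ (2 * j + 1)) j

/-- Interpolation of the coarse Euler chain at the fine grid times. -/
def interp (l : ℕ) (x : Vec dx) (ξ : ℕ → Vec dx) (k : ℕ) : Vec dx :=
  M.coarseChain l x ξ (k / 2) + if k % 2 = 1 then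
    stepSize (l + 1) • M.b (M.coarseChain l x ξ (k / 2))
      + Matrix.toEuclideanLin (M.σ (M.coarseChain l x ξ (k / 2))) (ξ (k - 1)) else 0

variable {M}

lemma eulerChain_succ (l : ℕ) (x : Vec dx) (ξ : ℕ → Vec dx) (k : ℕ) :
    M.eulerChain l x ξ (k + 1) = M.eulerChain l x ξ k + stepSize l • M.b (M.eulerChain l x ξ k)
      + Matrix.toEuclideanLin (M.σ (M.eulerChain l x ξ k)) (ξ k) := rfl

/-- The interpolation advances on the fine grid with coefficients frozen at the last coarse time;
after two fine steps it has made exactly one coarse step. It thus differs from the fine chain, step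
by step, by one `eulerNoise`. -/
lemma interp_succ (x : Vec dx) (ξ : ℕ → Vec dx) (k : ℕ) :
    M.interp l x ξ (k + 1) = M.interp l x ξ k
      + (stepSize (l + 1) • M.b (M.coarseChain l x ξ (k / 2))
        + Matrix.toEuclideanLin (M.σ (M.coarseChain l x ξ (k / 2))) (ξ k)) := by
  obtain ⟨j, rfl | rfl⟩ : ∃ j, k = 2 * j ∨ k = 2 * j + 1 := ⟨k / 2, by lia⟩
  · have e1 : (2 * j + 1) / 2 = j := by lia
    have e2 : (2 * j) / 2 = j := by lia
    have e3 : (2 * j + 1) % 2 = 1 := by lia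
    have e4 : ¬ (2 * j) % 2 = 1 := by lia
    simp only [interp, e1, e2, if_pos e3, if_neg e4, Nat.add_sub_cancel, add_zero]
  · have e1 : (2 * j + 1 + 1) / 2 = j + 1 := by lia
    have e2 : (2 * j + 1) / 2 = j := by lia
    have e3 : ¬ (2 * j + 1 + 1) % 2 = 1 := by lia
    have e4 : (2 * j + 1) % 2 = 1 := by lia
    simp only [interp, e1, e2, if_neg e3, if_pos e4, Nat.add_sub_cancel, add_zero]
    rw [coarseChain, eulerChain_succ, ← coarseChain, stepSize_succ, map_add]
    module

lemma eulerChain_congr {x : Vec dx} {ξ ξ' : ℕ → Vec dx} {k : ℕ} (h : ∀ i < k, ξ i = ξ' i) :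
    M.eulerChain l x ξ k = M.eulerChain l x ξ' k := by
  induction k with
  | zero => rfl
  | succ k ih =>
    rw [eulerChain_succ, eulerChain_succ, ih fun i hi => h i (Nat.lt_succ_of_lt hi),
      h k (Nat.lt_succ_self k)]

lemma coarseChain_congr {x : Vec dx} {ξ ξ' : ℕ → Vec dx} {j : ℕ} (h : ∀ i < 2 * j, ξ i = ξ' i) :
    M.coarseChain l x ξ j = M.coarseChain l x ξ' j :=
  eulerChain_congr fun i hi => by rw [h (2 * i) (by lia), h (2 * i + 1) (by lia)]

lemma interp_congr {x : Vec dx} {ξ ξ' : ℕ → Vec dx} {k : ℕ} (h : ∀ i < k, ξ i = ξ' i) :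
    M.interp l x ξ k = M.interp l x ξ' k := by
  have e : M.coarseChain l x ξ (k / 2) = M.coarseChain l x ξ' (k / 2) :=
    coarseChain_congr fun i hi => h i (by lia)
  unfold interp
  split_ifs with hk
  · rw [e, h (k - 1) (by lia)]
  · rw [e]

lemma norm_interp_sub_le (hB : M.Bounds B) (x : Vec dx) (ξ : ℕ → Vec dx) (k : ℕ) :
    ‖M.interp l x ξ k - M.coarseChain l x ξ (k / 2)‖ ≤ B * (stepSize (l + 1) + ‖ξ (k - 1)‖) := by
  have hp := (stepSize_pos (l + 1)).le
  rw [interp, add_sub_cancel_left]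
  split_ifs
  · refine (norm_add_le _ _).trans ?_
    rw [norm_smul, Real.norm_eq_abs, abs_of_nonneg hp]
    calc _ ≤ stepSize (l + 1) * B + B * ‖ξ (k - 1)‖ := by
          gcongr
          · exact hB.b_bdd _
          · exact hB.s_bdd _ _
      _ = _ := by ring
  · rw [norm_zero]; positivity

lemma measurable_eulerChain (hB : M.Bounds B) (l k : ℕ) {Ω : Type*} [MeasurableSpace Ω]
    {x : Ω → Vec dx} {ξ : Ω → ℕ → Vec dx} (hx : Measurable x) (hξ : ∀ i, Measurable fun ω => ξ ω i) :
    Measurable fun ω => M.eulerChain l (x ω) (ξ ω) k := by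
  induction k with
  | zero => exact hx
  | succ k ih =>
    exact (ih.add (hB.measurable_drift ih (stepSize l))).add (hB.measurable_toEuclideanLin ih (hξ k))

lemma measurable_coarseChain (hB : M.Bounds B) (l j : ℕ) {Ω : Type*} [MeasurableSpace Ω]
    {x : Ω → Vec dx} {ξ : Ω → ℕ → Vec dx} (hx : Measurable x) (hξ : ∀ i, Measurable fun ω => ξ ω i) :
    Measurable fun ω => M.coarseChain l (x ω) (ξ ω) j :=
  measurable_eulerChain hB l j hx (ξ := fun ω j => ξ ω (2 * j) + ξ ω (2 * j + 1))
    fun i => (hξ (2 * i)).add (hξ (2 * i + 1))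

lemma measurable_interp (hB : M.Bounds B) (l k : ℕ) (x : Vec dx) :
    Measurable fun ξ : ℕ → Vec dx => M.interp l x ξ k := by
  have h1 : Measurable fun ξ : ℕ → Vec dx => M.coarseChain l x ξ (k / 2) :=
    measurable_coarseChain hB l (k / 2) measurable_const measurable_pi_apply
  have h2 := (hB.measurable_drift h1 (stepSize (l + 1))).add
      (hB.measurable_toEuclideanLin h1 (measurable_pi_apply (k - 1)))
  unfold interp
  refine h1.add ?_
  split_ifs
  · exact h2
  · exact measurable_const

/-- Discrete Gronwall inequality. -/
lemma le_of_affine_recursion {A : ℕ → ℝ≥0∞} {q R : ℝ≥0∞}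
    (h : ∀ k, A (k + 1) ≤ A k + q * (A k + R)) (k : ℕ) : A k ≤ (1 + q) ^ k * (A 0 + k * q * R) := by
  induction k with
  | zero => simp
  | succ k ih =>
    calc A (k + 1) ≤ A k + q * (A k + R) := h k
      _ = (1 + q) * A k + q * R := by ring
      _ ≤ (1 + q) * ((1 + q) ^ k * (A 0 + k * q * R)) + (1 + q) ^ (k + 1) * (q * R) := by
          refine add_le_add (mul_le_mul_right ih _) ?_
          exact le_mul_of_one_le_left (by simp)
            (one_le_pow₀ (by exact le_self_add : (1 : ℝ≥0∞) ≤ 1 + q))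
      _ = _ := by push_cast; ring

/-- Moment bounds of the local oscillation of the interpolated chain. -/
def oscC (dx : ℕ) (B : ℝ≥0) (n : ℕ) : ℝ := (2 * B) ^ n * (1 + gMom dx n)

lemma oscC_nonneg (n : ℕ) : 0 ≤ oscC dx B n := by
  have := gMom_nonneg (d := dx) n
  unfold oscC; positivity

lemma lintegral_osc_le (l k n : ℕ) :
    ∫⁻ ξ, ENNReal.ofReal ((B * (stepSize l + ‖ξ k‖)) ^ n) ∂(seqLaw (incr dx l)) ≤
      ENNReal.ofReal (oscC dx B n * Real.sqrt (stepSize l) ^ n) := by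
  have hp := (stepSize_pos l).le
  have hm : Measurable fun z : Vec dx => ENNReal.ofReal ((B * (stepSize l + ‖z‖)) ^ n) := by fun_prop
  have h1 : ∫⁻ ξ, ENNReal.ofReal ((B * (stepSize l + ‖ξ k‖)) ^ n) ∂(seqLaw (incr dx l)) =
      ∫⁻ z, ENNReal.ofReal ((B * (stepSize l + ‖z‖)) ^ n) ∂(incr dx l) :=
    (measurePreserving_eval_infinitePi (fun _ : ℕ => incr dx l) k).lintegral_comp hm
  simp only [mul_pow] at h1 ⊢
  rw [h1, ← ofReal_integral_eq_lintegral_ofReal ((integrable_add_norm_pow n).const_mul _)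
    (ae_of_all _ fun z => by positivity)]
  refine ENNReal.ofReal_le_ofReal ?_
  rw [integral_const_mul]
  calc _ ≤ (B : ℝ) ^ n * (2 ^ n * (1 + gMom dx n) * Real.sqrt (stepSize l) ^ n) := by
        gcongr
        exact integral_add_norm_pow_le n
    _ = _ := by rw [oscC]; ring

/-- The `k`-th increment is independent of the error and of the coefficients at step `k`, so it is
integrated first. The coefficients are compared at points that differ by the current error plus the
oscillation of the interpolation since the last coarse time. -/
lemma lintegral_error_succ_le (hB : M.Bounds B) (m : ℕ) (x x' : Vec dx) (k : ℕ) :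
    ∫⁻ ξ, ENNReal.ofReal (‖M.eulerChain (l + 1) x ξ (k + 1) - M.interp l x' ξ (k + 1)‖ ^ (2 * m + 2))
        ∂(seqLaw (incr dx (l + 1))) ≤
      ∫⁻ ξ, ENNReal.ofReal (‖M.eulerChain (l + 1) x ξ k - M.interp l x' ξ k‖ ^ (2 * m + 2))
        ∂(seqLaw (incr dx (l + 1))) + ENNReal.ofReal (stepSize (l + 1) * growth dx B m) *
      (∫⁻ ξ, ENNReal.ofReal (‖M.eulerChain (l + 1) x ξ k - M.interp l x' ξ k‖ ^ (2 * m + 2))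
        ∂(seqLaw (incr dx (l + 1)))
        + ENNReal.ofReal (oscC dx B (2 * m + 2) * Real.sqrt (stepSize (l + 1)) ^ (2 * m + 2))) := by
  set e : (ℕ → Vec dx) → Vec dx := fun ξ => M.eulerChain (l + 1) x ξ k - M.interp l x' ξ k with he
  set U : (ℕ → Vec dx) → Vec dx := fun ξ => M.eulerChain (l + 1) x ξ k with hU
  set V : (ℕ → Vec dx) → Vec dx := fun ξ => M.coarseChain l x' ξ (k / 2) with hV
  have hUm : Measurable U := measurable_eulerChain hB (l + 1) k measurable_const measurable_pi_apply
  have hVm : Measurable V := measurable_coarseChain hB l (k / 2) measurable_const measurable_pi_apply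
  have hem : Measurable e := hUm.sub (measurable_interp hB l k x')
  have hp := (stepSize_pos (l + 1)).le
  have hgr := growth_nonneg (dx := dx) B m
  have hsucc : ∀ ξ, M.eulerChain (l + 1) x ξ (k + 1) - M.interp l x' ξ (k + 1) =
      e ξ + M.eulerNoise (stepSize (l + 1)) (U ξ) (V ξ) (ξ k) := by
    intro ξ
    rw [eulerChain_succ, interp_succ]
    simp only [he, hU, hV, eulerNoise]
    module
  have hF : Measurable (Function.uncurry fun (ξ : ℕ → Vec dx) z =>
      ENNReal.ofReal (‖e ξ + M.eulerNoise (stepSize (l + 1)) (U ξ) (V ξ) z‖ ^ (2 * m + 2))) := by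
    have h1 : Measurable fun q : (ℕ → Vec dx) × Vec dx =>
        M.eulerNoise (stepSize (l + 1)) (U q.1) (V q.1) q.2 :=
      measurable_eulerNoise hB (stepSize (l + 1)) (hUm.comp measurable_fst)
        (hVm.comp measurable_fst) measurable_snd
    exact (((hem.comp measurable_fst).add h1).norm.pow_const _).ennreal_ofReal
  simp only [hsucc]
  rw [lintegral_seqLaw_coord (incr dx (l + 1)) k (F := fun ξ z => ENNReal.ofReal
    (‖e ξ + M.eulerNoise (stepSize (l + 1)) (U ξ) (V ξ) z‖ ^ (2 * m + 2))) hF ?_]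
  swap
  · intro ξ ξ' z h
    have e1 : U ξ = U ξ' := eulerChain_congr h
    have e2 : V ξ = V ξ' := coarseChain_congr fun i hi => h i (by lia)
    have e3 : e ξ = e ξ' := by
      simp only [he]; rw [eulerChain_congr h, interp_congr h]
    rw [e1, e2, e3]
  have m1 : Measurable fun ξ => ENNReal.ofReal (‖e ξ‖ ^ (2 * m + 2)) :=
    (hem.norm.pow_const _).ennreal_ofReal
  calc _ ≤ ∫⁻ ξ, (ENNReal.ofReal (‖e ξ‖ ^ (2 * m + 2))
        + ENNReal.ofReal (stepSize (l + 1) * growth dx B m) * (ENNReal.ofReal (‖e ξ‖ ^ (2 * m + 2))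
        + ENNReal.ofReal ((B * (stepSize (l + 1) + ‖ξ (k - 1)‖)) ^ (2 * m + 2))))
        ∂(seqLaw (incr dx (l + 1))) := by
        refine lintegral_mono fun ξ => ?_
        have hρ : 0 ≤ B * (stepSize (l + 1) + ‖ξ (k - 1)‖) := by positivity
        refine (lintegral_euler_step hB m hρ (a := e ξ) (u := U ξ) (v := V ξ) ?_).trans ?_
        · have : U ξ - V ξ = e ξ + (M.interp l x' ξ k - V ξ) := by simp only [he, hU]; abel
          rw [this]
          exact (norm_add_le _ _).trans (by gcongr; exact norm_interp_sub_le hB x' ξ k)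
        · rw [← ENNReal.ofReal_add (by positivity) (by positivity),
            ← ENNReal.ofReal_mul (by positivity), ← ENNReal.ofReal_add (by positivity) (by positivity)]
    _ = ∫⁻ ξ, ENNReal.ofReal (‖e ξ‖ ^ (2 * m + 2)) ∂(seqLaw (incr dx (l + 1)))
        + ENNReal.ofReal (stepSize (l + 1) * growth dx B m) *
        (∫⁻ ξ, ENNReal.ofReal (‖e ξ‖ ^ (2 * m + 2)) ∂(seqLaw (incr dx (l + 1)))
        + ∫⁻ ξ, ENNReal.ofReal ((B * (stepSize (l + 1) + ‖ξ (k - 1)‖)) ^ (2 * m + 2))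
          ∂(seqLaw (incr dx (l + 1)))) := by
        rw [lintegral_add_left m1, lintegral_const_mul' _ _ ENNReal.ofReal_ne_top,
          lintegral_add_left m1]
    _ ≤ _ := by
        gcongr
        exact lintegral_osc_le (l + 1) (k - 1) (2 * m + 2)

/-- The strong error `Δ_l ^ (1 / 2)`. -/
def strongErr (l : ℕ) : ℝ≥0 := (Real.sqrt (stepSize (l + 1))).toNNReal

lemma coe_strongErr (l : ℕ) : (strongErr l : ℝ) = Real.sqrt (stepSize (l + 1)) :=
  Real.coe_toNNReal _ (Real.sqrt_nonneg _)

variable (dx) in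
/-- Moment constants of the strong error. -/
def eulerC (B : ℝ≥0) (m : ℕ) : ℝ :=
  2 ^ (2 * m + 2) * (Real.exp (growth dx B m) * (1 + growth dx B m * oscC dx B (2 * m + 2))
    + oscC dx B (2 * m + 2))

/-- Strong error of the coupled Euler schemes. -/
lemma lintegral_eulerChain_sub_coarseChain_le (hB : M.Bounds B) (m : ℕ) (x x' : Vec dx) {k : ℕ}
    (hk : k ≤ 2 ^ (l + 1)) :
    ∫⁻ ξ, ENNReal.ofReal (‖M.eulerChain (l + 1) x ξ k - M.coarseChain l x' ξ (k / 2)‖ ^ (2 * m + 2))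
        ∂(seqLaw (incr dx (l + 1))) ≤
      ENNReal.ofReal (eulerC dx B m) * ((nndist x x' + strongErr l : ℝ≥0) : ℝ≥0∞) ^ (2 * m + 2) := by
  set n := 2 * m + 2 with hn
  have hgr := growth_nonneg (dx := dx) B m
  have hos := oscC_nonneg (dx := dx) (B := B) n
  have hp := (stepSize_pos (l + 1)).le
  set A : ℕ → ℝ≥0∞ := fun k =>
    ∫⁻ ξ, ENNReal.ofReal (‖M.eulerChain (l + 1) x ξ k - M.interp l x' ξ k‖ ^ n)
        ∂(seqLaw (incr dx (l + 1))) with hA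
  set R := ENNReal.ofReal (oscC dx B n * Real.sqrt (stepSize (l + 1)) ^ n) with hR
  set q := ENNReal.ofReal (stepSize (l + 1) * growth dx B m) with hq
  have hrec := le_of_affine_recursion (A := A) (q := q) (R := R)
    (fun k => lintegral_error_succ_le hB m x x' k) k
  set ρ : ℝ≥0 := nndist x x' + strongErr l with hρ
  have hA0 : A 0 ≤ (ρ : ℝ≥0∞) ^ n := by
    have e : ∀ ξ, ENNReal.ofReal (‖M.eulerChain (l + 1) x ξ 0 - M.interp l x' ξ 0‖ ^ n)
        = (nndist x x' : ℝ≥0∞) ^ n := by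
      intro ξ
      have : M.interp l x' ξ 0 = x' := by
        simp [interp, coarseChain, eulerChain]
      rw [this, eulerChain, ENNReal.ofReal_pow (norm_nonneg _), ← dist_eq_norm, ← coe_nndist,
        ENNReal.ofReal_coe_nnreal]
    simp only [hA, e, lintegral_const, measure_univ, mul_one]
    gcongr
    exact le_self_add
  have hRρ : R ≤ ENNReal.ofReal (oscC dx B n) * (ρ : ℝ≥0∞) ^ n := by
    rw [hR, ENNReal.ofReal_mul hos, ENNReal.ofReal_pow (Real.sqrt_nonneg _)]
    exact mul_le_mul' le_rfl (pow_le_pow_left' (ENNReal.coe_le_coe.2 le_add_self) n)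
  have hk' : (k : ℝ) * (stepSize (l + 1) * growth dx B m) ≤ growth dx B m := by
    have h1 : (k : ℝ) ≤ 2 ^ (l + 1) := by exact_mod_cast hk
    calc (k : ℝ) * (stepSize (l + 1) * growth dx B m)
        ≤ 2 ^ (l + 1) * (stepSize (l + 1) * growth dx B m) := by gcongr
      _ = (stepSize (l + 1) * 2 ^ (l + 1)) * growth dx B m := by ring
      _ = _ := by rw [stepSize_mul, one_mul]
  have hkq : (k : ℝ≥0∞) * q ≤ ENNReal.ofReal (growth dx B m) := by
    rw [hq, ← ENNReal.ofReal_natCast, ← ENNReal.ofReal_mul (Nat.cast_nonneg k)]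
    exact ENNReal.ofReal_le_ofReal hk'
  -- There are at most 2^(l+1) steps of size 2^(-(l+1)), so the growth factor is bounded
  -- independently of the level.
  have hexp : (1 + q) ^ k ≤ ENNReal.ofReal (Real.exp (growth dx B m)) := by
    rw [hq, ← ENNReal.ofReal_one, ← ENNReal.ofReal_add zero_le_one (by positivity),
      ← ENNReal.ofReal_pow (by positivity)]
    refine ENNReal.ofReal_le_ofReal ?_
    calc (1 + stepSize (l + 1) * growth dx B m) ^ k
        ≤ Real.exp (stepSize (l + 1) * growth dx B m) ^ k := by
          gcongr
          rw [add_comm]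
          exact Real.add_one_le_exp _
      _ = Real.exp (k * (stepSize (l + 1) * growth dx B m)) := (Real.exp_nat_mul _ _).symm
      _ ≤ _ := Real.exp_le_exp.2 hk'
  have hAk : A k ≤ ENNReal.ofReal (Real.exp (growth dx B m)) *
      ((ρ : ℝ≥0∞) ^ n + ENNReal.ofReal (growth dx B m) *
        (ENNReal.ofReal (oscC dx B n) * (ρ : ℝ≥0∞) ^ n)) := by
    refine hrec.trans ?_
    gcongr
  have hem : Measurable fun ξ => M.eulerChain (l + 1) x ξ k - M.interp l x' ξ k :=
    (measurable_eulerChain hB (l + 1) k measurable_const measurable_pi_apply).sub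
      (measurable_interp hB l k x')
  calc _ ≤ ∫⁻ ξ, ENNReal.ofReal (2 ^ n) * (ENNReal.ofReal
          (‖M.eulerChain (l + 1) x ξ k - M.interp l x' ξ k‖ ^ n)
          + ENNReal.ofReal ((B * (stepSize (l + 1) + ‖ξ (k - 1)‖)) ^ n))
        ∂(seqLaw (incr dx (l + 1))) := by
        refine lintegral_mono fun ξ => ?_
        have hρ0 : 0 ≤ B * (stepSize (l + 1) + ‖ξ (k - 1)‖) := by positivity
        rw [← ENNReal.ofReal_add (by positivity) (by positivity),
          ← ENNReal.ofReal_mul (by positivity)]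
        refine ENNReal.ofReal_le_ofReal ?_
        refine le_trans ?_ (add_pow_le_two_pow_mul (norm_nonneg _) hρ0 n)
        gcongr
        have : M.eulerChain (l + 1) x ξ k - M.coarseChain l x' ξ (k / 2) =
          (M.eulerChain (l + 1) x ξ k - M.interp l x' ξ k)
            + (M.interp l x' ξ k - M.coarseChain l x' ξ (k / 2)) := by abel
        rw [this]
        exact (norm_add_le _ _).trans (by gcongr; exact norm_interp_sub_le hB x' ξ k)
    _ = ENNReal.ofReal (2 ^ n) * (A k + ∫⁻ ξ, ENNReal.ofReal
          ((B * (stepSize (l + 1) + ‖ξ (k - 1)‖)) ^ n) ∂(seqLaw (incr dx (l + 1)))) := by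
        rw [lintegral_const_mul' _ _ ENNReal.ofReal_ne_top,
          lintegral_add_left (hem.norm.pow_const n).ennreal_ofReal]
    _ ≤ ENNReal.ofReal (2 ^ n) * (ENNReal.ofReal (Real.exp (growth dx B m)) *
      ((ρ : ℝ≥0∞) ^ n + ENNReal.ofReal (growth dx B m) *
        (ENNReal.ofReal (oscC dx B n) * (ρ : ℝ≥0∞) ^ n))
        + ENNReal.ofReal (oscC dx B n) * (ρ : ℝ≥0∞) ^ n) := by
        gcongr
        exact (lintegral_osc_le (l + 1) (k - 1) n).trans hRρ
    _ = _ := by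
        rw [eulerC, ENNReal.ofReal_mul (by positivity), ENNReal.ofReal_add (by positivity) hos,
          ENNReal.ofReal_mul (Real.exp_pos _).le, ENNReal.ofReal_add zero_le_one (by positivity),
          ENNReal.ofReal_mul hgr, ENNReal.ofReal_one]
        ring

end FilterModel

end EulerError

end CoupledPF

namespace CoupledPF

/-! ### The coupled Euler schemes as a coupled system -/

section Restriction

variable {Y : Type*} [MeasurableSpace Y] (ν : Measure Y) [IsProbabilityMeasure ν]

lemma measurePreserving_seqLaw_pi (m : ℕ) :
    MeasurePreserving (fun (y : ℕ → Y) (i : Fin m) => y i) (seqLaw ν) (Measure.pi fun _ => ν) := by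
  refine ⟨by fun_prop, ?_⟩
  rw [← Measure.infinitePi_eq_pi]
  exact Measure.map_infinitePi_infinitePi_of_inj (P := fun _ : ℕ => ν)
    (f := fun i : Fin m => (i : ℕ)) Fin.val_injective

lemma LO.scale {Ω : Type*} [MeasurableSpace Ω] {μ : Measure Ω} {f : Ω → ℝ} {ε : ℝ≥0}
    {C : ℕ → ℝ≥0} {c : ℝ≥0} (h : LO μ f (c * ε) C) : LO μ f ε (fun r => c ^ r * C r) where
  meas := h.meas
  bound r := (h.bound r).trans (le_of_eq (by push_cast; ring))

end Restriction

namespace FilterModel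

variable {dx dy : ℕ} (M : FilterModel dx dy) {B : ℝ≥0} {l : ℕ}

/-- The pair of Euler paths started at `x` and `x'` and driven by the fine increments `ξ`. -/
def pairPath (l : ℕ) (x x' : Vec dx) (ξ : Fin (2 ^ (l + 1)) → Vec dx) : PathPair dx l :=
  (fun k => M.eulerChain (l + 1) x (extendZero ξ) k, fun k => M.coarseChain l x' (extendZero ξ) k)

/-- The index of the last coarse grid time before a fine one. -/
def half (k : Fin (2 ^ (l + 1))) : Fin (2 ^ l + 1) :=
  ⟨k / 2, by have h := k.2; have := pow_succ 2 l; lia⟩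

/-- The values of `h` along the two paths of a pair, at the fine grid times. -/
def obs (s : Bool) (z : PathPair dx l) (k : Fin (2 ^ (l + 1))) : Vec dy :=
  match s with
  | true => M.h (z.1 k.castSucc)
  | false => M.h (z.2 (half k))

/-- The endpoints of the two paths of a pair. -/
def endpoint (s : Bool) (z : PathPair dx l) : Vec dx :=
  match s with
  | true => z.1 (Fin.last _)
  | false => z.2 (Fin.last _)

/-- The quadratic mean distance of the two paths of a pair. -/
def pathGap (z : PathPair dx l) : ℝ :=
  Real.sqrt (stepSize (l + 1) * ∑ k : Fin (2 ^ (l + 1)),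
    ‖z.1 k.castSucc - z.2 (half k)‖ ^ 2)

/-- A distance of the two paths of a pair. -/
def pathDist (B : ℝ≥0) (z : PathPair dx l) : ℝ≥0 :=
  -- One factor `B` is the Lipschitz constant of `h`, the other comes from `expWeight_sub_lo`. The
  -- strong error is included because the distance must dominate ε.
  ‖z.1 (Fin.last _) - z.2 (Fin.last _)‖₊ + B * B * (pathGap z).toNNReal + strongErr l

variable {M}

lemma coupledEuler_eq (x x' : Vec dx) :
    M.coupledEuler l x x' = (incrementLaw dx (l + 1)).map (M.pairPath l x x') := rfl

lemma measurable_extendZero {d m : ℕ} (k : ℕ) :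
    Measurable fun ξ : Fin m → Vec d => extendZero ξ k := by
  unfold extendZero
  split_ifs
  · exact measurable_pi_apply _
  · exact measurable_const

lemma measurable_pairPath (hB : M.Bounds B) {Ω : Type*} [MeasurableSpace Ω] {x x' : Ω → Vec dx}
    {ξ : Ω → Fin (2 ^ (l + 1)) → Vec dx} (hx : Measurable x) (hx' : Measurable x')
    (hξ : Measurable ξ) : Measurable fun ω => M.pairPath l (x ω) (x' ω) (ξ ω) := by
  have h : ∀ i, Measurable fun ω => extendZero (ξ ω) i := fun i => (measurable_extendZero i).comp hξ
  have h1 : Measurable fun ω (k : Fin (2 ^ (l + 1) + 1)) =>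
      M.eulerChain (l + 1) (x ω) (extendZero (ξ ω)) k :=
    measurable_pi_lambda _ fun k => measurable_eulerChain hB (l + 1) k hx h
  have h2 : Measurable fun ω (k : Fin (2 ^ l + 1)) =>
      M.coarseChain l (x' ω) (extendZero (ξ ω)) k :=
    measurable_pi_lambda _ fun k => measurable_coarseChain hB l k hx' h
  exact h1.prodMk h2

lemma measurable_pairPath_right (hB : M.Bounds B) (x x' : Vec dx) :
    Measurable (M.pairPath l x x') :=
  measurable_pairPath hB measurable_const measurable_const measurable_id

lemma measurable_fine (k : Fin (2 ^ (l + 1) + 1)) : Measurable fun z : PathPair dx l => z.1 k :=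
  (measurable_pi_apply k).comp measurable_fst

lemma measurable_coarse (k : Fin (2 ^ l + 1)) : Measurable fun z : PathPair dx l => z.2 k :=
  (measurable_pi_apply k).comp measurable_snd

lemma measurable_obs (hB : M.Bounds B) (s : Bool) :
    Measurable (M.obs s : PathPair dx l → _) := by
  refine measurable_pi_lambda _ fun k => ?_
  cases s
  · exact hB.measurable_h.comp (measurable_coarse (half k))
  · exact hB.measurable_h.comp (measurable_fine k.castSucc)

lemma measurable_endpoint (s : Bool) : Measurable (endpoint s : PathPair dx l → Vec dx) := by
  cases s
  · exact measurable_coarse _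
  · exact measurable_fine _

lemma measurable_pathGap : Measurable (pathGap : PathPair dx l → ℝ) := by
  unfold pathGap
  refine (Measurable.const_mul (Finset.measurable_sum _ fun k _ => ?_) _).sqrt
  exact ((measurable_fine _).sub (measurable_coarse _)).norm.pow_const 2

lemma measurable_pathDist : Measurable (pathDist B : PathPair dx l → ℝ≥0) := by
  have h : Measurable fun z : PathPair dx l => ‖z.1 (Fin.last _) - z.2 (Fin.last _)‖₊ :=
    ((measurable_fine _).sub (measurable_coarse _)).nnnorm
  exact (h.add (measurable_pathGap.real_toNNReal.const_mul _)).add measurable_const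

lemma norm_obs_le (hB : M.Bounds B) (s : Bool) (z : PathPair dx l) (k : Fin (2 ^ (l + 1))) :
    ‖M.obs s z k‖ ≤ B := by
  cases s <;> exact hB.h_bdd _

lemma isProbabilityMeasure_coupledEuler (hB : M.Bounds B) (x x' : Vec dx) :
    IsProbabilityMeasure (M.coupledEuler l x x') :=
  Measure.isProbabilityMeasure_map (measurable_pairPath_right hB x x').aemeasurable

/-- The coupled Euler transition as a Markov kernel. -/
def pathKernel (hB : M.Bounds B) (l : ℕ) : Kernel (Vec dx × Vec dx) (PathPair dx l) where
  toFun x := M.coupledEuler l x.1 x.2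
  measurable' := by
    have hf : Measurable fun q : (Vec dx × Vec dx) × (Fin (2 ^ (l + 1)) → Vec dx) =>
        M.pairPath l q.1.1 q.1.2 q.2 :=
      measurable_pairPath hB (measurable_fst.comp measurable_fst)
        (measurable_snd.comp measurable_fst) measurable_snd
    have h : (fun x : Vec dx × Vec dx => M.coupledEuler l x.1 x.2) = fun x =>
        ((incrementLaw dx (l + 1)).map (Prod.mk x)).map
          fun q : (Vec dx × Vec dx) × (Fin (2 ^ (l + 1)) → Vec dx) =>
            M.pairPath l q.1.1 q.1.2 q.2 := by
      funext x
      rw [Measure.map_map hf measurable_prodMk_left]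
      rfl
    rw [h]
    exact (Measure.measurable_map _ hf).comp Measurable.map_prodMk_left

instance (hB : M.Bounds B) : IsMarkovKernel (pathKernel hB l) :=
  ⟨fun x => isProbabilityMeasure_coupledEuler hB x.1 x.2⟩

lemma abs_linForm_le {d m : ℕ} {H y : Fin m → Vec d} (hH : ∀ k, ‖H k‖ ≤ B) :
    |linForm H y| ≤ ∑ k, B * ‖y k‖ := by
  refine (Finset.abs_sum_le_sum_abs _ _).trans (Finset.sum_le_sum fun k _ => ?_)
  exact (abs_real_inner_le_norm _ _).trans (by gcongr; exact hH k)

/-- For fixed data, a positive lower bound that is uniform over paths whose observations are bounded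
by `B`. It depends on the data and the number of grid points, and is used qualitatively only. -/
lemma le_expWeight {d l : ℕ} {H : Fin (2 ^ l) → Vec d} (hH : ∀ k, ‖H k‖ ≤ B)
    (y : Fin (2 ^ l) → Vec d) :
    Real.exp (-(∑ k, B * ‖y k‖) - B ^ 2) ≤ expWeight H y := by
  have h1 := abs_le.1 (abs_linForm_le (y := y) hH)
  have h2 := sum_sq_le hH
  have h3 : 0 ≤ (B : ℝ) ^ 2 := by positivity
  refine Real.exp_le_exp.2 ?_
  linarith

lemma expWeight_le {d l : ℕ} {H : Fin (2 ^ l) → Vec d} (hH : ∀ k, ‖H k‖ ≤ B)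
    (y : Fin (2 ^ l) → Vec d) :
    expWeight H y ≤ Real.exp (∑ k, B * ‖y k‖) := by
  have h1 := abs_le.1 (abs_linForm_le (y := y) hH)
  have h2 : 0 ≤ stepSize l / 2 * ∑ k, ‖H k‖ ^ 2 := by have := (stepSize_pos l).le; positivity
  refine Real.exp_le_exp.2 ?_
  linarith

lemma measurable_expWeight_obs (hB : M.Bounds B) (s : Bool) :
    Measurable fun q : PathPair dx l × (Fin (2 ^ (l + 1)) → Vec dy) =>
      expWeight (M.obs s q.1) q.2 := by
  have h := measurable_expWeight.comp (((measurable_obs hB s).comp measurable_fst).prodMk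
    (measurable_snd (α := PathPair dx l) (β := Fin (2 ^ (l + 1)) → Vec dy)))
  simp only [Function.comp_def] at h
  exact h

lemma map_coupledEuler_side (hB : M.Bounds B) (s : Bool) {x x' : Vec dx × Vec dx}
    (h : side s x = side s x') (y : Fin (2 ^ (l + 1)) → Vec dy) :
    (M.coupledEuler l x.1 x.2).map (fun z => (expWeight (M.obs s z) y, endpoint s z)) =
      (M.coupledEuler l x'.1 x'.2).map (fun z => (expWeight (M.obs s z) y, endpoint s z)) := by
  have hm : Measurable fun z : PathPair dx l => (expWeight (M.obs s z) y, endpoint s z) :=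
    ((measurable_expWeight_obs hB s).comp measurable_prodMk_right).prodMk (measurable_endpoint s)
  rw [coupledEuler_eq, coupledEuler_eq, Measure.map_map hm (measurable_pairPath_right hB _ _),
    Measure.map_map hm (measurable_pairPath_right hB _ _)]
  congr 1
  funext ξ
  cases s
  · have : x.2 = x'.2 := h
    simp only [Function.comp_apply, endpoint, pairPath, this]
    rfl
  · have : x.1 = x'.1 := h
    simp only [Function.comp_apply, endpoint, pairPath, this]
    rfl

/-- The coupled Euler schemes, as a coupled system. -/
def system (hB : M.Bounds B) (l : ℕ) :
    CoupledSystem (Vec dx) (PathPair dx l) (Fin (2 ^ (l + 1)) → Vec dy) where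
  ν := incrementLaw dy (l + 1)
  g s z y := expWeight (M.obs s z) y
  e := endpoint
  K := pathKernel hB l
  x0 := M.x0
  z0 := 0
  d := nndist
  D := pathDist B
  ε := strongErr l
  isProb := inferInstance
  isMarkov := inferInstance
  measurable_g s := measurable_expWeight_obs hB s
  measurable_e := measurable_endpoint
  measurable_D := measurable_pathDist
  d_self := nndist_self _
  g_lower s y := ⟨_, Real.exp_pos _, fun z => le_expWeight (norm_obs_le hB s z) y⟩
  g_upper s y := ⟨_, fun z => expWeight_le (norm_obs_le hB s z) y⟩
  marginal s _ _ h y := map_coupledEuler_side hB s h y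

variable (dx) in
/-- Moment constants of the distance of the two chains. -/
def eulerMom (B : ℝ≥0) : ℕ → ℝ≥0
  | 0 => 1
  | m + 1 => (eulerC dx B m).toNNReal

lemma lintegral_enorm_eulerChain_sub_le (hB : M.Bounds B) (x x' : Vec dx) {k : ℕ}
    (hk : k ≤ 2 ^ (l + 1)) (m : ℕ) :
    ∫⁻ ξ, ‖M.eulerChain (l + 1) x ξ k - M.coarseChain l x' ξ (k / 2)‖ₑ ^ (2 * m)
        ∂(seqLaw (incr dx (l + 1))) ≤
      eulerMom dx B m * ((nndist x x' + strongErr l : ℝ≥0) : ℝ≥0∞) ^ (2 * m) := by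
  cases m with
  | zero => simp [eulerMom]
  | succ m =>
    have h := lintegral_eulerChain_sub_coarseChain_le hB m x x' hk
    simp only [ENNReal.ofReal_pow (norm_nonneg _), ofReal_norm] at h
    exact h

lemma pathGap_sq (z : PathPair dx l) : pathGap z ^ 2 = stepSize (l + 1) * ∑ k : Fin (2 ^ (l + 1)),
    ‖z.1 k.castSucc - z.2 (half k)‖ ^ 2 :=
  Real.sq_sqrt (mul_nonneg (stepSize_pos _).le (Finset.sum_nonneg fun _ _ => by positivity))

lemma pathGap_nonneg (z : PathPair dx l) : 0 ≤ pathGap z := Real.sqrt_nonneg _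

/-- Power mean inequality: the 2^(l+1) weights `stepSize (l + 1)` sum to one. -/
lemma pathGap_pow_le (z : PathPair dx l) (m : ℕ) :
    pathGap z ^ (2 * m) ≤ ∑ k : Fin (2 ^ (l + 1)), stepSize (l + 1) *
      ‖z.1 k.castSucc - z.2 (half k)‖ ^ (2 * m) := by
  have h := Real.pow_arith_mean_le_arith_mean_pow (Finset.univ : Finset (Fin (2 ^ (l + 1))))
    (fun _ => stepSize (l + 1)) (fun k => ‖z.1 k.castSucc
      - z.2 (half k)‖ ^ 2)
    (fun _ _ => (stepSize_pos _).le) (by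
      rw [Finset.sum_const, Finset.card_univ, Fintype.card_fin, nsmul_eq_mul, mul_comm]
      exact_mod_cast stepSize_mul (l + 1)) (fun _ _ => by positivity) m
  rw [pow_mul, pathGap_sq, Finset.mul_sum]
  simpa only [← pow_mul] using h

lemma extendZero_restrict {d m : ℕ} (ξ : ℕ → Vec d) {i : ℕ} (hi : i < m) :
    extendZero (fun j : Fin m => ξ j) i = ξ i := by
  rw [extendZero, dif_pos hi]

lemma pairPath_restrict_fst (x x' : Vec dx) (ξ : ℕ → Vec dx) (k : Fin (2 ^ (l + 1) + 1)) :
    (M.pairPath l x x' fun i => ξ i).1 k = M.eulerChain (l + 1) x ξ k :=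
  eulerChain_congr fun _ hi => extendZero_restrict ξ (by lia)

lemma pairPath_restrict_snd (x x' : Vec dx) (ξ : ℕ → Vec dx) (k : Fin (2 ^ l + 1)) :
    (M.pairPath l x x' fun i => ξ i).2 k = M.coarseChain l x' ξ k :=
  coarseChain_congr fun _ hi => extendZero_restrict ξ (by have := pow_succ 2 l; lia)

lemma lo_norm_end (hB : M.Bounds B) (x x' : Vec dx) :
    LO (seqLaw (incr dx (l + 1))) (fun ξ =>
      ‖M.eulerChain (l + 1) x ξ (2 ^ (l + 1)) - M.coarseChain l x' ξ (2 ^ l)‖)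
      (nndist x x' + strongErr l) (fun r => eulerMom dx B r + 1) := by
  refine LO.of_even ?_ fun m => ?_
  · exact ((measurable_eulerChain hB (l + 1) _ measurable_const measurable_pi_apply).sub
      (measurable_coarseChain hB l _ measurable_const measurable_pi_apply)).norm
  · have h := lintegral_enorm_eulerChain_sub_le hB x x' (l := l) (le_refl (2 ^ (l + 1))) m
    have e : 2 ^ (l + 1) / 2 = 2 ^ l := by have := pow_succ 2 l; lia
    rw [e] at h
    simpa only [enorm_norm] using h

lemma lo_pathGap (hB : M.Bounds B) (x x' : Vec dx) :
    LO (seqLaw (incr dx (l + 1))) (fun ξ => pathGap (M.pairPath l x x' fun i => ξ i))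
      (nndist x x' + strongErr l) (fun r => eulerMom dx B r + 1) := by
  have hz : Measurable fun ξ : ℕ → Vec dx => M.pairPath l x x' fun i => ξ i :=
    measurable_pairPath hB measurable_const measurable_const
      (measurable_pi_lambda _ fun i => measurable_pi_apply _)
  refine LO.of_even (measurable_pathGap.comp hz) fun m => ?_
  have hp := (stepSize_pos (l + 1)).le
  have hm : ∀ k : Fin (2 ^ (l + 1)), Measurable fun ξ : ℕ → Vec dx =>
      ‖M.eulerChain (l + 1) x ξ k - M.coarseChain l x' ξ (k / 2)‖ₑ ^ (2 * m) := fun k =>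
    ((measurable_eulerChain hB (l + 1) _ measurable_const measurable_pi_apply).sub
      (measurable_coarseChain hB l _ measurable_const measurable_pi_apply)).enorm.pow_const _
  calc ∫⁻ ξ, ‖pathGap (M.pairPath l x x' fun i => ξ i)‖ₑ ^ (2 * m) ∂(seqLaw (incr dx (l + 1)))
      ≤ ∫⁻ ξ, ∑ k : Fin (2 ^ (l + 1)), ENNReal.ofReal (stepSize (l + 1)) *
          ‖M.eulerChain (l + 1) x ξ k - M.coarseChain l x' ξ (k / 2)‖ₑ ^ (2 * m)
          ∂(seqLaw (incr dx (l + 1))) := by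
        refine lintegral_mono fun ξ => ?_
        have h := pathGap_pow_le (M.pairPath l x x' fun i => ξ i) m
        simp only [pairPath_restrict_fst, pairPath_restrict_snd] at h
        rw [← ofReal_norm, Real.norm_eq_abs, abs_of_nonneg (pathGap_nonneg _),
          ← ENNReal.ofReal_pow (pathGap_nonneg _)]
        refine (ENNReal.ofReal_le_ofReal h).trans (le_of_eq ?_)
        rw [ENNReal.ofReal_sum_of_nonneg fun k _ => by positivity]
        refine Finset.sum_congr rfl fun k _ => ?_
        rw [ENNReal.ofReal_mul hp, ENNReal.ofReal_pow (norm_nonneg _), ofReal_norm]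
        rfl
    _ = ∑ k : Fin (2 ^ (l + 1)), ENNReal.ofReal (stepSize (l + 1)) *
          ∫⁻ ξ, ‖M.eulerChain (l + 1) x ξ k - M.coarseChain l x' ξ (k / 2)‖ₑ ^ (2 * m)
          ∂(seqLaw (incr dx (l + 1))) := by
        rw [lintegral_finsetSum _ fun k _ => (hm k).const_mul _]
        simp only [lintegral_const_mul' _ _ ENNReal.ofReal_ne_top]
    _ ≤ ∑ k : Fin (2 ^ (l + 1)), ENNReal.ofReal (stepSize (l + 1)) *
          (eulerMom dx B m * ((nndist x x' + strongErr l : ℝ≥0) : ℝ≥0∞) ^ (2 * m)) := by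
        gcongr with k
        exact lintegral_enorm_eulerChain_sub_le hB x x' k.2.le m
    _ = _ := by
        rw [Finset.sum_const, Finset.card_univ, Fintype.card_fin, nsmul_eq_mul, ← mul_assoc]
        have h : ((2 ^ (l + 1) : ℕ) : ℝ≥0∞) * ENNReal.ofReal (stepSize (l + 1)) = 1 := by
          rw [← ENNReal.ofReal_natCast, ← ENNReal.ofReal_mul (by positivity), mul_comm]
          push_cast
          rw [stepSize_mul, ENNReal.ofReal_one]
        rw [h, one_mul]

variable (dx) in
/-- Moment constants of `pathDist`. -/
def distC (B : ℝ≥0) : ℕ → ℝ≥0 :=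
  addC (addC (fun r => eulerMom dx B r + 1) fun r => (B * B) ^ r * (mulC (fun _ => 1)
    fun r => eulerMom dx B r + 1) r) fun _ => 1

lemma lintegral_pathDist_le (hB : M.Bounds B) (x x' : Vec dx) (r : ℕ) :
    ∫⁻ z, (pathDist B z : ℝ≥0∞) ^ r ∂(M.coupledEuler l x x') ≤
      distC dx B r * ((nndist x x' + strongErr l : ℝ≥0) : ℝ≥0∞) ^ r := by
  have hD : Measurable fun z : PathPair dx l => (pathDist B z : ℝ≥0∞) ^ r :=
    measurable_pathDist.coe_nnreal_ennreal.pow_const r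
  have h1 := lo_norm_end hB x x' (l := l)
  have h2 := ((LO.const (μ := seqLaw (incr dx (l + 1))) (ε := B * B) ((B : ℝ) * B)
    (by rw [abs_of_nonneg (by positivity)]; simp)).mul (lo_pathGap hB x x' (l := l))).scale
  have h3 := (LO.const (μ := seqLaw (incr dx (l + 1))) (ε := nndist x x' + strongErr l)
    (strongErr l : ℝ) (by rw [abs_of_nonneg (by positivity)]; push_cast; simp))
  have h := ((h1.add h2).add h3).bound r
  rw [coupledEuler_eq, lintegral_map hD (measurable_pairPath_right hB x x'), incrementLaw_eq,
    ← (measurePreserving_seqLaw_pi (incr dx (l + 1)) (2 ^ (l + 1))).lintegral_comp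
      (f := fun ξ => (pathDist B (M.pairPath l x x' ξ) : ℝ≥0∞) ^ r)
      (hD.comp (measurable_pairPath_right hB x x'))]
  refine le_trans (le_of_eq (lintegral_congr fun ξ => ?_)) h
  congr 1
  have e : ((pathDist B (M.pairPath l x x' fun i => ξ i) : ℝ≥0) : ℝ) =
      ‖M.eulerChain (l + 1) x ξ (2 ^ (l + 1)) - M.coarseChain l x' ξ (2 ^ l)‖
        + (B : ℝ) * B * pathGap (M.pairPath l x x' fun i => ξ i) + strongErr l := by
    rw [pathDist, pairPath_restrict_fst, pairPath_restrict_snd]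
    push_cast
    rw [Real.coe_toNNReal _ (pathGap_nonneg _)]
  rw [← e]
  simp

/-- Moment constants of the potentials. -/
def obsC (B : ℝ≥0) : ℕ → ℝ≥0 := mulC (addC gaussC fun _ => 1) (addC (potC B) (potC B))

variable (dx) in
/-- Moment constants of the coupled Euler schemes. -/
def systemC (B : ℝ≥0) (r : ℕ) : ℝ≥0 := potC B r + obsC B r + distC dx B r

lemma stepSize_mul_sum_obs_le (hB : M.Bounds B) (z : PathPair dx l) :
    stepSize (l + 1) * ∑ k, ‖M.obs true z k - M.obs false z k‖ ^ 2 ≤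
      ((B * (pathGap z).toNNReal : ℝ≥0) : ℝ) ^ 2 := by
  have hp := (stepSize_pos (l + 1)).le
  rw [NNReal.coe_mul, Real.coe_toNNReal _ (pathGap_nonneg z), mul_pow, pathGap_sq, ← mul_assoc,
    mul_comm _ (stepSize _), mul_assoc, Finset.mul_sum (a := (B : ℝ) ^ 2)]
  gcongr with k
  rw [← mul_pow]
  gcongr
  exact hB.h_lip _ _

/-- The constants depend on `dx` and `B` and not on the level; this is where uniformity in `l` comes
from. -/
lemma good_system (hB : M.Bounds B) (l : ℕ) : (system hB l).Good (systemC dx B) where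
  g_lo s z := (expWeight_lo (norm_obs_le hB s z)).mono_const fun r =>
    le_add_right (le_add_right le_rfl)
  inv_lo s z := (inv_expWeight_lo (norm_obs_le hB s z)).mono_const fun r =>
    le_add_right (le_add_right le_rfl)
  diff_lo z := ((expWeight_sub_lo hB.one_le (norm_obs_le hB true z) (norm_obs_le hB false z)
      (stepSize_mul_sum_obs_le hB z)).mono (le_add_right (le_add_left (le_of_eq
        (mul_assoc _ _ _).symm)))).mono_const fun r => le_add_right (le_add_left le_rfl)
  d_le z := by
    change nndist (z.1 (Fin.last _)) (z.2 (Fin.last _)) + strongErr l ≤ pathDist B z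
    rw [nndist_eq_nnnorm, pathDist]
    gcongr
    exact le_self_add
  eps_le_one := NNReal.coe_le_coe.1 (by
    change (strongErr l : ℝ) ≤ 1
    rw [coe_strongErr]; exact sqrt_stepSize_le_one)
  D_moment x r := (lintegral_pathDist_le hB x.1 x.2 r).trans (by
    gcongr
    · exact le_add_left le_rfl
    · exact le_rfl
    · exact le_rfl)

lemma nice_system (hB : M.Bounds B) (l p : ℕ) {φ : Vec dx → ℝ} (h1 : ∀ x, |φ x| ≤ 1)
    (h2 : ∀ x y, |φ x - φ y| ≤ ‖x - y‖) :
    (system hB l).Nice p (fun _ x _ => φ x) (fun _ => 1) where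
  meas s := by
    have hc : Continuous φ := (LipschitzWith.of_dist_le_mul (K := 1) fun x y => by
      rw [Real.dist_eq, dist_eq_norm, NNReal.coe_one, one_mul]; exact h2 x y).continuous
    exact hc.measurable.comp measurable_fst
  bdd s y := ⟨1, h1⟩
  lo s x := CLO.const _ (by simpa using h1 x)
  diff x x' := CLO.const _ ((h2 x x').trans (by
    change _ ≤ ((nndist x x' + strongErr l : ℝ≥0) : ℝ)
    push_cast
    rw [dist_eq_norm]
    simp))

end FilterModel

end CoupledPF

namespace CoupledPF

/-! ### Brownian increments as i.i.d. blocks -/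

section Increments

variable {d : ℕ}

/-- The increments of a path on the grid of mesh `Δ_L`. -/
def gridInc (L : ℕ) (y : ℝ≥0 → Vec d) (k : ℕ) : Vec d := y (gridTime L (k + 1)) - y (gridTime L k)

/-- The increments of a path on the grid of mesh `Δ_L`, grouped by unit time intervals. -/
def blocks (L : ℕ) (y : ℝ≥0 → Vec d) (p : ℕ) (k : Fin (2 ^ L)) : Vec d := gridInc L y (p * 2 ^ L + k)

lemma gridTime_mono (L : ℕ) : Monotone (gridTime L) := fun i j h => by
  unfold gridTime
  gcongr

lemma nndist_gridTime (L k : ℕ) :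
    nndist ((gridTime L (k + 1) : ℝ≥0) : ℝ) (gridTime L k : ℝ≥0) = (stepSize L).toNNReal := by
  refine NNReal.coe_injective ?_
  rw [coe_nndist, Real.coe_toNNReal _ (stepSize_pos L).le, Real.dist_eq]
  have h : ((gridTime L (k + 1) : ℝ≥0) : ℝ) - (gridTime L k : ℝ≥0) = stepSize L := by
    simp only [gridTime, stepSize]
    push_cast
    field_simp
    ring
  rw [h, abs_of_pos (stepSize_pos L)]

lemma incr_eq_map_pi (L : ℕ) :
    incr d L = (Measure.pi fun _ : Fin d => gaussianReal 0 (stepSize L).toNNReal).map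
      (WithLp.toLp 2) := by
  have hg : gaussianReal 0 (stepSize L).toNNReal =
      (gaussianReal 0 1).map (fun x => Real.sqrt (stepSize L) * x) := by
    rw [gaussianReal_map_const_mul]
    congr 1
    · simp
    · refine NNReal.coe_injective ?_
      simp [Real.sq_sqrt (stepSize_pos L).le, (stepSize_pos L).le]
  have hp : (Measure.pi fun _ : Fin d => gaussianReal 0 (stepSize L).toNNReal) =
      (Measure.pi fun _ : Fin d => gaussianReal 0 1).map
        fun x i => Real.sqrt (stepSize L) * x i := by
    rw [← Measure.infinitePi_eq_pi, ← Measure.infinitePi_eq_pi, Measure.infinitePi_map_pi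
      (fun _ : Fin d => gaussianReal 0 1) (f := fun _ x => Real.sqrt (stepSize L) * x)
      fun _ => by fun_prop]
    simp only [hg]
  rw [hp, incr, ← map_pi_eq_stdGaussian, Measure.map_map (by fun_prop) (by fun_prop),
    Measure.map_map (by fun_prop) (by fun_prop)]
  rfl

variable {Ω : Type*} [MeasurableSpace Ω] {P : Measure Ω} {B : ℝ≥0 → Ω → Vec d}

lemma IsBrownianVec.measurable_gridInc (hB : IsBrownianVec B P) (L : ℕ) :
    Measurable fun ω => gridInc L fun t => B t ω :=
  measurable_pi_lambda _ fun _ => (hB.measurable _).sub (hB.measurable _)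

lemma IsBrownianVec.measurable_blocks (hB : IsBrownianVec B P) (L : ℕ) :
    Measurable fun ω => blocks L fun t => B t ω :=
  measurable_pi_lambda _ fun _ => measurable_pi_lambda _ fun _ =>
    (hB.measurable _).sub (hB.measurable _)

/-- Independent increments in time for each coordinate, together with independence of the
coordinates as processes, give independence of the whole array. -/
lemma IsBrownianVec.iIndepFun_coord [IsProbabilityMeasure P] (hB : IsBrownianVec B P) (L : ℕ) :
    iIndepFun (fun (q : ℕ × Fin d) ω =>
      B (gridTime L (q.1 + 1)) ω q.2 - B (gridTime L q.1) ω q.2) P := by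
  have hm : ∀ (i : Fin d) t, Measurable fun ω => B t ω i := fun i t =>
    (by fun_prop : Measurable fun v : Vec d => v i).comp (hB.measurable t)
  have h1 := hB.indep.comp (fun _ (f : ℝ≥0 → ℝ) (k : ℕ) => f (gridTime L (k + 1)) - f (gridTime L k))
    fun _ => by fun_prop
  have h2 : ∀ i : Fin d, iIndepFun (fun (k : ℕ) ω =>
      B (gridTime L (k + 1)) ω i - B (gridTime L k) ω i) P := fun i =>
    (hB.brownian i).toIsPreBrownianReal.hasIndepIncrements.nat (gridTime_mono L)
  have h := iIndepFun_uncurry' (P := P) (X := fun (i : Fin d) (k : ℕ) ω =>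
    B (gridTime L (k + 1)) ω i - B (gridTime L k) ω i) (fun i k => (hm i _).sub (hm i _)) h1 h2
  exact h.precomp (g := Prod.swap) Prod.swap_injective

lemma IsBrownianVec.map_gridInc [IsProbabilityMeasure P] (hB : IsBrownianVec B P) (L : ℕ) :
    P.map (fun ω => gridInc L fun t => B t ω) = seqLaw (incr d L) := by
  have hm : ∀ (i : Fin d) t, Measurable fun ω => B t ω i := fun i t =>
    (by fun_prop : Measurable fun v : Vec d => v i).comp (hB.measurable t)
  have hmp : ∀ q : ℕ × Fin d, Measurable fun ω =>
      B (gridTime L (q.1 + 1)) ω q.2 - B (gridTime L q.1) ω q.2 := fun q => (hm _ _).sub (hm _ _)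
  have h1 := (hB.iIndepFun_coord L).map_fun_eq_infinitePi_map hmp
  have h2 : ∀ q : ℕ × Fin d, P.map (fun ω =>
      B (gridTime L (q.1 + 1)) ω q.2 - B (gridTime L q.1) ω q.2) =
        gaussianReal 0 (stepSize L).toNNReal := fun q => by
    have := ((hB.brownian q.2).toIsPreBrownianReal.hasLaw_sub
      (gridTime L (q.1 + 1)) (gridTime L q.1)).map_eq
    rw [← nndist_gridTime L q.1]
    exact this
  simp only [h2] at h1
  have h3 := Measure.infinitePi_map_curry (ι := ℕ) (κ := Fin d)
    (fun _ _ => gaussianReal 0 (stepSize L).toNNReal)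
  have h4 := Measure.infinitePi_map_pi (fun _ : ℕ => Measure.infinitePi fun _ : Fin d =>
    gaussianReal 0 (stepSize L).toNNReal) (f := fun _ => WithLp.toLp 2) fun _ => by fun_prop
  rw [← h3, ← h1, Measure.map_map (MeasurableEquiv.measurable _) (measurable_pi_lambda _ hmp),
    Measure.map_map (by fun_prop) ((MeasurableEquiv.measurable _).comp
      (measurable_pi_lambda _ hmp))] at h4
  simp only [Measure.infinitePi_eq_pi, ← incr_eq_map_pi] at h4
  rw [seqLaw, ← h4]
  rfl

/-- Euclidean division makes the pairs (block, position) distinct indices, so regrouping an i.i.d.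
sequence gives i.i.d. blocks. -/
lemma map_reshape (ν : Measure (Vec d)) [IsProbabilityMeasure ν] (m : ℕ) :
    (seqLaw ν).map (fun y (p : ℕ) (k : Fin m) => y (p * m + k)) =
      seqLaw (Measure.pi fun _ : Fin m => ν) := by
  have hinj : Function.Injective fun q : ℕ × Fin m => q.1 * m + (q.2 : ℕ) := by
    rintro ⟨p, k⟩ ⟨p', k'⟩ h
    simp only at h
    have hm : 0 < m := k.pos
    have e1 : p = p' := by
      have := congrArg (· / m) h
      simpa [Nat.add_div_of_dvd_right, mul_comm _ m, Nat.mul_add_div hm,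
        Nat.div_eq_of_lt k.2, Nat.div_eq_of_lt k'.2] using this
    subst e1
    have e2 : k = k' := Fin.ext (by lia)
    rw [e2]
  have h1 := Measure.map_infinitePi_infinitePi_of_inj (P := fun _ : ℕ => ν) hinj
  have h2 := Measure.infinitePi_map_curry (ι := ℕ) (κ := Fin m) (fun _ _ => ν)
  rw [← h1, Measure.map_map (MeasurableEquiv.measurable _) (by fun_prop)] at h2
  simp only [Measure.infinitePi_eq_pi] at h2
  rw [seqLaw, seqLaw, ← h2]
  rfl

lemma IsBrownianVec.map_blocks [IsProbabilityMeasure P] (hB : IsBrownianVec B P) (L : ℕ) :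
    P.map (fun ω => blocks L fun t => B t ω) = seqLaw (incrementLaw d L) := by
  rw [incrementLaw_eq, ← map_reshape, ← hB.map_gridInc L,
    Measure.map_map (by fun_prop) (hB.measurable_gridInc L)]
  rfl

end Increments

/-! ### Conditional expectation given the data -/

section Conditioning

variable {Ω A E : Type*} [MeasurableSpace Ω] {P : Measure Ω} [IsProbabilityMeasure P]
  [MeasurableSpace A] [MeasurableSpace E] [StandardBorelSpace E] [Nonempty E]

/-- Conditioning on an independent random variable amounts to freezing it. -/
lemma condExp_ae_eq_integral_of_indepFun {X : Ω → A} {V : Ω → E} (hX : Measurable X)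
    (hV : Measurable V) (h : IndepFun X V P) {F : A × E → ℝ} (hF : Measurable F)
    (hi : Integrable (fun ω => F (X ω, V ω)) P) :
    P[fun ω => F (X ω, V ω) | MeasurableSpace.comap X inferInstance] =ᵐ[P]
      fun ω => ∫ v, F (X ω, v) ∂(P.map V) := by
  have : IsProbabilityMeasure (P.map V) := Measure.isProbabilityMeasure_map hV.aemeasurable
  have h1 := condExp_prod_ae_eq_integral_condDistrib hX hV.aemeasurable hF.stronglyMeasurable hi
  -- By independence the joint law is a product, so the conditional law of `V` is constant.
  have h2 : condDistrib V X P =ᵐ[P.map X] Kernel.const A (P.map V) := by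
    refine condDistrib_ae_eq_of_measure_eq_compProd X hV.aemeasurable ?_
    rw [Measure.compProd_const, (indepFun_iff_map_prod_eq_prod_map_map hX.aemeasurable
      hV.aemeasurable).1 h]
  filter_upwards [h1, ae_of_ae_map hX.aemeasurable h2] with ω e1 e2
  rw [e1, e2]
  rfl

/-- The history is generated by one random variable, the path restricted to `[0, t]`, so
conditioning on it can use a conditional distribution. -/
lemma historySigma_eq_comap {d : ℕ} (Y : ℝ≥0 → Ω → Vec d) (t : ℝ≥0) :
    historySigma Y t = MeasurableSpace.comap (fun ω (s : Set.Iic t) => Y s ω) inferInstance := by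
  have h : (MeasurableSpace.pi : MeasurableSpace (Set.Iic t → Vec d)) =
    ⨆ s : Set.Iic t, MeasurableSpace.comap (fun f => f s) inferInstance := rfl
  rw [historySigma, h, MeasurableSpace.comap_iSup]
  simp only [MeasurableSpace.comap_comp]
  rfl

end Conditioning

/-! ### Filters as normalized path integrals -/

namespace CoupledSystem

variable {X Z Y E : Type} [MeasurableSpace X] [MeasurableSpace Z] [MeasurableSpace Y]
  [MeasurableSpace E] (S : CoupledSystem X Z Y) (κ : Measure E) [IsProbabilityMeasure κ]
  (Ψ : X × X → E → Z)

/-- The chain at one level, driven by the noise `ζ`. -/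
def chain (s : Bool) (ζ : ℕ → E) : ℕ → X
  | 0 => S.x0
  | n + 1 => S.e s (Ψ (chain s ζ n, chain s ζ n) (ζ n))

/-- The path of the chain over the `n`-th unit time interval. -/
def chainPath (s : Bool) (ζ : ℕ → E) (n : ℕ) : Z := Ψ (S.chain Ψ s ζ n, S.chain Ψ s ζ n) (ζ n)

/-- The weight of the chain at time `n`. -/
def chainWeight (s : Bool) (n : ℕ) (ζ : ℕ → E) (y : ℕ → Y) : ℝ :=
  ∏ p ∈ Finset.range n, S.g s (S.chainPath Ψ s ζ p) (y p)

/-- The unnormalized filter of the chain. -/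
def unnorm (n : ℕ) (φ : Bool → X → (ℕ → Y) → ℝ) (s : Bool) (y : ℕ → Y) : ℝ :=
  ∫ ζ, φ s (S.chain Ψ s ζ n) y * S.chainWeight Ψ s n ζ y ∂(seqLaw κ)

variable {S κ Ψ} {s : Bool} {φ : Bool → X → (ℕ → Y) → ℝ} {n : ℕ}

lemma measurable_chain (hΨ : Measurable (Function.uncurry Ψ)) (n : ℕ) :
    Measurable fun ζ => S.chain Ψ s ζ n := by
  induction n with
  | zero => exact measurable_const
  | succ n ih =>
    exact (S.measurable_e s).comp (hΨ.comp ((ih.prodMk ih).prodMk (measurable_pi_apply n)))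

lemma measurable_chainPath (hΨ : Measurable (Function.uncurry Ψ)) (n : ℕ) :
    Measurable fun ζ => S.chainPath Ψ s ζ n :=
  hΨ.comp (((measurable_chain hΨ n).prodMk (measurable_chain hΨ n)).prodMk (measurable_pi_apply n))

lemma measurable_chainWeight (hΨ : Measurable (Function.uncurry Ψ)) (n : ℕ) :
    Measurable fun q : (ℕ → Y) × (ℕ → E) => S.chainWeight Ψ s n q.2 q.1 := by
  refine Finset.measurable_fun_prod _ fun p _ => ?_
  exact (S.measurable_g s).comp (((measurable_chainPath hΨ p).comp measurable_snd).prodMk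
    ((measurable_pi_apply p).comp measurable_fst))

lemma chain_congr {ζ ζ' : ℕ → E} (h : ∀ i < n, ζ i = ζ' i) :
    S.chain Ψ s ζ n = S.chain Ψ s ζ' n := by
  induction n with
  | zero => rfl
  | succ n ih =>
    simp only [chain]
    rw [ih fun i hi => h i (Nat.lt_succ_of_lt hi), h n (Nat.lt_succ_self n)]

lemma chainWeight_congr {ζ ζ' : ℕ → E} (h : ∀ i < n, ζ i = ζ' i) (y : ℕ → Y) :
    S.chainWeight Ψ s n ζ y = S.chainWeight Ψ s n ζ' y := by
  refine Finset.prod_congr rfl fun p hp => ?_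
  have hp := Finset.mem_range.1 hp
  rw [chainPath, chainPath, chain_congr fun i hi => h i (hi.trans hp), h p hp]

lemma chainWeight_pos (n : ℕ) (ζ : ℕ → E) (y : ℕ → Y) : 0 < S.chainWeight Ψ s n ζ y :=
  Finset.prod_pos fun _ _ => S.g_pos s _ _

lemma chainWeight_le (n : ℕ) (y : ℕ → Y) : ∃ c, ∀ ζ, S.chainWeight Ψ s n ζ y ≤ c := by
  choose c hc using fun p => S.g_upper s (y p)
  exact ⟨∏ p ∈ Finset.range n, c p, fun ζ => Finset.prod_le_prod (fun p _ => (S.g_pos s _ _).le)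
    fun p _ => hc p _⟩

lemma integrable_chain (hΨ : Measurable (Function.uncurry Ψ))
    (hφ : Measurable (Function.uncurry (φ s))) (hb : ∀ y, ∃ c, ∀ x, |φ s x y| ≤ c) (y : ℕ → Y) :
    Integrable (fun ζ => φ s (S.chain Ψ s ζ n) y * S.chainWeight Ψ s n ζ y) (seqLaw κ) := by
  obtain ⟨c, hc⟩ := hb y
  obtain ⟨b, hb⟩ := chainWeight_le (S := S) (Ψ := Ψ) (s := s) n y
  have h1 : Measurable fun ζ => φ s (S.chain Ψ s ζ n) y :=
    hφ.comp ((measurable_chain hΨ n).prodMk measurable_const)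
  have h2 : Measurable fun ζ => S.chainWeight Ψ s n ζ y :=
    (measurable_chainWeight hΨ n).comp (measurable_const.prodMk measurable_id)
  refine integrable_of_abs_le (c := c * b) (h1.mul h2) fun ζ => ?_
  have hw := chainWeight_pos (S := S) (Ψ := Ψ) (s := s) n ζ y
  rw [abs_mul, abs_of_pos hw]
  exact mul_le_mul (hc _) (hb ζ) hw.le ((abs_nonneg _).trans (hc (S.chain Ψ s ζ n)))

lemma integral_seqLaw_coord (k : ℕ) {F : (ℕ → E) → E → ℝ}
    (hF : Measurable (Function.uncurry F)) (hi : Integrable (fun ζ => F ζ (ζ k)) (seqLaw κ))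
    (hd : ∀ ζ ζ' z, (∀ i < k, ζ i = ζ' i) → F ζ z = F ζ' z) :
    ∫ ζ, F ζ (ζ k) ∂(seqLaw κ) = ∫ ζ, ∫ z, F ζ z ∂κ ∂(seqLaw κ) := by
  have hm : Measurable fun ζ : ℕ → E => F ζ (ζ k) :=
    hF.comp (measurable_id.prodMk (measurable_pi_apply k))
  have hp := measurePreserving_update κ k
  have e : ∀ q : (ℕ → E) × E, F (Function.update q.1 k q.2) (Function.update q.1 k q.2 k) =
      F q.1 q.2 := fun q => by
    simp only [Function.update_self]
    exact hd _ _ _ fun i hi => Function.update_of_ne hi.ne _ _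
  have hi2 : Integrable (fun q : (ℕ → E) × E => F q.1 q.2) ((seqLaw κ).prod κ) := by
    have := hp.integrable_comp_of_integrable hi
    simpa only [Function.comp_def, e] using this
  rw [← hp.map_eq, integral_map hp.measurable.aemeasurable (by
    rw [hp.map_eq]; exact hm.aestronglyMeasurable)]
  simp only [e]
  rw [integral_prod _ hi2, hp.map_eq]

/-- The last noise block is independent of the chain and weight up to time `n`; integrating it first
produces the backward operator. -/
lemma unnorm_succ (hΨ : Measurable (Function.uncurry Ψ)) (hK : ∀ x, S.K x = κ.map (Ψ x))
    (hφ : Measurable (Function.uncurry (φ s))) (hb : ∀ y, ∃ c, ∀ x, |φ s x y| ≤ c) (y : ℕ → Y) :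
    S.unnorm κ Ψ (n + 1) φ s y = S.unnorm κ Ψ n (S.step n φ) s y := by
  have hg : Measurable fun z => S.gf n φ s z y := measurable_gf_left hφ y
  have e : ∀ ζ, φ s (S.chain Ψ s ζ (n + 1)) y * S.chainWeight Ψ s (n + 1) ζ y =
      S.gf n φ s (Ψ (S.chain Ψ s ζ n, S.chain Ψ s ζ n) (ζ n)) y * S.chainWeight Ψ s n ζ y := by
    intro ζ
    rw [chainWeight, Finset.prod_range_succ, ← chainWeight, gf, chain, chainPath]
    ring
  have hi := integrable_chain (S := S) (κ := κ) (n := n + 1) hΨ hφ hb y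
  rw [unnorm]
  simp only [e] at hi ⊢
  rw [integral_seqLaw_coord n (F := fun ζ z => S.gf n φ s (Ψ (S.chain Ψ s ζ n, S.chain Ψ s ζ n) z) y *
    S.chainWeight Ψ s n ζ y) ?_ hi ?_]
  · rw [unnorm]
    refine integral_congr_ae (ae_of_all _ fun ζ => ?_)
    simp only
    have hm : Measurable (Ψ (S.chain Ψ s ζ n, S.chain Ψ s ζ n)) := hΨ.comp measurable_prodMk_left
    rw [integral_mul_const, step, hK, integral_map hm.aemeasurable hg.aestronglyMeasurable]
  · have h1 : Measurable fun q : (ℕ → E) × E => S.chain Ψ s q.1 n :=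
      (measurable_chain hΨ n).comp measurable_fst
    have h2 : Measurable fun q : (ℕ → E) × E => S.chainWeight Ψ s n q.1 y :=
      (measurable_chainWeight hΨ n).comp (measurable_const.prodMk measurable_fst)
    exact (hg.comp (hΨ.comp ((h1.prodMk h1).prodMk measurable_snd))).mul h2
  · intro ζ ζ' z h
    rw [chain_congr h, chainWeight_congr h]

lemma unnorm_one_pos (hΨ : Measurable (Function.uncurry Ψ)) (n : ℕ) (y : ℕ → Y) :
    0 < S.unnorm κ Ψ n one s y := by
  have hi := integrable_chain (S := S) (κ := κ) (s := s) (n := n) (φ := one) hΨ measurable_const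
    (fun _ => ⟨1, fun _ => by simp [one]⟩) y
  rw [unnorm, integral_pos_iff_support_of_nonneg (fun ζ => by
    simpa [one] using (chainWeight_pos n ζ y).le) hi]
  have : Function.support (fun ζ => one s (S.chain Ψ s ζ n) y * S.chainWeight Ψ s n ζ y)
      = Set.univ := by
    ext ζ
    simpa [one] using (chainWeight_pos n ζ y).ne'
  rw [this, measure_univ]
  exact one_pos

/-- The exact filter is the normalized version of the unnormalized filter of the chain. -/
theorem exactInt_eq_unnorm (hΨ : Measurable (Function.uncurry Ψ))
    (hK : ∀ x, S.K x = κ.map (Ψ x)) (n : ℕ) : ∀ {φ : Bool → X → (ℕ → Y) → ℝ},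
    Measurable (Function.uncurry (φ s)) → (∀ y, ∃ c, ∀ x, |φ s x y| ≤ c) → ∀ y : ℕ → Y,
      S.exactInt n φ s y = S.unnorm κ Ψ n φ s y / S.unnorm κ Ψ n one s y := by
  induction n with
  | zero =>
    intro φ hφ hb y
    rw [exactInt_zero y hφ]
    simp [unnorm, chain, chainWeight, one]
  | succ n ih =>
    intro φ hφ hb y
    have h1 : Measurable (Function.uncurry (one s : X → (ℕ → Y) → ℝ)) := measurable_const
    have h2 : ∀ y : ℕ → Y, ∃ c, ∀ x, |(one s : X → (ℕ → Y) → ℝ) x y| ≤ c :=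
      fun _ => ⟨1, fun _ => by simp [one]⟩
    rw [exactInt_succ hφ hb, ih (measurable_step hφ) (step_bdd hb),
      ih (measurable_step h1) (step_bdd h2), unnorm_succ hΨ hK hφ hb,
      unnorm_succ hΨ hK h1 h2]
    have p1 := (unnorm_one_pos (S := S) (κ := κ) (s := s) hΨ n y).ne'
    have p2 := (unnorm_one_pos (S := S) (κ := κ) (s := s) hΨ (n + 1) y).ne'
    rw [unnorm_succ hΨ hK h1 h2] at p2
    field_simp

end CoupledSystem

end CoupledPF

/-! ### Identification of the discretized filters -/

namespace CoupledPF

lemma sum_double {m n : ℕ} (h : n = m * 2) (F : Fin n → ℝ) :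
    ∑ k, F k = ∑ j : Fin m, (F ⟨2 * j, by lia⟩ + F ⟨2 * j + 1, by lia⟩) := by
  subst h
  rw [← finProdFinEquiv.sum_comp, Fintype.sum_prod_type]
  refine Finset.sum_congr rfl fun j _ => ?_
  rw [Fin.sum_univ_two]
  congr 2
  · exact Fin.ext (by simp [finProdFinEquiv])
  · exact Fin.ext (by simp [finProdFinEquiv]; lia)

lemma prod_range_mul_eq (n m : ℕ) (f : ℕ → ℝ) :
    ∏ k ∈ Finset.range (n * m), f k = ∏ p ∈ Finset.range n, ∏ k : Fin m, f (p * m + k) := by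
  induction n with
  | zero => simp
  | succ n ih =>
    rw [Nat.succ_mul, Finset.prod_range_add, ih, Finset.prod_range_succ,
      Finset.prod_range fun x => f (n * m + x)]

section Grid

variable {d : ℕ}

lemma gridTime_double (l k : ℕ) : gridTime (l + 1) (2 * k) = gridTime l k := by
  unfold gridTime
  push_cast
  rw [pow_succ']
  exact mul_div_mul_left _ _ two_ne_zero

lemma gridInc_coarse (l : ℕ) (y : ℝ≥0 → Vec d) (k : ℕ) :
    gridInc l y k = gridInc (l + 1) y (2 * k) + gridInc (l + 1) y (2 * k + 1) := by
  have e : gridTime (l + 1) (2 * k + 1 + 1) = gridTime l (k + 1) := gridTime_double l (k + 1)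
  rw [gridInc, gridInc, gridInc, e, gridTime_double]
  abel

lemma gridTime_block_le {L n p : ℕ} (hp : p < n) {k : ℕ} (hk : k ≤ 2 ^ L) :
    gridTime L (p * 2 ^ L + k) ≤ n := by
  unfold gridTime
  rw [div_le_iff₀ (by positivity)]
  have h : p * 2 ^ L + k ≤ n * 2 ^ L := by
    calc p * 2 ^ L + k ≤ (p + 1) * 2 ^ L := by rw [Nat.succ_mul]; lia
      _ ≤ n * 2 ^ L := Nat.mul_le_mul_right _ hp
  exact_mod_cast h

/-- Blocks before `n` only use the path up to time `n`; hence the weight is a function of the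
observed history. -/
lemma blocks_congr {L n p : ℕ} (hp : p < n) {y y' : ℝ≥0 → Vec d}
    (h : ∀ t ≤ (n : ℝ≥0), y t = y' t) : blocks L y p = blocks L y' p := by
  funext k
  have e1 := h _ (gridTime_block_le (L := L) hp k.2.le)
  have e2 := h _ (gridTime_block_le (L := L) (k := k + 1) hp k.2)
  rw [blocks, blocks, gridInc, gridInc, e1, add_assoc, e2]

end Grid

namespace FilterModel

variable {dx dy : ℕ} {M : FilterModel dx dy} {B : ℝ≥0} {l : ℕ}

lemma eulerChain_add (l : ℕ) (x : Vec dx) (ξ : ℕ → Vec dx) (a k : ℕ) :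
    M.eulerChain l x ξ (a + k) = M.eulerChain l (M.eulerChain l x ξ a) (fun i => ξ (a + i)) k := by
  induction k with
  | zero => rfl
  | succ k ih => rw [← add_assoc, eulerChain_succ, eulerChain_succ, ih]

lemma extendZero_blocks {L : ℕ} (w : ℝ≥0 → Vec dx) (p : ℕ) {i : ℕ} (hi : i < 2 ^ L) :
    extendZero (blocks L w p) i = gridInc L w (p * 2 ^ L + i) := by
  rw [extendZero, dif_pos hi, blocks]

lemma pairPath_blocks_fst (w : ℝ≥0 → Vec dx) (p : ℕ) (x' : Vec dx) (k : Fin (2 ^ (l + 1) + 1)) :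
    (M.pairPath l (M.eulerChain (l + 1) M.x0 (gridInc (l + 1) w) (p * 2 ^ (l + 1))) x'
      (blocks (l + 1) w p)).1 k =
      M.eulerChain (l + 1) M.x0 (gridInc (l + 1) w) (p * 2 ^ (l + 1) + k) := by
  rw [eulerChain_add]
  exact eulerChain_congr fun i hi => extendZero_blocks w p (by lia)

lemma pairPath_blocks_snd (w : ℝ≥0 → Vec dx) (p : ℕ) (x : Vec dx) (k : Fin (2 ^ l + 1)) :
    (M.pairPath l x (M.eulerChain l M.x0 (gridInc l w) (p * 2 ^ l)) (blocks (l + 1) w p)).2 k =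
      M.eulerChain l M.x0 (gridInc l w) (p * 2 ^ l + k) := by
  rw [eulerChain_add]
  refine eulerChain_congr fun i hi => ?_
  have := pow_succ 2 l
  have e : p * 2 ^ (l + 1) + 2 * i = 2 * (p * 2 ^ l + i) := by rw [this]; ring
  rw [extendZero_blocks w p (by lia), extendZero_blocks w p (by lia), ← add_assoc, e]
  exact (gridInc_coarse l w _).symm

lemma potential_eq (l k : ℕ) (y : ℝ≥0 → Vec dy) (x : Vec dx) :
    M.potential l k y x =
      Real.exp (inner ℝ (M.h x) (gridInc l y k) - stepSize l / 2 * ‖M.h x‖ ^ 2) := by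
  rw [potential, real_inner_self_eq_norm_sq, gridInc]

lemma pathPotential_fine (p : ℕ) (y : ℝ≥0 → Vec dy) (z : PathPair dx l) :
    M.pathPotential (l + 1) p y z.1 = expWeight (M.obs true z) (blocks (l + 1) y p) := by
  simp only [pathPotential, potential_eq]
  rw [← Real.exp_sum, Finset.sum_sub_distrib, ← Finset.mul_sum]
  rfl

/-- The coarse value of `h` is constant over two fine steps, the two data increments add up and the
step sizes too. So both levels are weights of the same fine data block. -/
lemma pathPotential_coarse (p : ℕ) (y : ℝ≥0 → Vec dy) (z : PathPair dx l) :
    M.pathPotential l p y z.2 = expWeight (M.obs false z) (blocks (l + 1) y p) := by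
  simp only [pathPotential, potential_eq]
  rw [← Real.exp_sum, expWeight, linForm, Finset.mul_sum, ← Finset.sum_sub_distrib,
    sum_double (pow_succ 2 l)]
  congr 1
  refine Finset.sum_congr rfl fun j _ => ?_
  have h1 : half (⟨2 * j, by have := pow_succ 2 l; lia⟩ : Fin (2 ^ (l + 1))) = j.castSucc :=
    Fin.ext (by simp [half])
  have h2 : half (⟨2 * j + 1, by have := pow_succ 2 l; lia⟩ : Fin (2 ^ (l + 1))) = j.castSucc :=
    Fin.ext (by simp [half]; lia)
  have e : p * 2 ^ (l + 1) + 2 * j = 2 * (p * 2 ^ l + j) := by rw [pow_succ]; ring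
  simp only [obs, h1, h2, blocks]
  rw [gridInc_coarse, inner_add_right, stepSize_succ l, ← add_assoc, e]
  ring

/-- The resolution of the level. -/
def lev (s : Bool) (l : ℕ) : ℕ := bif s then l + 1 else l

lemma chain_eq (hB : M.Bounds B) (l : ℕ) (s : Bool) (w : ℝ≥0 → Vec dx) (n : ℕ) :
    (system hB l).chain (fun x => M.pairPath l x.1 x.2) s (blocks (l + 1) w) n =
      M.eulerChain (lev s l) M.x0 (gridInc (lev s l) w) (n * 2 ^ lev s l) := by
  induction n with
  | zero => rw [Nat.zero_mul]; rfl
  | succ n ih =>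
    rw [CoupledSystem.chain, ih]
    cases s
    · refine (pairPath_blocks_snd (M := M) (l := l) w n
        (M.eulerChain l M.x0 (gridInc l w) (n * 2 ^ l)) (Fin.last _)).trans ?_
      rw [Nat.succ_mul]
      rfl
    · refine (pairPath_blocks_fst (M := M) (l := l) w n
        (M.eulerChain (l + 1) M.x0 (gridInc (l + 1) w) (n * 2 ^ (l + 1))) (Fin.last _)).trans ?_
      rw [Nat.succ_mul]
      rfl

lemma chainWeight_eq (hB : M.Bounds B) (l : ℕ) (s : Bool) (w : ℝ≥0 → Vec dx) (y : ℝ≥0 → Vec dy)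
    (n : ℕ) :
    (system hB l).chainWeight (fun x => M.pairPath l x.1 x.2) s n (blocks (l + 1) w)
        (blocks (l + 1) y) =
      ∏ k ∈ Finset.range (n * 2 ^ lev s l),
        M.potential (lev s l) k y (M.eulerChain (lev s l) M.x0 (gridInc (lev s l) w) k) := by
  rw [prod_range_mul_eq]
  refine Finset.prod_congr rfl fun p _ => ?_
  rw [CoupledSystem.chainPath, chain_eq]
  cases s
  · refine (pathPotential_coarse p y _).symm.trans ?_
    refine Finset.prod_congr rfl fun k _ => ?_
    congr 1
    exact pairPath_blocks_snd w p _ k.castSucc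
  · refine (pathPotential_fine p y _).symm.trans ?_
    refine Finset.prod_congr rfl fun k _ => ?_
    congr 1
    exact pairPath_blocks_fst w p _ k.castSucc

lemma measurable_noise (hB : M.Bounds B) (l : ℕ) :
    Measurable (Function.uncurry fun x : Vec dx × Vec dx => M.pairPath l x.1 x.2) :=
  measurable_pairPath hB (measurable_fst.comp measurable_fst) (measurable_snd.comp measurable_fst)
    measurable_snd

end FilterModel

namespace CoupledSystem

variable {X Z Y E : Type} [MeasurableSpace X] [MeasurableSpace Z] [MeasurableSpace Y]
  [MeasurableSpace E] {S : CoupledSystem X Z Y} {κ : Measure E} [IsProbabilityMeasure κ]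
  {Ψ : X × X → E → Z} {s : Bool}

lemma exists_chainWeight_lo {C : ℕ → ℝ≥0} (hS : S.Good C) (s : Bool) (n : ℕ) :
    ∃ C', ∀ ζ : ℕ → E, LO (seqLaw S.ν) (S.chainWeight Ψ s n ζ) 1 C' := by
  induction n with
  | zero =>
    refine ⟨fun _ => 1, fun ζ => ?_⟩
    have : S.chainWeight Ψ s 0 ζ = fun _ => 1 := by
      funext y; simp [chainWeight]
    rw [this]
    exact LO.const _ (by simp)
  | succ n ih =>
    obtain ⟨C', h⟩ := ih
    refine ⟨mulC C' C, fun ζ => ?_⟩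
    have h1 : LO (seqLaw S.ν) (fun y => S.g s (S.chainPath Ψ s ζ n) (y n)) 1 C :=
      LO.comp (f := S.g s (S.chainPath Ψ s ζ n)) (T := fun y : ℕ → Y => y n)
        (measurePreserving_eval_infinitePi (fun _ : ℕ => S.ν) n) (hS.g_lo s _)
    have h2 := (h ζ).mul h1
    rw [mul_one] at h2
    have : S.chainWeight Ψ s (n + 1) ζ = fun y => S.chainWeight Ψ s n ζ y *
        S.g s (S.chainPath Ψ s ζ n) (y n) := by
      funext y
      rw [chainWeight, Finset.prod_range_succ, ← chainWeight]
    rw [this]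
    exact h2

/-- For each noise sequence the weight has a first moment over the data with a bound independent of
the noise. The pathwise upper bound depends on the data and would not give this. -/
lemma integrable_chainWeight {C : ℕ → ℝ≥0} (hS : S.Good C) (hΨ : Measurable (Function.uncurry Ψ))
    (s : Bool) (n : ℕ) : Integrable (fun q : (ℕ → Y) × (ℕ → E) => S.chainWeight Ψ s n q.2 q.1)
      ((seqLaw S.ν).prod (seqLaw κ)) := by
  have hm := measurable_chainWeight (S := S) (s := s) hΨ n
  obtain ⟨C', h⟩ := exists_chainWeight_lo (Ψ := Ψ) hS s n
  refine ⟨hm.aestronglyMeasurable, ?_⟩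
  rw [HasFiniteIntegral, lintegral_prod_symm _ hm.enorm.aemeasurable]
  calc _ ≤ ∫⁻ _ : ℕ → E, (C' 1 : ℝ≥0∞) ∂(seqLaw κ) :=
        lintegral_mono fun ζ => by simpa using (h ζ).bound_one
    _ < ⊤ := by simp

end CoupledSystem

namespace FilterModel

variable {dx dy : ℕ} {M : FilterModel dx dy} {B : ℝ≥0} {Ω : Type*} [MeasurableSpace Ω]
  {P : Measure Ω} [IsProbabilityMeasure P] {Y : ℝ≥0 → Ω → Vec dy} {W : ℝ≥0 → Ω → Vec dx}

/-- Extension by zero of a path defined up to time `n`. -/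
def extendPath {d : ℕ} (n : ℝ≥0) (x : Set.Iic n → Vec d) (t : ℝ≥0) : Vec d :=
  if h : t ≤ n then x ⟨t, h⟩ else 0

lemma measurable_extendPath {d : ℕ} (n : ℝ≥0) (t : ℝ≥0) :
    Measurable fun x : Set.Iic n → Vec d => extendPath n x t := by
  unfold extendPath
  split_ifs
  · exact measurable_pi_apply _
  · exact measurable_const

/-- The unnormalized filters are those of the coupled system. -/
lemma unnormFilter_ae_eq (hB : M.Bounds B) (l : ℕ) (s : Bool) (n : ℕ) (hY : IsBrownianVec Y P)
    (hW : IsBrownianVec W P) (hind : IndepFun (fun ω t => Y t ω) (fun ω t => W t ω) P)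
    {φ : Vec dx → ℝ} (hφ : Measurable φ) {c : ℝ} (hb : ∀ x, |φ x| ≤ c) :
    M.unnormFilter P Y W (lev s l) n φ =ᵐ[P] fun ω => (system hB l).unnorm (incrementLaw dx (l + 1))
      (fun x => M.pairPath l x.1 x.2) n (fun _ x _ => φ x) s (blocks (l + 1) fun t => Y t ω) := by
  set S := system hB l with hS
  set Ψ : Vec dx × Vec dx → (Fin (2 ^ (l + 1)) → Vec dx) → PathPair dx l :=
    fun x => M.pairPath l x.1 x.2 with hΨ'
  have hΨ : Measurable (Function.uncurry Ψ) := measurable_noise hB l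
  set X : Ω → Set.Iic (n : ℝ≥0) → Vec dy := fun ω s => Y s ω with hX
  set V : Ω → ℕ → Fin (2 ^ (l + 1)) → Vec dx := fun ω => blocks (l + 1) fun t => W t ω with hV
  -- The path is only observed up to time `n`; it is continued by zero, which does not affect the
  -- weight.
  set yb : (Set.Iic (n : ℝ≥0) → Vec dy) → ℕ → Fin (2 ^ (l + 1)) → Vec dy :=
    fun x => blocks (l + 1) (extendPath n x) with hyb
  have hXm : Measurable X := measurable_pi_lambda _ fun s => hY.measurable s
  have hVm : Measurable V := hW.measurable_blocks (l + 1)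
  have hYm : Measurable fun ω => blocks (l + 1) fun t => Y t ω := hY.measurable_blocks (l + 1)
  have hybm : Measurable yb := measurable_pi_lambda _ fun p => measurable_pi_lambda _ fun k =>
    (measurable_extendPath _ _).sub (measurable_extendPath _ _)
  have hbm : ∀ {d : ℕ}, Measurable fun y : ℝ≥0 → Vec d => blocks (l + 1) y := fun {d} =>
    measurable_pi_lambda _ fun p => measurable_pi_lambda _ fun k =>
      (measurable_pi_apply _).sub (measurable_pi_apply _)
  have hind1 : IndepFun X V P := hind.comp (φ := fun (y : ℝ≥0 → Vec dy) (s : Set.Iic (n : ℝ≥0)) => y s)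
    (ψ := fun w : ℝ≥0 → Vec dx => blocks (l + 1) w) (by fun_prop) hbm
  have hind2 : IndepFun (fun ω => blocks (l + 1) fun t => Y t ω) V P :=
    hind.comp (φ := fun y : ℝ≥0 → Vec dy => blocks (l + 1) y)
      (ψ := fun w : ℝ≥0 → Vec dx => blocks (l + 1) w) hbm hbm
  have hyy : ∀ (ζ : ℕ → Fin (2 ^ (l + 1)) → Vec dx) ω, S.chainWeight Ψ s n ζ (yb (X ω)) =
      S.chainWeight Ψ s n ζ (blocks (l + 1) fun t => Y t ω) := fun ζ ω =>
    Finset.prod_congr rfl fun p hp => by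
      congr 1
      refine blocks_congr (Finset.mem_range.1 hp) fun t ht => ?_
      rw [extendPath, dif_pos ht]
  set F : (Set.Iic (n : ℝ≥0) → Vec dy) × (ℕ → Fin (2 ^ (l + 1)) → Vec dx) → ℝ := fun q =>
    φ (S.chain Ψ s q.2 n) * S.chainWeight Ψ s n q.2 (yb q.1) with hF
  have hFm : Measurable F :=
    (hφ.comp ((CoupledSystem.measurable_chain hΨ n).comp measurable_snd)).mul
      ((CoupledSystem.measurable_chainWeight hΨ n).comp
        ((hybm.comp measurable_fst).prodMk measurable_snd))
  have hlaw : P.map V = seqLaw (incrementLaw dx (l + 1)) := hW.map_blocks (l + 1)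
  have hi : Integrable (fun ω => F (X ω, V ω)) P := by
    have h1 := CoupledSystem.integrable_chainWeight (κ := incrementLaw dx (l + 1))
      (good_system hB l) hΨ s n
    have h2 : (seqLaw S.ν).prod (seqLaw (incrementLaw dx (l + 1))) =
        P.map fun ω => (blocks (l + 1) fun t => Y t ω, V ω) := by
      rw [(indepFun_iff_map_prod_eq_prod_map_map hYm.aemeasurable hVm.aemeasurable).1 hind2, hlaw,
        hY.map_blocks]
      rfl
    rw [h2] at h1
    have h3 := h1.comp_measurable (hYm.prodMk hVm)
    refine (h3.const_mul c).mono' (hFm.comp (hXm.prodMk hVm)).aestronglyMeasurable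
      (ae_of_all _ fun ω => ?_)
    have hw := CoupledSystem.chainWeight_pos (S := S) (Ψ := Ψ) (s := s) n (V ω) (yb (X ω))
    simp only [hF, Function.comp_apply]
    rw [← hyy, Real.norm_eq_abs, abs_mul, abs_of_pos hw]
    exact mul_le_mul_of_nonneg_right (hb _) hw.le
  have h := condExp_ae_eq_integral_of_indepFun hXm hVm hind1 hFm hi
  rw [← historySigma_eq_comap] at h
  have e : (fun ω => φ (M.eulerSignal W (lev s l) (n * 2 ^ lev s l) ω) *
      ∏ k ∈ Finset.range (n * 2 ^ lev s l),
        M.potential (lev s l) k (fun t => Y t ω) (M.eulerSignal W (lev s l) k ω)) =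
      fun ω => F (X ω, V ω) := by
    funext ω
    simp only [hF, hyy]
    rw [hV, hS, hΨ', chain_eq, chainWeight_eq]
    rfl
  rw [unnormFilter, e]
  filter_upwards [h] with ω hω
  rw [hω, hlaw, CoupledSystem.unnorm]
  simp only [hF, hyy]

/-- The filters are those of the coupled system. -/
lemma filter_ae_eq (hB : M.Bounds B) (l : ℕ) (s : Bool) (n : ℕ) (hY : IsBrownianVec Y P)
    (hW : IsBrownianVec W P) (hind : IndepFun (fun ω t => Y t ω) (fun ω t => W t ω) P)
    {φ : Vec dx → ℝ} (hφ : Measurable φ) {c : ℝ} (hb : ∀ x, |φ x| ≤ c) :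
    M.filter P Y W (lev s l) n φ =ᵐ[P] fun ω =>
      (system hB l).exactInt n (fun _ x _ => φ x) s (blocks (l + 1) fun t => Y t ω) := by
  have h1 := unnormFilter_ae_eq hB l s n hY hW hind hφ hb
  have h2 := unnormFilter_ae_eq hB l s n hY hW hind (φ := fun _ => 1) measurable_const (c := 1)
    (by simp)
  filter_upwards [h1, h2] with ω e1 e2
  rw [filter, e1, e2, CoupledSystem.exactInt_eq_unnorm (measurable_noise hB l) (fun _ => rfl) n
    (φ := fun _ x _ => φ x) (hφ.comp measurable_fst) (fun _ => ⟨c, hb⟩)]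
  rfl

end FilterModel

end CoupledPF

/-! ### Identification of the coupled particle filter -/

namespace CoupledPF

namespace FilterModel

variable {dx dy : ℕ} {M : FilterModel dx dy} {B : ℝ≥0} {l N : ℕ}

/-- The last of the first `n` generations. -/
def lastGen (hB : M.Bounds B) : (n : ℕ) → (Fin n → Fin N → PathPair dx l) → Fin N → PathPair dx l
  | 0, _ => fun _ => (system hB l).z0
  | p + 1, w => w (Fin.last p)

lemma measurable_lastGen (hB : M.Bounds B) (n : ℕ) :
    Measurable (lastGen hB n : (Fin n → Fin N → PathPair dx l) → _) := by
  cases n with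
  | zero => exact measurable_const
  | succ p => exact measurable_pi_apply (Fin.last p)

lemma fineWeight_eq (hB : M.Bounds B) (p : ℕ) (y : ℝ≥0 → Vec dy) (w : Fin N → PathPair dx l) :
    M.fineWeight l p y w = (system hB l).wt true p (blocks (l + 1) y) w := by
  funext i
  simp only [fineWeight, pathPotential_fine]
  rfl

lemma coarseWeight_eq (hB : M.Bounds B) (p : ℕ) (y : ℝ≥0 → Vec dy) (w : Fin N → PathPair dx l) :
    M.coarseWeight l p y w = (system hB l).wt false p (blocks (l + 1) y) w := by
  funext i
  simp only [coarseWeight, pathPotential_coarse]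
  rfl

lemma nextGeneration_eq [NeZero N] (hB : M.Bounds B) (y : ℝ≥0 → Vec dy) (n : ℕ)
    (w : Fin n → Fin N → PathPair dx l) :
    M.nextGeneration l N y n w = (system hB l).gen n (blocks (l + 1) y, lastGen hB n w) := by
  rw [CoupledSystem.gen_apply]
  cases n with
  | zero => rfl
  | succ p =>
    rw [nextGeneration]
    congr 1
    funext i
    rw [coupledUpdate, fineWeight_eq hB, coarseWeight_eq hB]
    rfl

/-- The law of the next generation uses only the last one, so the history of generations can be
forgotten. -/
lemma cpfLaw_succ [NeZero N] (hB : M.Bounds B) (y : ℝ≥0 → Vec dy) (n : ℕ)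
    {F : (Fin N → PathPair dx l) → ℝ≥0∞} (hF : Measurable F) :
    ∫⁻ w, F (lastGen hB (n + 1) w) ∂(M.cpfLaw l N y (n + 1)) =
      ∫⁻ w, ∫⁻ v, F v ∂((system hB l).gen n (blocks (l + 1) y, lastGen hB n w))
        ∂(M.cpfLaw l N y n) := by
  have hsnoc : Measurable fun q : (Fin n → Fin N → PathPair dx l) × (Fin N → PathPair dx l) =>
      (Fin.snoc q.1 q.2 : Fin (n + 1) → Fin N → PathPair dx l) := by
    refine measurable_pi_lambda _ fun i => ?_
    refine Fin.lastCases ?_ (fun i => ?_) i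
    · simp only [Fin.snoc_last]; exact measurable_snd
    · simp only [Fin.snoc_castSucc]; exact (measurable_pi_apply i).comp measurable_fst
  have hsw : ∀ w : Fin n → Fin N → PathPair dx l, Measurable fun v : Fin N → PathPair dx l =>
      (Fin.snoc w v : Fin (n + 1) → Fin N → PathPair dx l) := fun w =>
    hsnoc.comp measurable_prodMk_left
  have hF' : Measurable fun w : Fin (n + 1) → Fin N → PathPair dx l => F (lastGen hB (n + 1) w) :=
    hF.comp (measurable_lastGen hB (n + 1))
  set κ : Kernel (Fin n → Fin N → PathPair dx l) (Fin N → PathPair dx l) :=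
    ((system hB l).gen n).comap (fun w => (blocks (l + 1) y, lastGen hB n w))
      (measurable_const.prodMk (measurable_lastGen hB n)) with hκ
  -- Integration against `bind` needs this measurability, which is obtained by exhibiting the map as
  -- a kernel.
  have hm : Measurable fun w => (M.nextGeneration l N y n w).map
      fun v => (Fin.snoc w v : Fin (n + 1) → Fin N → PathPair dx l) := by
    have e : (fun w => (M.nextGeneration l N y n w).map
        fun v => (Fin.snoc w v : Fin (n + 1) → Fin N → PathPair dx l)) =
        fun w => ((Kernel.id ×ₖ κ).map fun q => (Fin.snoc q.1 q.2 :
          Fin (n + 1) → Fin N → PathPair dx l)) w := by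
      funext w
      rw [nextGeneration_eq hB, Kernel.map_apply _ hsnoc, Kernel.prod_apply, Kernel.id_apply,
        Measure.dirac_prod, Measure.map_map hsnoc measurable_prodMk_left]
      rfl
    rw [e]
    exact Kernel.measurable _
  rw [cpfLaw, Measure.lintegral_bind hm.aemeasurable hF'.aemeasurable]
  refine lintegral_congr fun w => ?_
  rw [lintegral_map hF' (hsw w), nextGeneration_eq hB]
  refine lintegral_congr fun v => ?_
  rw [lastGen, Fin.snoc_last]

/-- The law of the last generation of the coupled particle filter. -/
lemma lintegral_cpfLaw [NeZero N] (hB : M.Bounds B) (y : ℝ≥0 → Vec dy) (n : ℕ) :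
    ∀ {F : (Fin N → PathPair dx l) → ℝ≥0∞}, Measurable F →
    ∫⁻ w, F (lastGen hB n w) ∂(M.cpfLaw l N y n) =
      ∫⁻ v, F v ∂((system hB l).gens N n (blocks (l + 1) y)) := by
  induction n with
  | zero =>
    intro F hF
    rw [cpfLaw, CoupledSystem.gens, Kernel.const_apply, lintegral_dirac' _ hF,
      lintegral_dirac' (f := fun w => F (lastGen hB 0 w)) _
        (hF.comp (measurable_lastGen hB 0))]
    rfl
  | succ n ih =>
    intro F hF
    rw [cpfLaw_succ hB y n hF, CoupledSystem.lintegral_gens_succ _ _ hF]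
    have hm : Measurable fun w => ∫⁻ v, F v ∂((system hB l).gen n (blocks (l + 1) y, w)) :=
      (hF.lintegral_kernel (κ := (system hB l).gen n)).comp
        (measurable_const.prodMk measurable_id)
    exact ih hm

lemma cpfEstimate_eq (hB : M.Bounds B) (y : ℝ≥0 → Vec dy) (φ : Vec dx → ℝ) (n : ℕ)
    (w : Fin n → Fin N → PathPair dx l) :
    M.cpfEstimate y φ n w =
      (system hB l).partInt n (fun _ x _ => φ x) true (blocks (l + 1) y) (lastGen hB n w)
        - (system hB l).partInt n (fun _ x _ => φ x) false (blocks (l + 1) y) (lastGen hB n w) := by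
  cases n with
  | zero => rfl
  | succ p =>
    rw [cpfEstimate, CoupledSystem.partInt, CoupledSystem.partInt]
    simp only [pathPotential_fine, pathPotential_coarse, div_eq_mul_inv, CoupledSystem.gf_one]
    rfl

end FilterModel

end CoupledPF

/-! ### Normalization of the test function and conclusion -/

namespace CoupledPF

section Scaling

variable {d : ℕ} {φ : Vec d → ℝ}

lemma abs_le_supNorm {E : Type*} {f : E → ℝ} (h : IsBddFun f) (x : E) : |f x| ≤ supNorm f := by
  obtain ⟨K, hK⟩ := h
  exact le_ciSup (f := fun x => |f x|) ⟨K, by rintro _ ⟨x, rfl⟩; exact hK x⟩ x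

lemma supNorm_nonneg {E : Type*} (f : E → ℝ) : 0 ≤ supNorm f :=
  Real.iSup_nonneg fun _ => abs_nonneg _

lemma lipConst_nonneg (φ : Vec d → ℝ) : 0 ≤ lipConst φ := Real.sInf_nonneg fun _ h => h.1

lemma abs_sub_le_lipConst (h : IsLipFun φ) (x y : Vec d) :
    |φ x - φ y| ≤ lipConst φ * ‖x - y‖ := by
  rcases eq_or_ne x y with rfl | hxy
  · simp
  have hp : 0 < ‖x - y‖ := norm_pos_iff.2 (sub_ne_zero.2 hxy)
  rw [← div_le_iff₀ hp]
  obtain ⟨K, hK⟩ := h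
  refine le_csInf ⟨max K 0, le_max_right _ _, fun x y => (hK x y).trans ?_⟩ fun K' h' => ?_
  · gcongr
    exact le_max_left _ _
  · exact (div_le_iff₀ hp).2 (h'.2 x y)

/-- Normalization of a bounded Lipschitz function. -/
lemma exists_normalized (h1 : IsBddFun φ) (h2 : IsLipFun φ) : ∃ ψ : Vec d → ℝ,
    (∀ x, |ψ x| ≤ 1) ∧ (∀ x y, |ψ x - ψ y| ≤ ‖x - y‖) ∧
      φ = fun x => (supNorm φ + lipConst φ) * ψ x := by
  set a := supNorm φ + lipConst φ with ha
  have s0 := supNorm_nonneg φ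
  have l0 := lipConst_nonneg φ
  have ha0 : 0 ≤ a := add_nonneg s0 l0
  have b1 : ∀ x, |φ x| ≤ a := fun x => (abs_le_supNorm h1 x).trans (by linarith)
  have b2 : ∀ x y, |φ x - φ y| ≤ a * ‖x - y‖ := fun x y => (abs_sub_le_lipConst h2 x y).trans (by
    gcongr; linarith)
  have hinv : a⁻¹ * a ≤ 1 := inv_mul_le_one
  have hi : 0 ≤ a⁻¹ := inv_nonneg.2 ha0
  refine ⟨fun x => a⁻¹ * φ x, fun x => ?_, fun x y => ?_, ?_⟩
  · rw [abs_mul, abs_of_nonneg hi]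
    exact (mul_le_mul_of_nonneg_left (b1 x) hi).trans hinv
  · rw [← mul_sub, abs_mul, abs_of_nonneg hi]
    refine (mul_le_mul_of_nonneg_left (b2 x y) hi).trans ?_
    rw [← mul_assoc]
    exact mul_le_of_le_one_left (norm_nonneg _) hinv
  · funext x
    -- If the norm is zero then φ vanishes, and so does its quotient by the default value `0⁻¹ = 0`.
    rcases eq_or_ne a 0 with h0 | h0
    · have := b1 x
      rw [h0] at this ⊢
      rw [zero_mul]
      exact abs_nonpos_iff.1 this
    · rw [← mul_assoc, mul_inv_cancel₀ h0, one_mul]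

end Scaling

namespace FilterModel

variable {dx dy : ℕ} {M : FilterModel dx dy} {B : ℝ≥0}

lemma coe_rate (hB : M.Bounds B) (l N : ℕ) : (((system hB l).rate N : ℝ≥0) : ℝ) =
    stepSize (l + 1) ^ (1 / 2 : ℝ) / (N : ℝ)
      + stepSize (l + 1) ^ (1 / 4 : ℝ) / (N : ℝ) ^ (3 / 2 : ℝ) := by
  have hp := (stepSize_pos (l + 1)).le
  have hN : (0 : ℝ) ≤ N := Nat.cast_nonneg N
  have e1 : (((system hB l).ε : ℝ≥0) : ℝ) = stepSize (l + 1) ^ (1 / 2 : ℝ) := by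
    rw [← Real.sqrt_eq_rpow]; exact coe_strongErr l
  have e2 : ((NNReal.sqrt (system hB l).ε : ℝ≥0) : ℝ) = stepSize (l + 1) ^ (1 / 4 : ℝ) := by
    rw [Real.coe_sqrt, e1, Real.sqrt_eq_rpow, ← Real.rpow_mul hp]
    norm_num
  have e3 : ((fluct N : ℝ≥0) : ℝ) ^ 3 = ((N : ℝ) ^ (3 / 2 : ℝ))⁻¹ := by
    rw [fluct, NNReal.coe_inv, inv_pow, Real.coe_sqrt, NNReal.coe_natCast, Real.sqrt_eq_rpow,
      ← Real.rpow_natCast, ← Real.rpow_mul hN]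
    norm_num
  rw [CoupledSystem.rate, fluct_sq]
  rw [NNReal.coe_add, NNReal.coe_mul, NNReal.coe_mul, NNReal.coe_pow, NNReal.coe_inv,
    NNReal.coe_natCast, e1, e2, e3, ← div_eq_mul_inv, ← div_eq_mul_inv]

lemma ofReal_sq_eq_enorm (x : ℝ) : ENNReal.ofReal (x ^ 2) = ‖x‖ₑ ^ 2 := by
  rw [← sq_abs, ENNReal.ofReal_pow (abs_nonneg x), ← Real.norm_eq_abs, ofReal_norm]

/-- The mean square error of the coupled particle filter in terms of the coupled system. -/
lemma lintegral_error_eq (hB : M.Bounds B) (l n : ℕ) {N : ℕ} [NeZero N] {Ω : Type*}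
    [MeasurableSpace Ω] {P : Measure Ω} [IsProbabilityMeasure P] {Y : ℝ≥0 → Ω → Vec dy}
    {W : ℝ≥0 → Ω → Vec dx} (hY : IsBrownianVec Y P) (hW : IsBrownianVec W P)
    (hind : IndepFun (fun ω t => Y t ω) (fun ω t => W t ω) P) {φ : Vec dx → ℝ} (hφ : Measurable φ)
    {c : ℝ} (hb : ∀ x, |φ x| ≤ c)
    (he : Measurable ((system hB l).err N n fun _ x _ => φ x)) :
    ∫⁻ ω, ∫⁻ w, ENNReal.ofReal ((M.cpfEstimate (fun t => Y t ω) φ n w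
        - (M.filter P Y W (l + 1) n φ ω - M.filter P Y W l n φ ω)) ^ 2)
        ∂(M.cpfLaw l N (fun t => Y t ω) n) ∂P =
      ∫⁻ q, ‖(system hB l).err N n (fun _ x _ => φ x) q‖ₑ ^ 2 ∂((system hB l).joint N n) := by
  set E := (system hB l).err N n fun _ x _ => φ x with hE
  have hm : Measurable fun q => ‖E q‖ₑ ^ 2 := he.enorm.pow_const 2
  have hG : Measurable fun y => ∫⁻ v, ‖E (y, v)‖ₑ ^ 2 ∂((system hB l).gens N n y) :=
    Measurable.lintegral_kernel_prod_right (f := fun y v => ‖E (y, v)‖ₑ ^ 2) hm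
  have h1 := filter_ae_eq hB l true n hY hW hind hφ hb
  have h0 := filter_ae_eq hB l false n hY hW hind hφ hb
  have hae : (fun ω => ∫⁻ w, ENNReal.ofReal ((M.cpfEstimate (fun t => Y t ω) φ n w
        - (M.filter P Y W (l + 1) n φ ω - M.filter P Y W l n φ ω)) ^ 2)
        ∂(M.cpfLaw l N (fun t => Y t ω) n)) =ᵐ[P] fun ω =>
      ∫⁻ v, ‖E (blocks (l + 1) (fun t => Y t ω), v)‖ₑ ^ 2
        ∂((system hB l).gens N n (blocks (l + 1) fun t => Y t ω)) := by
    filter_upwards [h1, h0] with ω e1 e0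
    rw [← lintegral_cpfLaw hB (fun t => Y t ω) n
      (F := fun v => ‖E (blocks (l + 1) (fun t => Y t ω), v)‖ₑ ^ 2) (hm.comp measurable_prodMk_left)]
    refine lintegral_congr fun w => ?_
    have e1' : M.filter P Y W (l + 1) n φ ω = _ := e1
    have e0' : M.filter P Y W l n φ ω = _ := e0
    rw [ofReal_sq_eq_enorm, cpfEstimate_eq hB, e1', e0', hE, CoupledSystem.err]
    congr 2
    ring
  rw [lintegral_congr_ae hae, CoupledSystem.lintegral_joint _ hm]
  have hlaw : seqLaw (system hB l).ν = P.map fun ω => blocks (l + 1) fun t => Y t ω :=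
    (hY.map_blocks (l + 1)).symm
  rw [hlaw, lintegral_map hG (hY.measurable_blocks (l + 1))]

end FilterModel

end CoupledPF

end

theorem mainTheorem2 {dx dy : ℕ} (M : FilterModel dx dy) (hM : M.Regular) (n : ℕ) :
    ∃ C : ℝ, ∀ (l N : ℕ) (φ : Vec dx → ℝ), 1 ≤ N → IsBddFun φ → IsLipFun φ →
      ∀ (Ω : Type*) [MeasurableSpace Ω] (P : Measure Ω) [IsProbabilityMeasure P]
        (Y : ℝ≥0 → Ω → Vec dy) (W : ℝ≥0 → Ω → Vec dx),
        IsBrownianVec Y P → IsBrownianVec W P →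
        IndepFun (fun ω t => Y t ω) (fun ω t => W t ω) P →
        ∫⁻ ω, ∫⁻ w, ENNReal.ofReal
            ((M.cpfEstimate (fun t => Y t ω) φ n w
              - (M.filter P Y W (l + 1) n φ ω - M.filter P Y W l n φ ω)) ^ 2)
            ∂(M.cpfLaw l N (fun t => Y t ω) n) ∂P
          ≤ ENNReal.ofReal (C * (supNorm φ + lipConst φ) ^ 2 *
              (stepSize (l + 1) ^ (1 / 2 : ℝ) / (N : ℝ)
                + stepSize (l + 1) ^ (1 / 4 : ℝ) / (N : ℝ) ^ (3 / 2 : ℝ))) := by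
  obtain ⟨B, hB⟩ := hM.exists_bounds
  -- The constant is fixed before the level, `N`, φ and the probability space. The moment constants
  -- `1` are those of a normalized test function.
  obtain ⟨c, hc⟩ := err_so n (FilterModel.systemC dx B) fun _ => 1
  refine ⟨c, fun l N φ hN hbdd hlip Ω _ P _ Y W hY hW hind => ?_⟩
  have : NeZero N := ⟨by lia⟩
  obtain ⟨ψ, h1, h2, hφψ⟩ := exists_normalized hbdd hlip
  set a := supNorm φ + lipConst φ
  have hnice := FilterModel.nice_system hB l n h1 h2
  have hso := hc _ (FilterModel.good_system hB l) _ hnice N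
  -- The error is linear in φ, so the general case follows from a normalized function and the factor
  -- `a ^ 2`.
  have herr : (FilterModel.system hB l).err N n (fun _ x _ => φ x) =
      fun q => a * (FilterModel.system hB l).err N n (fun _ x _ => ψ x) q := by
    funext q
    rw [hφψ]
    simp only [CoupledSystem.err]
    rw [CoupledSystem.partInt_mul (φ := fun _ x _ => ψ x) (fun _ => a),
      CoupledSystem.partInt_mul (φ := fun _ x _ => ψ x) (fun _ => a),
      CoupledSystem.exactInt_mul (φ := fun _ x _ => ψ x) (fun _ => a),
      CoupledSystem.exactInt_mul (φ := fun _ x _ => ψ x) (fun _ => a)]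
    ring
  have hψ : Measurable ψ :=
    (LipschitzWith.of_dist_le_mul (K := 1) fun x y => by
      rw [Real.dist_eq, dist_eq_norm, NNReal.coe_one, one_mul]; exact h2 x y).continuous.measurable
  have hφ : Measurable φ := by rw [hφψ]; exact hψ.const_mul a
  rw [FilterModel.lintegral_error_eq hB l n hY hW hind hφ (abs_le_supNorm hbdd)
    (by rw [herr]; exact hso.meas.const_mul a), herr]
  simp only [enorm_mul, mul_pow]
  rw [lintegral_const_mul' _ _ (by simp)]
  calc _ ≤ ‖a‖ₑ ^ 2 * (c * ((FilterModel.system hB l).rate N : ℝ≥0∞)) := by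
        gcongr
        exact hso.bound
    _ = _ := by
        rw [← FilterModel.coe_rate hB l N, ← FilterModel.ofReal_sq_eq_enorm, mul_comm (c : ℝ),
          ENNReal.ofReal_mul (by positivity), ENNReal.ofReal_mul (by positivity),
          ENNReal.ofReal_coe_nnreal, ENNReal.ofReal_coe_nnreal, mul_assoc]
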